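/- **Setting.** A connection schedule of period $T\ge 1$ on a finite node set $V$ is a sequence of permutations $\sigma_0,\dots,\sigma_{T-1}$ of $V$; write $\sigma_t=\sigma_{t \bmod T}$ for $t\in\mathbb Z$. Its virtual topology has vertices $V\times\mathbb Z$, a virtual edge $(i,t)\to(i,t+1)$ and a (separate) physical edge $(i,t)\to(\sigma_t(i),t+1)$ for each $(i,t)$. The latency of a finite path is its number of edges, virtual and physical. A flow is a measure on the set of paths; it is feasible if the paths through each physical edge have total measure at most $1$. An oblivious routing protocol is a flow $R$, invariant under translation of time by $T$, such that for all $a,b\in V$, $t\in\mathbb Z$ the paths from $(a,t)$ to $b$ (at any time $t'>t$) have total measure $1$. $R$ guarantees throughput $r$ if, for each $D:V\times V\times\mathbb Z\to[0,\infty)$ with $\sum_b D(a,b,t)\le r$ and $\sum_b D(b,a,t)\le r$ for all $a,t$, the flow obtained from $R$ by multiplying the weight of each path from $(a,t)$ to $b$ by $D(a,b,t)$ is feasible. The maximum latency of $R$ is the supremum of the latencies of the paths of positive measure. A shift schedule on $N$ nodes has $V=\mathbb Z/N$ and $\sigma_k(j)=j+s_k$ with shifts $s_0,\dots,s_{T-1}\in\mathbb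 Z/N$. The $H$-fold convolution power of a shift schedule $s_0,\dots,s_{\Lambda-1}$ is the shift schedule of period $\Lambda^H$ whose shift at time $t=\sum_{j<H}t_j\Lambda^{j}$ ($0\le t_j<\Lambda$) is $\sum_{j<H}s_{t_j}$. Algorithms are programs of a random access machine on natural numbers with addition, truncated subtraction, indirect addressing and zero tests at unit cost; randomized algorithms receive polynomially many (in $N$) independent uniformly random elements of $\mathbb Z/N$. **Theorem.** Let $L^*(h,N)=hN^{1/h}$ and fix a real $\varepsilon>0$. There are a constant $C$, a threshold $N_0$ and an integer $H\ge1$, depending only on $\varepsilon$, such that the following hold, where the programs also depend only on $\varepsilon$. 1. (Multiplicative error.) There is a randomized algorithm, with running time polynomial in $N$, that for every $N\ge N_0$ outputs a uniformly random sequence of shifts in $\mathbb Z/N$ of some polynomially bounded length $T(N)\geq 1$; and there is a deterministic certifier that, given any shift schedule on $N\ge N_0$ nodes, halts in time polynomial in $N$ and the period of the schedule. The certifier accepts the random schedule with probability at least $\frac12$. On each schedule $\sigma$ on $N\ge N_0$ nodes that it accepts, for every integer $1\le h\le\log_2N$ there is an oblivious routing protocol on $\sigma$ that guarantees throughput $\frac1{2h}(1-\varepsilon)$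 and has maximum latency at most $C\,L^*(h,N)\log N$ (so $\tilde O(L^*(h,N))$). 2. (Additive error.) There is a randomized algorithm, with running time polynomial in $N$, that for every $N\ge N_0$ outputs the $H$-fold convolution power of a uniformly random shift schedule of some polynomially bounded period $\Lambda(N)\ge1$; and there is a deterministic certifier, with running time as in 1, that accepts the output with probability at least $\frac12$. On each schedule $\sigma$ on $N\ge N_0$ nodes that it accepts, for every integer $1\le h\le\log_2N$ there is an oblivious routing protocol on $\sigma$ that guarantees throughput $\frac1{2h}-\varepsilon$ and has maximum latency at most $C\,L^*(h,N)$. 3. (Deterministic, multiplicative error.) There is a deterministic algorithm that for every power of two $N$ computes, in time polynomial in $N$, a shift schedule $\sigma$ on $N$ nodes such that for every integer $1\le h\le\log_2N$ there is an oblivious routing protocol on $\sigma$ that guarantees throughput $\frac1{2h}(1-\varepsilon)$ and has maximum latency at most $C\,L^*(h,N)\log N$. -/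

import Mathlib

open scoped ENNReal NNReal

noncomputable section

/-! ## Connection schedules, paths and flows -/

/-- A periodic connection schedule on the node set `V`. -/
structure ConnectionSchedule (V : Type*) where
  period : ℕ
  period_pos : 0 < period
  perm : Fin period → Equiv.Perm V

/-- The permutation in force at timestep `t`, that is, `σ_k` for `t ≡ k` modulo the period. -/
def ConnectionSchedule.at {V : Type*} (σ : ConnectionSchedule V) (t : ℤ) : Equiv.Perm V :=
  σ.perm ⟨(t % (σ.period : ℤ)).toNat, by
    have h : (0 : ℤ) < σ.period := by exact_mod_cast σ.period_pos
    have h1 := Int.emod_nonneg t h.ne'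
    have h2 := Int.emod_lt_of_pos t h
    omega⟩

/-- A finite path in the virtual topology. It starts at the vertex `(src, start)`; the list says for
each timestep whether the path follows the physical edge (`true`) or the virtual edge (`false`)
leaving its current vertex. Physical and virtual edges are distinct edges, even where a
permutation fixes a node. -/
@[ext]
structure NetPath (V : Type*) where
  src : V
  start : ℤ
  moves : List Bool

instance {V : Type*} : MeasurableSpace (NetPath V) := ⊤

instance {V : Type*} : DiscreteMeasurableSpace (NetPath V) := ⟨fun _ => trivial⟩

/-- The node that is reached from node `a` at time `t` by the given moves. -/
def ConnectionSchedule.walk {V : Type*} (σ : ConnectionSchedule V) : V → ℤ → List Bool → V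
  | a, _, [] => a
  | a, t, false :: l => σ.walk a (t + 1) l
  | a, t, true :: l => σ.walk (σ.at t a) (t + 1) l

/-- The final node of a path. -/
def NetPath.dst {V : Type*} (σ : ConnectionSchedule V) (P : NetPath V) : V :=
  σ.walk P.src P.start P.moves

/-- The latency of a path: its number of edges, physical and virtual. -/
def NetPath.latency {V : Type*} (P : NetPath V) : ℕ := P.moves.length

/-- Translation of a path in time. -/
def NetPath.translate {V : Type*} (P : NetPath V) (d : ℤ) : NetPath V :=
  ⟨P.src, P.start + d, P.moves⟩

/-- The paths from `(a, t)` to `(b, t')` for some `t' > t`. -/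
def pathsBetween {V : Type*} (σ : ConnectionSchedule V) (a b : V) (t : ℤ) : Set (NetPath V) :=
  {P | P.src = a ∧ P.start = t ∧ P.dst σ = b ∧ 0 < P.latency}

/-- The paths that contain the physical edge leaving `(i, u)`. -/
def pathsThrough {V : Type*} (σ : ConnectionSchedule V) (i : V) (u : ℤ) : Set (NetPath V) :=
  {P | ∃ l₁ l₂ : List Bool, P.moves = l₁ ++ true :: l₂ ∧
    P.start + (l₁.length : ℤ) = u ∧ σ.walk P.src P.start l₁ = i}

/-- A flow is a measure on the discrete space of paths. -/
abbrev PathFlow (V : Type*) := MeasureTheory.Measure (NetPath V)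

/-- Every physical edge carries at most one unit; virtual edges are uncapacitated. -/
def PathFlow.Feasible {V : Type*} (σ : ConnectionSchedule V) (f : PathFlow V) : Prop :=
  ∀ (i : V) (u : ℤ), f (pathsThrough σ i u) ≤ 1

/-- The flow `f^D`: the weight of a path from `(a, t)` to `b` is multiplied by `D a b t`. -/
def PathFlow.induced {V : Type*} (σ : ConnectionSchedule V) (f : PathFlow V) (D : V → V → ℤ → ℝ≥0) :
    PathFlow V :=
  f.withDensity fun P => (D P.src (P.dst σ) P.start : ℝ≥0∞)

/-- An oblivious routing protocol: a flow, periodic with the period of the schedule, that sends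
exactly one unit from each `(a, t)` to each node `b`. -/
structure IsObliviousRouting {V : Type*} (σ : ConnectionSchedule V) (R : PathFlow V) : Prop where
  periodic : ∀ P : NetPath V, R {P.translate σ.period} = R {P}
  unit : ∀ (a b : V) (t : ℤ), R (pathsBetween σ a b t) = 1

/-- `R` guarantees throughput `r`: it feasibly routes every demand function in which each node sends
and receives at most `r` at each timestep. -/
def GuaranteesThroughput {V : Type*} [Fintype V] (σ : ConnectionSchedule V) (R : PathFlow V)
    (r : ℝ) : Prop :=
  ∀ D : V → V → ℤ → ℝ≥0,
    (∀ (a : V) (t : ℤ), ((∑ b, D a b t : ℝ≥0) : ℝ) ≤ r ∧ ((∑ b, D b a t : ℝ≥0) : ℝ) ≤ r) →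
    (R.induced σ D).Feasible σ

/-- The maximum latency of the paths that carry a positive amount of flow. -/
def maxLatency {V : Type*} (f : PathFlow V) : ℝ≥0∞ :=
  ⨆ (P : NetPath V) (_ : 0 < f {P}), (P.latency : ℝ≥0∞)

/-! ## Shift schedules -/

/-- A shift connection schedule on `ℤ/N`, given by the sequence of its shifts. -/
structure ShiftSchedule (N : ℕ) where
  period : ℕ
  period_pos : 0 < period
  shift : Fin period → ZMod N

/-- The connection schedule `σ_k(j) = j + s_k`. -/
def ShiftSchedule.toConnectionSchedule {N : ℕ} (s : ShiftSchedule N) :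
    ConnectionSchedule (ZMod N) where
  period := s.period
  period_pos := s.period_pos
  perm k := Equiv.addRight (s.shift k)

/-- The shift schedule whose shifts are the first `T` entries of `w`. -/
def ShiftSchedule.ofPrefix {N m : ℕ} (w : Fin m → ZMod N) (T : ℕ) (hT : 0 < T) (hm : T ≤ m) :
    ShiftSchedule N where
  period := T
  period_pos := hT
  shift i := w (Fin.castLE hm i)

/-- The `H`-fold convolution power of a shift schedule of period `L`: it has period `L ^ H`, and its
shift at the timestep with base-`L` digits `t_0, …, t_{H-1}` is the sum of the shifts of the
base schedule at `t_0, …, t_{H-1}`. -/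
def ShiftSchedule.convPow {N : ℕ} (S : ShiftSchedule N) (H : ℕ) : ShiftSchedule N where
  period := S.period ^ H
  period_pos := pow_pos S.period_pos H
  shift t := ∑ j : Fin H,
    S.shift ⟨(t : ℕ) / S.period ^ (j : ℕ) % S.period, Nat.mod_lt _ S.period_pos⟩

/-- `L*(h, N) = h N^{1/h}`. -/
def Lstar (h N : ℕ) : ℝ := (h : ℝ) * (N : ℝ) ^ (1 / (h : ℝ))

/-- For every hop count `1 ≤ h ≤ log₂ N` there is an oblivious routing protocol on the schedule with
guaranteed throughput `thr h` and maximum latency at most `lat h`. -/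
def SupportsAllHopCounts {N : ℕ} [NeZero N] (s : ShiftSchedule N) (thr lat : ℕ → ℝ) : Prop :=
  ∀ h : ℕ, 1 ≤ h → (h : ℝ) ≤ Real.logb 2 N →
    ∃ R : PathFlow (ZMod N), IsObliviousRouting s.toConnectionSchedule R ∧
      GuaranteesThroughput s.toConnectionSchedule R (thr h) ∧
      maxLatency R ≤ ENNReal.ofReal (lat h)

/-! ## A random access machine with a step count

Registers and array cells hold natural numbers. The arithmetic instructions are addition and
truncated subtraction, at unit cost; there is no multiplication, so that numbers gain at most one
bit per step and polynomial time is the usual notion. -/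

/-- Programs. Registers and arrays are named by natural numbers. -/
inductive Prog where
  /-- `reg d := n` -/
  | const (d n : ℕ)
  /-- `reg d := reg a + reg b` -/
  | add (d a b : ℕ)
  /-- `reg d := reg a - reg b`, truncated at zero -/
  | sub (d a b : ℕ)
  /-- `reg d := arr A [reg i]` -/
  | load (d A i : ℕ)
  /-- `arr A [reg i] := reg a` -/
  | store (A i a : ℕ)
  /-- `p; q` -/
  | seq (p q : Prog)
  /-- if `reg a ≠ 0` then `p` else `q` -/
  | ite (a : ℕ) (p q : Prog)
  /-- while `reg a ≠ 0` do `p` -/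
  | while (a : ℕ) (p : Prog)

/-- The memory of the machine. -/
structure MachineState where
  reg : ℕ → ℕ
  arr : ℕ → ℕ → ℕ

/-- Assignment to a register. -/
def MachineState.setReg (st : MachineState) (d v : ℕ) : MachineState :=
  { st with reg := Function.update st.reg d v }

/-- Assignment to an array cell. -/
def MachineState.setArr (st : MachineState) (A i v : ℕ) : MachineState :=
  { st with arr := Function.update st.arr A (Function.update (st.arr A) i v) }

/-- `Exec p st st' n`: started in `st`, the program `p` halts in `st'` after exactly `n` steps. -/
inductive Exec : Prog → MachineState → MachineState → ℕ → Prop where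
  | const (d n : ℕ) (st : MachineState) : Exec (.const d n) st (st.setReg d n) 1
  | add (d a b : ℕ) (st : MachineState) :
      Exec (.add d a b) st (st.setReg d (st.reg a + st.reg b)) 1
  | sub (d a b : ℕ) (st : MachineState) :
      Exec (.sub d a b) st (st.setReg d (st.reg a - st.reg b)) 1
  | load (d A i : ℕ) (st : MachineState) :
      Exec (.load d A i) st (st.setReg d (st.arr A (st.reg i))) 1
  | store (A i a : ℕ) (st : MachineState) :
      Exec (.store A i a) st (st.setArr A (st.reg i) (st.reg a)) 1
  | seq {p q : Prog} {st₁ st₂ st₃ : MachineState} {m n : ℕ} :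
      Exec p st₁ st₂ m → Exec q st₂ st₃ n → Exec (.seq p q) st₁ st₃ (m + n)
  | ite_true {a : ℕ} {p q : Prog} {st st' : MachineState} {n : ℕ} :
      st.reg a ≠ 0 → Exec p st st' n → Exec (.ite a p q) st st' (n + 1)
  | ite_false {a : ℕ} {p q : Prog} {st st' : MachineState} {n : ℕ} :
      st.reg a = 0 → Exec q st st' n → Exec (.ite a p q) st st' (n + 1)
  | while_true {a : ℕ} {p : Prog} {st₁ st₂ st₃ : MachineState} {m n : ℕ} :
      st₁.reg a ≠ 0 → Exec p st₁ st₂ m → Exec (.while a p) st₂ st₃ n →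
      Exec (.while a p) st₁ st₃ (m + n + 1)
  | while_false {a : ℕ} {p : Prog} {st : MachineState} :
      st.reg a = 0 → Exec (.while a p) st st 1

/-- The initial memory for the input consisting of `N` and a sequence `x` of `m` elements of `ℤ/N`:
register 0 holds `N`, register 1 holds `m`, array 0 holds the representatives in `0, …, N - 1`
of the entries of `x`, and everything else is zero. -/
def inputState (N : ℕ) {m : ℕ} (x : Fin m → ZMod N) : MachineState where
  reg r := if r = 0 then N else if r = 1 then m else 0
  arr A i := if h : A = 0 ∧ i < m then (x ⟨i, h.2⟩).val else 0

/-- In the final memory `st` the output is the shift schedule `s`: register 1 holds the period, and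
array 0 the shifts. -/
def IsOutput {N : ℕ} (st : MachineState) (s : ShiftSchedule N) : Prop :=
  st.reg 1 = s.period ∧ ∀ i : Fin s.period, st.arr 0 i = (s.shift i).val

/-- On input `N` and `x`, the program `G` outputs `s` within `B` steps. -/
def ComputesWithin {N m : ℕ} (G : Prog) (x : Fin m → ZMod N) (s : ShiftSchedule N) (B : ℕ) :
    Prop :=
  ∃ (st : MachineState) (n : ℕ), Exec G (inputState N x) st n ∧ n ≤ B ∧ IsOutput st s

/-- On input the shift schedule `s`, the program `V` halts within `B` steps. -/
def HaltsWithin {N : ℕ} (V : Prog) (s : ShiftSchedule N) (B : ℕ) : Prop :=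
  ∃ (st : MachineState) (n : ℕ), Exec V (inputState N s.shift) st n ∧ n ≤ B

/-- On input the shift schedule `s`, the program `V` halts with the value 1 in register 0. -/
def Accepts {N : ℕ} (V : Prog) (s : ShiftSchedule N) : Prop :=
  ∃ (st : MachineState) (n : ℕ), Exec V (inputState N s.shift) st n ∧ st.reg 0 = 1

/-- The probability of the event `E` under the uniform distribution on a finite set. -/
def unifProb {Ω : Type*} [Fintype Ω] [Nonempty Ω] (E : Set Ω) : ℝ≥0∞ :=
  (PMF.uniformOfFintype Ω).toOuterMeasure E

/-- For network size `N`: from `m` independent uniformly random elements `w` of `ℤ/N`, the program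
`G` computes the schedule `S w` in time `q(N)`; the program `V` halts on every shift schedule `s`
on `N` nodes in time `q(N + period of s)` and accepts only schedules that are `good`; and `V`
accepts the random schedule `S w` with probability at least `1/2`. -/
def SamplesAndCertifies {N m : ℕ} [NeZero N] (G V : Prog) (q : Polynomial ℕ)
    (S : (Fin m → ZMod N) → ShiftSchedule N) (good : ShiftSchedule N → Prop) : Prop :=
  (∀ w : Fin m → ZMod N, ComputesWithin G w (S w) (q.eval N)) ∧
  (∀ s : ShiftSchedule N, HaltsWithin V s (q.eval (N + s.period))) ∧
  (∀ s : ShiftSchedule N, Accepts V s → good s) ∧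
  1 / 2 ≤ unifProb {w : Fin m → ZMod N | Accepts V (S w)}

end

noncomputable section

/-! ## Oblivious routing from randomized semi-routes -/

/-! Everything is reduced to random half-routes. A `SemiRoute` picks, for each starting time, a
random set of slots within a window of length L in which to follow the physical edge, so that the
displacement is exactly uniform on ℤ/N and the total weight with which any time slot is used, over
all starting times, is at most Φ. Two consecutive independent half-routes, conditioned on their
total displacement, form an oblivious routing (Valiant's load balancing). For a given edge, the
slots of the half that crosses it determine where that half began or where the path ends, and
averaging over the other, uniform half turns the demand into a row sum or a column sum. Each half
therefore loads the edge by at most rΦ, and throughput r is guaranteed as soon as 2rΦ ≤ 1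
(`SemiRoute.guaranteesThroughput`). It remains to find half-routes with Φ close to h and L of the
order of h N^{1/h}, up to a logarithm where that is allowed.

On a random schedule, take one hop in each of h consecutive blocks of length l, where l is a large
constant times N^{1/h}. The l^h possible sums are pairwise independent, so by a second moment
computation their counts fall short of uniform by a small fraction on average
(`expect_tableDeficit_le`). Sequences are weighted so that none exceeds l^{-h} and no residue
exceeds 1/N. The missing mass, at most 1/p, is supplied by two rounds of 10h hops in shorter blocks,
whose counts are all at least half of the average; this adds at most 40h/p to the load
(`load_fallbackRoute_le`).

The small average deficit has to hold at every starting time, which needs concentration, obtained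
from a bounded differences inequality in two ways. For bounded h the independent coordinates are the
columns of a single window; there are at least N^{1/h} of them, which beats log N
(`prob_single_window`). For general h the deficit is averaged over a number of windows proportional
to log N, among which the route waits at random (`prob_windows`); this costs a factor log N in
latency. For additive error only h < 1/(2ε) requires positive throughput, so single windows suffice
for the bounded h, and all other h need only connectivity within O(log N) steps. Hence a plain
random schedule serves, and the convolution power is taken with H = 1.

Soundness uses only inequalities between block counts. The certifier computes these counts by
iterated convolution in polynomial time and accepts exactly when the inequalities hold
(`accepts_certifier_iff`); a union bound over times and hop counts gives acceptance with probability
at least 1/2 (`prob_not_certified_le`).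

For N = 2^n the shifts are all rotations of all n-bit numbers. In an aligned window of 2^K n slots
the low K bits run through all values while the high bits stay fixed. Hops whose rotation advances
by K from window to window therefore choose hK ≥ n cyclically consecutive binary digits freely. The
sum is exactly uniform, with load h and no fallback (`rotationRoute`). -/

theorem ConnectionSchedule.walk_append {V : Type*} (σ : ConnectionSchedule V) (l₁ l₂ : List Bool) :
    ∀ (a : V) (t : ℤ), σ.walk a t (l₁ ++ l₂) = σ.walk (σ.walk a t l₁) (t + l₁.length) l₂ := by
  induction l₁ with
  | nil => intro a t; simp [ConnectionSchedule.walk]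
  | cons x l ih =>
    intro a t
    cases x <;>
    · simp only [List.cons_append, ConnectionSchedule.walk, ih, List.length_cons]
      congr 1
      push_cast
      ring

namespace ShiftSchedule

variable {N : ℕ}

/-- The shift in force at timestep `t`. -/
def shiftAt (s : ShiftSchedule N) (t : ℤ) : ZMod N :=
  s.shift ⟨(t % (s.period : ℤ)).toNat, by
    have h : (0 : ℤ) < s.period := by exact_mod_cast s.period_pos
    have h1 := Int.emod_nonneg t h.ne'
    have h2 := Int.emod_lt_of_pos t h
    omega⟩

theorem toConnectionSchedule_at (s : ShiftSchedule N) (t : ℤ) :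
    s.toConnectionSchedule.at t = Equiv.addRight (s.shiftAt t) := rfl

theorem shiftAt_add_period (s : ShiftSchedule N) (t : ℤ) :
    s.shiftAt (t + s.period) = s.shiftAt t := by
  simp [shiftAt]

/-- The displacement caused by the physical edges taken at the times `t + i`, `i ∈ S`. -/
def disp (s : ShiftSchedule N) (t : ℤ) (S : Finset ℕ) : ZMod N := ∑ i ∈ S, s.shiftAt (t + i)

end ShiftSchedule

/-- The moves of a path of latency `L` that takes physical edges exactly at the offsets in `S`. -/
def movesOf (S : Finset ℕ) (L : ℕ) : List Bool := (List.range L).map fun i => decide (i ∈ S)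

@[simp]
theorem length_movesOf (S : Finset ℕ) (L : ℕ) : (movesOf S L).length = L := by simp [movesOf]

theorem movesOf_succ (S : Finset ℕ) (L : ℕ) :
    movesOf S (L + 1) = movesOf S L ++ [decide (L ∈ S)] := by
  simp [movesOf, List.range_succ]

theorem take_movesOf (S : Finset ℕ) {k L : ℕ} (h : k ≤ L) :
    (movesOf S L).take k = movesOf S k := by
  simp [movesOf, ← List.map_take, List.take_range, h]

theorem walk_movesOf {N : ℕ} (s : ShiftSchedule N) (a : ZMod N) (t : ℤ) (S : Finset ℕ) (k : ℕ) :
    s.toConnectionSchedule.walk a t (movesOf S k) = a + s.disp t (S.filter (· < k)) := by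
  induction k with
  | zero => simp [movesOf, ConnectionSchedule.walk, ShiftSchedule.disp]
  | succ k ih =>
    rw [movesOf_succ, ConnectionSchedule.walk_append, ih, length_movesOf]
    by_cases hk : k ∈ S
    · have : S.filter (· < k + 1) = insert k (S.filter (· < k)) := by
        ext i; simp only [Finset.mem_filter, Finset.mem_insert]
        constructor
        · rintro ⟨h1, h2⟩
          rcases Nat.lt_succ_iff_lt_or_eq.1 h2 with h | h
          · exact Or.inr ⟨h1, h⟩
          · exact Or.inl h
        · rintro (rfl | ⟨h1, h2⟩)
          · exact ⟨hk, Nat.lt_succ_self _⟩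
          · exact ⟨h1, by omega⟩
      rw [this]
      simp only [hk, decide_true, ConnectionSchedule.walk,
        ShiftSchedule.toConnectionSchedule_at, ShiftSchedule.disp]
      rw [Finset.sum_insert (by simp)]
      simp only [Equiv.coe_addRight]
      ring
    · have : S.filter (· < k + 1) = S.filter (· < k) := by
        ext i; simp only [Finset.mem_filter]
        constructor
        · rintro ⟨h1, h2⟩
          refine ⟨h1, ?_⟩
          rcases Nat.lt_succ_iff_lt_or_eq.1 h2 with h | h
          · exact h
          · exact absurd (h ▸ h1) hk
        · rintro ⟨h1, h2⟩
          exact ⟨h1, by omega⟩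
      rw [this]
      simp [hk, ConnectionSchedule.walk]

theorem mem_pathsThrough_movesOf {N : ℕ} (s : ShiftSchedule N) (a i : ZMod N) (t u : ℤ)
    (S : Finset ℕ) (L : ℕ)
    (h : (⟨a, t, movesOf S L⟩ : NetPath (ZMod N)) ∈ pathsThrough s.toConnectionSchedule i u) :
    ∃ k ∈ S, k < L ∧ t + k = u ∧ a + s.disp t (S.filter (· < k)) = i := by
  obtain ⟨l₁, l₂, h1, h2, h3⟩ := h
  dsimp only at h1 h2 h3
  have hlen : l₁.length < L := by
    have := congrArg List.length h1
    simp at this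
    omega
  have hl₁ : l₁ = movesOf S l₁.length := by
    rw [← take_movesOf S hlen.le, h1, List.take_left]
  have hk : l₁.length ∈ S := by
    have h4 : (movesOf S L)[l₁.length]? = some true := by
      rw [h1]; simp
    simpa [movesOf, hlen] using h4
  refine ⟨l₁.length, hk, hlen, h2, ?_⟩
  rw [← walk_movesOf, ← hl₁, h3]

/-- A periodic family of random sets of hops, one for each starting time, all within a window of
length `L`, whose displacement is uniformly distributed; `load` bounds the expected number of
starting times from which the hop at a given time is taken. -/
structure SemiRoute {N : ℕ} (s : ShiftSchedule N) (L : ℕ) (Φ : ℝ≥0∞) where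
  Ω : Type
  [fintype : Fintype Ω]
  off : ℤ → Ω → Finset ℕ
  weight : ℤ → Ω → ℝ≥0∞
  off_lt : ∀ t ω, ∀ i ∈ off t ω, i < L
  off_periodic : ∀ t ω, off (t + s.period) ω = off t ω
  weight_periodic : ∀ t ω, weight (t + s.period) ω = weight t ω
  uniform : ∀ t c, ∑ ω, (if s.disp t (off t ω) = c then weight t ω else 0) = (N : ℝ≥0∞)⁻¹
  load : ∀ u : ℤ, ∑' t : ℤ, ∑ ω, (if ∃ i ∈ off t ω, t + (i : ℤ) = u then weight t ω else 0) ≤ Φ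

namespace SemiRoute

open MeasureTheory

variable {N : ℕ} {s : ShiftSchedule N} {L : ℕ} {Φ : ℝ≥0∞} (Q : SemiRoute s L Φ)

instance : Fintype Q.Ω := Q.fintype

/-- The hops of the concatenation of two consecutive semi-routes. -/
def hops (t : ℤ) (ω₁ ω₂ : Q.Ω) : Finset ℕ :=
  Q.off t ω₁ ∪ (Q.off (t + L) ω₂).map (addRightEmbedding L)

/-- The path from `(a, t)` that concatenates two semi-routes. -/
def path (x : ℤ × ZMod N × Q.Ω × Q.Ω) : NetPath (ZMod N) :=
  ⟨x.2.1, x.1, movesOf (Q.hops x.1 x.2.2.1 x.2.2.2) (2 * L)⟩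

/-- The weight of a concatenation of two semi-routes. -/
def pathWeight (x : ℤ × ZMod N × Q.Ω × Q.Ω) : ℝ≥0∞ :=
  N * (Q.weight x.1 x.2.2.1 * Q.weight (x.1 + L) x.2.2.2)

/-- Valiant load balancing: two consecutive independent semi-routes, conditioned on the
destination. -/
def routing : PathFlow (ZMod N) :=
  Measure.sum fun x => Q.pathWeight x • Measure.dirac (Q.path x)

theorem disjoint_hops (t : ℤ) (ω₁ ω₂ : Q.Ω) :
    Disjoint (Q.off t ω₁) ((Q.off (t + L) ω₂).map (addRightEmbedding L)) := by
  rw [Finset.disjoint_left]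
  intro i h1 h2
  obtain ⟨j, -, rfl⟩ := Finset.mem_map.1 h2
  have := Q.off_lt _ _ _ h1
  simp at this

theorem disp_map_add (t : ℤ) (S : Finset ℕ) :
    s.disp t (S.map (addRightEmbedding L)) = s.disp (t + L) S := by
  simp only [ShiftSchedule.disp, Finset.sum_map, addRightEmbedding_apply]
  refine Finset.sum_congr rfl fun i _ => ?_
  congr 1; push_cast; ring

theorem disp_hops (t : ℤ) (ω₁ ω₂ : Q.Ω) :
    s.disp t (Q.hops t ω₁ ω₂) = s.disp t (Q.off t ω₁) + s.disp (t + L) (Q.off (t + L) ω₂) := by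
  rw [← disp_map_add]
  exact Finset.sum_union (Q.disjoint_hops t ω₁ ω₂)

theorem dst_path (x : ℤ × ZMod N × Q.Ω × Q.Ω) :
    (Q.path x).dst s.toConnectionSchedule =
      x.2.1 + (s.disp x.1 (Q.off x.1 x.2.2.1) + s.disp (x.1 + L) (Q.off (x.1 + L) x.2.2.2)) := by
  rw [← disp_hops]
  simp only [NetPath.dst, path]
  rw [walk_movesOf, Finset.filter_true_of_mem]
  intro i hi
  rcases Finset.mem_union.1 hi with h | h
  · have := Q.off_lt _ _ _ h
    omega
  · obtain ⟨j, hj, rfl⟩ := Finset.mem_map.1 h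
    have := Q.off_lt _ _ _ hj
    simp only [addRightEmbedding_apply]
    omega

theorem routing_apply (A : Set (NetPath (ZMod N))) :
    Q.routing A = ∑' x, Q.pathWeight x * A.indicator 1 (Q.path x) := by
  simp [routing, Measure.sum_apply _ (MeasurableSet.of_discrete (s := A))]

theorem induced_routing_apply (D : ZMod N → ZMod N → ℤ → ℝ≥0) (A : Set (NetPath (ZMod N))) :
    (Q.routing.induced s.toConnectionSchedule D) A =
      ∑' x, Q.pathWeight x * A.indicator (fun P =>
        (D P.src (P.dst s.toConnectionSchedule) P.start : ℝ≥0∞)) (Q.path x) := by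
  have hA : MeasurableSet A := MeasurableSet.of_discrete
  rw [PathFlow.induced, withDensity_apply _ hA, ← lintegral_indicator hA, routing,
    lintegral_sum_measure]
  refine tsum_congr fun x => ?_
  rw [lintegral_smul_measure, lintegral_dirac, smul_eq_mul]

/-- The prefix of a semi-route before time `u`. -/
def dispBefore (t : ℤ) (ω : Q.Ω) (u : ℤ) : ZMod N :=
  s.disp t ((Q.off t ω).filter fun i => t + (i : ℤ) < u)

/-- The hop at time `u` lies in one of the two halves. Subtracting from `i` what that half has
already contributed recovers the node where the half began: the source in the first case, the
intermediate node in the second. One implication suffices, since loads are only bounded above. -/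
theorem mem_pathsThrough (x : ℤ × ZMod N × Q.Ω × Q.Ω) (i : ZMod N) (u : ℤ)
    (h : Q.path x ∈ pathsThrough s.toConnectionSchedule i u) :
    ((∃ k ∈ Q.off x.1 x.2.2.1, x.1 + (k : ℤ) = u) ∧
      x.2.1 = i - Q.dispBefore x.1 x.2.2.1 u) ∨
    ((∃ k ∈ Q.off (x.1 + L) x.2.2.2, x.1 + L + (k : ℤ) = u) ∧
      x.2.1 + s.disp x.1 (Q.off x.1 x.2.2.1) = i - Q.dispBefore (x.1 + L) x.2.2.2 u) := by
  obtain ⟨t, a, ω₁, ω₂⟩ := x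
  obtain ⟨k, hk, -, hu, hi⟩ := mem_pathsThrough_movesOf _ _ _ _ _ _ _ h
  dsimp only at *
  rcases Finset.mem_union.1 hk with hk1 | hk2
  · refine Or.inl ⟨⟨k, hk1, hu⟩, ?_⟩
    rw [eq_sub_iff_add_eq, ← hi, dispBefore]
    congr 2
    ext j
    simp only [hops, Finset.mem_filter, Finset.mem_union, Finset.mem_map, addRightEmbedding_apply]
    have hkL := Q.off_lt _ _ _ hk1
    constructor
    · rintro ⟨h1, h2⟩
      exact ⟨Or.inl h1, by omega⟩
    · rintro ⟨h1 | ⟨j', -, rfl⟩, h2⟩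
      · exact ⟨h1, by omega⟩
      · omega
  · obtain ⟨k', hk', rfl⟩ := Finset.mem_map.1 hk2
    simp only [addRightEmbedding_apply] at *
    refine Or.inr ⟨⟨k', hk', by push_cast at hu; omega⟩, ?_⟩
    rw [eq_sub_iff_add_eq, ← hi, dispBefore, add_assoc]
    congr 1
    rw [← disp_map_add, ShiftSchedule.disp, ShiftSchedule.disp, ShiftSchedule.disp,
      ← Finset.sum_union]
    · refine Finset.sum_congr ?_ fun _ _ => rfl
      ext j
      simp only [hops, Finset.mem_filter, Finset.mem_union, Finset.mem_map,
        addRightEmbedding_apply]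
      constructor
      · rintro (h1 | ⟨j', ⟨h1, h2⟩, rfl⟩)
        · have := Q.off_lt _ _ _ h1
          exact ⟨Or.inl h1, by omega⟩
        · exact ⟨Or.inr ⟨j', h1, rfl⟩, by push_cast at hu; omega⟩
      · rintro ⟨h1 | ⟨j', h1, rfl⟩, h2⟩
        · exact Or.inl h1
        · exact Or.inr ⟨j', ⟨h1, by push_cast at hu; omega⟩, rfl⟩
    · refine (Q.disjoint_hops t ω₁ ω₂).mono_right ?_
      exact Finset.map_subset_map.2 (Finset.filter_subset _ _)

theorem maxLatency_routing_le : maxLatency Q.routing ≤ (2 * L : ℕ) := by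
  refine iSup₂_le fun P hP => ?_
  rw [routing_apply] at hP
  obtain ⟨x, hx⟩ : ∃ x, Q.pathWeight x * Set.indicator {P} 1 (Q.path x) ≠ 0 := by
    by_contra! h
    simp [h] at hP
  have : Q.path x = P := by
    by_contra h
    exact hx (by simp [h])
  rw [← this]
  simp [path, NetPath.latency]

variable [NeZero N]

/-- Averaging a function of the displacement over a semi-route. -/
theorem sum_weight_mul (t : ℤ) (f : ZMod N → ℝ≥0∞) :
    ∑ ω, Q.weight t ω * f (s.disp t (Q.off t ω)) = (N : ℝ≥0∞)⁻¹ * ∑ c, f c := by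
  have h : ∀ ω, Q.weight t ω * f (s.disp t (Q.off t ω)) =
      ∑ c, (if s.disp t (Q.off t ω) = c then Q.weight t ω else 0) * f c := by
    intro ω
    rw [Finset.sum_eq_single (s.disp t (Q.off t ω))]
    · simp
    · intro c _ hc
      simp [hc.symm]
    · simp
  simp only [h]
  rw [Finset.sum_comm, Finset.mul_sum]
  refine Finset.sum_congr rfl fun c _ => ?_
  rw [← Finset.sum_mul, Q.uniform]

theorem natCast_mul_sum_weight_mul (t : ℤ) (f : ZMod N → ℝ≥0∞) :
    N * ∑ ω, Q.weight t ω * f (s.disp t (Q.off t ω)) = ∑ c, f c := by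
  rw [sum_weight_mul, ← mul_assoc, ENNReal.mul_inv_cancel, one_mul]
  · exact_mod_cast NeZero.ne N
  · exact ENNReal.natCast_ne_top N

theorem tsum_pathIndex (F : ℤ × ZMod N × Q.Ω × Q.Ω → ℝ≥0∞) :
    ∑' x, F x = ∑' t, ∑ a, ∑ ω₁, ∑ ω₂, F (t, a, ω₁, ω₂) := by
  rw [ENNReal.tsum_prod']
  simp only [tsum_fintype, Fintype.sum_prod_type]

/-- Once the first half is fixed, the second must supply one particular displacement, which has
probability 1/N; the factor `N` in `pathWeight` compensates for this. Positivity of `L` makes every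
path arrive strictly later than it starts. -/
theorem isObliviousRouting (hL : 0 < L) :
    IsObliviousRouting s.toConnectionSchedule Q.routing where
  periodic P := by
    rw [routing_apply, routing_apply, ← (Equiv.prodCongr (Equiv.addRight (s.period : ℤ))
      (Equiv.refl (ZMod N × Q.Ω × Q.Ω))).tsum_eq]
    refine tsum_congr fun x => ?_
    obtain ⟨t, a, ω₁, ω₂⟩ := x
    have e1 : t + (s.period : ℤ) + L = t + L + s.period := by ring
    have hw : Q.pathWeight (t + s.period, a, ω₁, ω₂) = Q.pathWeight (t, a, ω₁, ω₂) := by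
      simp only [pathWeight, e1, Q.weight_periodic]
    have hp : Q.path (t + s.period, a, ω₁, ω₂) ∈ ({P.translate s.period} : Set _) ↔
        Q.path (t, a, ω₁, ω₂) ∈ ({P} : Set _) := by
      simp only [path, hops, Set.mem_singleton_iff, e1, Q.off_periodic]
      rw [NetPath.ext_iff, NetPath.ext_iff]
      simp [NetPath.translate]
    change Q.pathWeight (t + s.period, a, ω₁, ω₂) * Set.indicator {P.translate s.period} 1
      (Q.path (t + s.period, a, ω₁, ω₂)) = _
    rw [hw]
    by_cases h : Q.path (t, a, ω₁, ω₂) ∈ ({P} : Set _)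
    · rw [Set.indicator_of_mem h, Set.indicator_of_mem (hp.2 h)]
      rfl
    · rw [Set.indicator_of_notMem h, Set.indicator_of_notMem (fun h' => h (hp.1 h'))]
  unit a b t := by
    rw [routing_apply, tsum_pathIndex, tsum_eq_single t, Finset.sum_eq_single a]
    · have : ∀ ω₁ ω₂, Q.pathWeight (t, a, ω₁, ω₂) *
          (pathsBetween s.toConnectionSchedule a b t).indicator 1 (Q.path (t, a, ω₁, ω₂)) =
          Q.weight t ω₁ * (N * (Q.weight (t + L) ω₂ * if s.disp (t + L) (Q.off (t + L) ω₂) =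
            b - a - s.disp t (Q.off t ω₁) then 1 else 0)) := by
        intro ω₁ ω₂
        have : Q.path (t, a, ω₁, ω₂) ∈ pathsBetween s.toConnectionSchedule a b t ↔
            s.disp (t + L) (Q.off (t + L) ω₂) = b - a - s.disp t (Q.off t ω₁) := by
          simp only [pathsBetween, Set.mem_ofPred_eq, dst_path]
          simp only [path, NetPath.latency, length_movesOf, true_and]
          constructor
          · rintro ⟨h, -⟩
            rw [← h]; ring
          · intro h
            exact ⟨by rw [h]; ring, by omega⟩
        simp only [Set.indicator, this, pathWeight, Pi.one_apply]
        ring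
      simp only [this, ← Finset.mul_sum]
      have h2 : ∀ ω₁, ∑ ω₂, Q.weight (t + L) ω₂ * (if s.disp (t + L) (Q.off (t + L) ω₂) =
            b - a - s.disp t (Q.off t ω₁) then (1 : ℝ≥0∞) else 0) = (N : ℝ≥0∞)⁻¹ * 1 := by
        intro ω₁
        rw [Q.sum_weight_mul (t + L) (fun c => if c = b - a - s.disp t (Q.off t ω₁) then 1 else 0)]
        simp
      have h3 := Q.natCast_mul_sum_weight_mul t (fun _ => (N : ℝ≥0∞)⁻¹ * 1)
      simp only [h2, Finset.mul_sum] at h3 ⊢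
      calc _ = ∑ i, (N : ℝ≥0∞) * (Q.weight t i * ((N : ℝ≥0∞)⁻¹ * 1)) :=
            Finset.sum_congr rfl fun _ _ => by ring
        _ = 1 := by
            rw [h3]
            simp only [mul_one, Finset.sum_const, Finset.card_univ, ZMod.card, nsmul_eq_mul]
            exact ENNReal.mul_inv_cancel (by exact_mod_cast NeZero.ne N)
              (ENNReal.natCast_ne_top N)
    · intro a' _ ha'
      refine Finset.sum_eq_zero fun ω₁ _ => Finset.sum_eq_zero fun ω₂ _ => ?_
      simp [Set.indicator, pathsBetween, path, ha']
    · simp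
    · intro t' ht'
      refine Finset.sum_eq_zero fun a' _ => Finset.sum_eq_zero fun ω₁ _ =>
        Finset.sum_eq_zero fun ω₂ _ => ?_
      simp [Set.indicator, pathsBetween, path, ht']

/-- Each half contributes at most rΦ to the load of an edge: Φ bounds the weight of the half that
uses the edge, and the uniform displacement of the other half averages the demand into a row sum
(first half) or a column sum (second half). -/
theorem guaranteesThroughput {r : ℝ} (hr : ENNReal.ofReal r * (2 * Φ) ≤ 1) :
    GuaranteesThroughput s.toConnectionSchedule Q.routing r := by
  intro D hD i u
  have hrow : ∀ a t, ∑ b, (D a b t : ℝ≥0∞) ≤ ENNReal.ofReal r := by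
    intro a t
    have := ENNReal.ofReal_le_ofReal (hD a t).1
    rwa [ENNReal.ofReal_coe_nnreal, ENNReal.ofNNReal_finsetSum] at this
  have hcol : ∀ a t, ∑ b, (D b a t : ℝ≥0∞) ≤ ENNReal.ofReal r := by
    intro a t
    have := ENNReal.ofReal_le_ofReal (hD a t).2
    rwa [ENNReal.ofReal_coe_nnreal, ENNReal.ofNNReal_finsetSum] at this
  rw [induced_routing_apply]
  set d : ℤ → Q.Ω → ZMod N := fun t ω => s.disp t (Q.off t ω) with hd
  -- the loads caused by the first and by the second halves of the paths
  let F₁ : ℤ × ZMod N × Q.Ω × Q.Ω → ℝ≥0∞ := fun x =>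
    if (∃ k ∈ Q.off x.1 x.2.2.1, x.1 + (k : ℤ) = u) ∧ x.2.1 = i - Q.dispBefore x.1 x.2.2.1 u then
      Q.pathWeight x * D x.2.1 (x.2.1 + (d x.1 x.2.2.1 + d (x.1 + L) x.2.2.2)) x.1 else 0
  let F₂ : ℤ × ZMod N × Q.Ω × Q.Ω → ℝ≥0∞ := fun x =>
    if (∃ k ∈ Q.off (x.1 + L) x.2.2.2, x.1 + L + (k : ℤ) = u) ∧
        x.2.1 = i - Q.dispBefore (x.1 + L) x.2.2.2 u - d x.1 x.2.2.1 then
      Q.pathWeight x * D x.2.1 (x.2.1 + (d x.1 x.2.2.1 + d (x.1 + L) x.2.2.2)) x.1 else 0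
  have hle : ∀ x, Q.pathWeight x * (pathsThrough s.toConnectionSchedule i u).indicator (fun P =>
        (D P.src (P.dst s.toConnectionSchedule) P.start : ℝ≥0∞)) (Q.path x) ≤ F₁ x + F₂ x := by
    intro x
    by_cases h : Q.path x ∈ pathsThrough s.toConnectionSchedule i u
    · rw [Set.indicator_of_mem h, dst_path]
      rcases Q.mem_pathsThrough x i u h with h1 | h2
      · refine le_add_right ?_
        simp only [F₁, if_pos h1]
        exact le_rfl
      · refine le_add_left ?_
        have h2' : x.2.1 = i - Q.dispBefore (x.1 + L) x.2.2.2 u - d x.1 x.2.2.1 := by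
          rw [← h2.2, hd]; ring
        simp only [F₂]
        rw [if_pos ⟨h2.1, h2'⟩]
        exact le_rfl
    · rw [Set.indicator_of_notMem h]
      simp
  have hF₁ : ∑' x, F₁ x ≤ ENNReal.ofReal r * Φ := by
    rw [tsum_pathIndex]
    calc _ ≤ ∑' t : ℤ, ENNReal.ofReal r * ∑ ω, (if ∃ k ∈ Q.off t ω, t + (k : ℤ) = u
            then Q.weight t ω else 0) := by
          refine ENNReal.tsum_le_tsum fun t => ?_
          rw [Finset.sum_comm, Finset.mul_sum]
          refine Finset.sum_le_sum fun ω₁ _ => ?_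
          by_cases h : ∃ k ∈ Q.off t ω₁, t + (k : ℤ) = u
          -- Given the first half, only one source can be at `i` at time `u`.
          · rw [if_pos h, Finset.sum_eq_single (i - Q.dispBefore t ω₁ u)]
            · set a := i - Q.dispBefore t ω₁ u with ha
              have : ∀ ω₂, F₁ (t, a, ω₁, ω₂) = Q.weight t ω₁ * (N * (Q.weight (t + L) ω₂ *
                  D a (a + (d t ω₁ + d (t + L) ω₂)) t)) := by
                intro ω₂
                simp only [F₁]
                rw [if_pos ⟨h, ha⟩, pathWeight]
                ring
              simp only [this, ← Finset.mul_sum]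
              -- The second half is uniform, so the destination runs over all nodes with unit
              -- weight: a row sum of `D`.
              rw [Q.natCast_mul_sum_weight_mul (t + L) (fun c => (D a (a + (d t ω₁ + c)) t : ℝ≥0∞)),
                mul_comm]
              gcongr
              refine le_trans (le_of_eq ?_) (hrow a t)
              exact ((Equiv.addLeft (d t ω₁)).trans (Equiv.addLeft a)).sum_comp
                (fun b => (D a b t : ℝ≥0∞))
            · intro a _ ha
              refine Finset.sum_eq_zero fun ω₂ _ => ?_
              simp only [F₁]
              rw [if_neg (fun h' => ha h'.2)]
            · simp
          · refine le_trans (le_of_eq ?_) zero_le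
            refine Finset.sum_eq_zero fun a _ => Finset.sum_eq_zero fun ω₂ _ => ?_
            simp only [F₁]
            rw [if_neg (fun h' => h h'.1)]
      _ ≤ ENNReal.ofReal r * Φ := by
          rw [ENNReal.tsum_mul_left]
          gcongr
          exact Q.load u
  have hF₂ : ∑' x, F₂ x ≤ ENNReal.ofReal r * Φ := by
    rw [tsum_pathIndex]
    calc _ ≤ ∑' t : ℤ, ENNReal.ofReal r * ∑ ω, (if ∃ k ∈ Q.off (t + L) ω, t + L + (k : ℤ) = u
            then Q.weight (t + L) ω else 0) := by
          refine ENNReal.tsum_le_tsum fun t => ?_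
          rw [Finset.mul_sum]
          have hc : ∑ ω₁, ∑ a, ∑ ω₂, F₂ (t, a, ω₁, ω₂) = ∑ ω₂, ∑ ω₁, ∑ a, F₂ (t, a, ω₁, ω₂) := by
            rw [Finset.sum_comm]
            simp only [fun a => Finset.sum_comm (s := Finset.univ) (t := Finset.univ)
              (f := fun ω₁ ω₂ => F₂ (t, a, ω₁, ω₂))]
            rw [Finset.sum_comm]
            refine Finset.sum_congr rfl fun ω₂ _ => Finset.sum_comm
          rw [Finset.sum_comm, hc]
          refine Finset.sum_le_sum fun ω₂ _ => ?_
          by_cases h : ∃ k ∈ Q.off (t + L) ω₂, t + L + (k : ℤ) = u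
          · rw [if_pos h]
            -- `e` is the intermediate node. With `ω₂` fixed, the destination `e + d (t + L) ω₂` is
            -- fixed as well, and only the source still varies with the first half.
            set e := i - Q.dispBefore (t + L) ω₂ u with he
            have : ∀ ω₁, ∑ a, F₂ (t, a, ω₁, ω₂) = Q.weight (t + L) ω₂ * (N * (Q.weight t ω₁ *
                D (e - d t ω₁) (e + d (t + L) ω₂) t)) := by
              intro ω₁
              rw [Finset.sum_eq_single (e - d t ω₁)]
              · simp only [F₂]
                rw [if_pos ⟨h, by rw [he]⟩, pathWeight,
                  show e - d t ω₁ + (d t ω₁ + d (t + L) ω₂) = e + d (t + L) ω₂ by ring]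
                ring
              · intro a _ ha
                simp only [F₂]
                rw [if_neg (fun h' => ha h'.2)]
              · simp
            simp only [this, ← Finset.mul_sum]
            -- The first half is uniform, so the source runs over all nodes with unit weight: a
            -- column sum of `D`.
            rw [Q.natCast_mul_sum_weight_mul t
              (fun c => (D (e - c) (e + d (t + L) ω₂) t : ℝ≥0∞)), mul_comm]
            gcongr
            refine le_trans (le_of_eq ?_) (hcol (e + d (t + L) ω₂) t)
            exact (Equiv.subLeft e).sum_comp (fun b => (D b (e + d (t + L) ω₂) t : ℝ≥0∞))
          · refine le_trans (le_of_eq ?_) zero_le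
            refine Finset.sum_eq_zero fun ω₁ _ => Finset.sum_eq_zero fun a _ => ?_
            simp only [F₂]
            rw [if_neg (fun h' => h h'.1)]
      _ ≤ ENNReal.ofReal r * Φ := by
          rw [ENNReal.tsum_mul_left]
          gcongr
          exact ((Equiv.addRight (L : ℤ)).tsum_eq (fun t : ℤ => ∑ ω,
            (if ∃ k ∈ Q.off t ω, t + (k : ℤ) = u then Q.weight t ω else 0))).trans_le (Q.load u)
  calc _ ≤ ∑' x, (F₁ x + F₂ x) := ENNReal.tsum_le_tsum hle
    _ = ∑' x, F₁ x + ∑' x, F₂ x := ENNReal.tsum_add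
    _ ≤ ENNReal.ofReal r * Φ + ENNReal.ofReal r * Φ := add_le_add hF₁ hF₂
    _ = ENNReal.ofReal r * (2 * Φ) := by ring
    _ ≤ 1 := hr

end SemiRoute

/-! ## Block sums and the semi-route with a fallback -/

section BlockSum

variable {N : ℕ}

/-- The sum of the shifts chosen by `x`, one from each of `h` consecutive blocks of length `b`
that start at time `t`. -/
def blockSum (sh : ℤ → ZMod N) (t : ℤ) {b h : ℕ} (x : Fin h → Fin b) : ZMod N :=
  ∑ j, sh (t + ((j * b + x j : ℕ) : ℤ))

/-- The number of choices with block sum `c`. -/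
def blockCount (sh : ℤ → ZMod N) (t : ℤ) (b h : ℕ) (c : ZMod N) : ℕ :=
  (Finset.univ.filter fun x : Fin h → Fin b => blockSum sh t x = c).card

/-- The amount by which the counts fall short of the uniform distribution. -/
def blockDeficit [NeZero N] (sh : ℤ → ZMod N) (t : ℤ) (b h : ℕ) : ℕ :=
  ∑ c, (b ^ h - N * blockCount sh t b h c)

theorem sum_blockSum [NeZero N] {R : Type*} [CommSemiring R] (sh : ℤ → ZMod N) (t : ℤ) (b h : ℕ)
    (f : ZMod N → R) :
    ∑ x : Fin h → Fin b, f (blockSum sh t x) = ∑ c, (blockCount sh t b h c : R) * f c := by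
  rw [← Finset.sum_fiberwise (s := Finset.univ) (g := fun x : Fin h → Fin b => blockSum sh t x)]
  refine Finset.sum_congr rfl fun c _ => ?_
  rw [Finset.sum_congr rfl (g := fun _ => f c)
    (fun x hx => by rw [(Finset.mem_filter.1 hx).2]), Finset.sum_const, nsmul_eq_mul, blockCount]

theorem sum_blockCount [NeZero N] (sh : ℤ → ZMod N) (t : ℤ) (b h : ℕ) :
    ∑ c, blockCount sh t b h c = b ^ h := by
  have := sum_blockSum (R := ℕ) sh t b h (fun _ => 1)
  simpa using this.symm

/-- The shortfall of one residue is at most the total deficit, which is at most half of `b ^ h`. The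
common factor `N` is kept because the machine compares with the total mass `N * b ^ h`. -/
theorem le_blockCount_of_deficit [NeZero N] {sh : ℤ → ZMod N} {t : ℤ} {b h : ℕ}
    (hd : 2 * N * blockDeficit sh t b h ≤ N * b ^ h) (c : ZMod N) :
    b ^ h ≤ 2 * (N * blockCount sh t b h c) := by
  have hN : 0 < N := Nat.pos_of_ne_zero (NeZero.ne N)
  have h1 : b ^ h - N * blockCount sh t b h c ≤ blockDeficit sh t b h :=
    Finset.single_le_sum (f := fun c => b ^ h - N * blockCount sh t b h c)
      (fun _ _ => Nat.zero_le _) (Finset.mem_univ c)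
  have h2 : 2 * blockDeficit sh t b h ≤ b ^ h := by
    rw [mul_assoc, mul_left_comm] at hd
    exact Nat.le_of_mul_le_mul_left hd hN
  omega

theorem blockCount_shiftAt_add_period (s : ShiftSchedule N) (t : ℤ) (b h : ℕ) :
    blockCount s.shiftAt (t + s.period) b h = blockCount s.shiftAt t b h := by
  funext c
  have : ∀ x : Fin h → Fin b, blockSum s.shiftAt (t + s.period) x = blockSum s.shiftAt t x := by
    intro x
    refine Finset.sum_congr rfl fun j _ => ?_
    rw [add_right_comm, s.shiftAt_add_period]
  simp only [blockCount, this]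

/-- The offsets of the hops chosen by `x` in consecutive blocks that start at offset `o`. -/
def hopSet (o : ℕ) {b h : ℕ} (x : Fin h → Fin b) : Finset ℕ :=
  Finset.univ.image fun j => o + (j * b + x j)

theorem hop_injective (o : ℕ) {b h : ℕ} (x : Fin h → Fin b) :
    Function.Injective fun j : Fin h => o + ((j : ℕ) * b + x j) := by
  intro j k hjk
  have h1 : (j : ℕ) * b + x j = k * b + x k := by simpa using hjk
  have hb : 0 < b := (Nat.zero_le _).trans_lt (x j).2
  have h2 := congrArg (· / b) h1
  simp only [Nat.add_comm ((_ : ℕ) * b), Nat.add_mul_div_right _ _ hb,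
    Nat.div_eq_of_lt (x _).2, zero_add] at h2
  exact Fin.ext h2

theorem mem_hopSet {o b h : ℕ} {x : Fin h → Fin b} {i : ℕ} (hi : i ∈ hopSet o x) :
    o ≤ i ∧ i < o + h * b := by
  obtain ⟨j, -, rfl⟩ := Finset.mem_image.1 hi
  have h1 := (x j).2
  have h2 : ((j : ℕ) + 1) * b ≤ h * b := Nat.mul_le_mul_right _ j.2
  rw [add_mul, one_mul] at h2
  omega

theorem sum_hopSet {o b h : ℕ} {R : Type*} [AddCommMonoid R] (x : Fin h → Fin b) (f : ℕ → R) :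
    ∑ i ∈ hopSet o x, f i = ∑ j, f (o + (j * b + x j)) :=
  Finset.sum_image fun _ _ _ _ h => hop_injective o x h

theorem disp_hopSet (s : ShiftSchedule N) (t : ℤ) (o : ℕ) {b h : ℕ} (x : Fin h → Fin b) :
    s.disp t (hopSet o x) = blockSum s.shiftAt (t + o) x := by
  rw [ShiftSchedule.disp, sum_hopSet, blockSum]
  refine Finset.sum_congr rfl fun j _ => ?_
  rw [Nat.cast_add o, add_assoc]

theorem card_hopSet_le (o : ℕ) {b h : ℕ} (x : Fin h → Fin b) : (hopSet o x).card ≤ h :=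
  Finset.card_image_le.trans (by simp)

end BlockSum

/-- If the offsets do not depend on the starting time, then the load at time `u` is a finite sum. -/
theorem tsum_load_le {Ω : Type*} [Fintype Ω] (off : Ω → Finset ℕ) (weight : ℤ → Ω → ℝ≥0∞) (u : ℤ) :
    ∑' t : ℤ, ∑ ω, (if ∃ i ∈ off ω, t + (i : ℤ) = u then weight t ω else 0) ≤
      ∑ ω, ∑ i ∈ off ω, weight (u - i) ω := by
  calc _ ≤ ∑' t : ℤ, ∑ ω, ∑ i ∈ off ω, (if t = u - (i : ℤ) then weight (u - i) ω else 0) := by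
        refine ENNReal.tsum_le_tsum fun t => Finset.sum_le_sum fun ω _ => ?_
        split_ifs with h
        · obtain ⟨i, hi, rfl⟩ := h
          refine le_trans (le_of_eq ?_) (Finset.single_le_sum
            (f := fun j : ℕ => if t = t + i - (j : ℤ) then weight (t + i - j) ω else 0)
            (fun _ _ => zero_le) hi)
          simp
        · exact zero_le
    _ = ∑ ω, ∑ i ∈ off ω, ∑' t : ℤ, (if t = u - (i : ℤ) then weight (u - i) ω else 0) := by
        rw [Summable.tsum_finsetSum fun _ _ => ENNReal.summable]
        refine Finset.sum_congr rfl fun ω _ => ?_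
        rw [Summable.tsum_finsetSum fun _ _ => ENNReal.summable]
    _ = _ := by simp [tsum_ite_eq]

/-! ### Capped uniform hop sequences, completed by a two-round fallback -/

set_option linter.unusedSectionVars false

section Fallback

variable {N : ℕ} [NeZero N] (s : ShiftSchedule N) (M h l b k : ℕ)

/-- The weight of one hop sequence of the primary part with block sum `c`, in the window that is
reached after waiting for `i` windows. -/
def primaryWeight (t : ℤ) (i : ℕ) (c : ZMod N) : ℝ≥0 :=
  (M : ℝ≥0)⁻¹ * min ((N * blockCount s.shiftAt (t + (i * (h * l) : ℕ)) l h c : ℝ≥0)⁻¹)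
    ((l : ℝ≥0) ^ h)⁻¹

/-- The probability that the primary part has displacement `c`. -/
def primaryMass (t : ℤ) (c : ZMod N) : ℝ≥0 :=
  ∑ i : Fin M, blockCount s.shiftAt (t + (i * (h * l) : ℕ)) l h c * primaryWeight s M h l t i c

/-- The part of the uniform distribution that the primary part does not cover. -/
def leftover (t : ℤ) (c : ZMod N) : ℝ≥0 := (N : ℝ≥0)⁻¹ - primaryMass s M h l t c

theorem natCast_mul_min_inv (m n : ℕ) (B : ℝ≥0) :
    (m : ℝ≥0) * min ((n * m : ℝ≥0)⁻¹) B⁻¹ = if m = 0 then 0 else min (n : ℝ≥0)⁻¹ (m / B) := by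
  split_ifs with hm
  · simp [hm]
  · have : (m : ℝ≥0) ≠ 0 := by exact_mod_cast hm
    rw [mul_min]
    congr 1
    rw [mul_inv, mul_comm, mul_assoc, inv_mul_cancel₀ this, mul_one]

/-- In each window a uniform choice of sequence would give the residue `c` its relative frequency;
the weights cut this off at 1/N. The primary part thus never overshoots the uniform distribution,
and what is missing can be added. -/
theorem primaryMass_eq (t : ℤ) (c : ZMod N) : primaryMass s M h l t c =
    (M : ℝ≥0)⁻¹ * ∑ i : Fin M, min (N : ℝ≥0)⁻¹
      (blockCount s.shiftAt (t + (i * (h * l) : ℕ)) l h c / (l : ℝ≥0) ^ h) := by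
  rw [primaryMass, Finset.mul_sum]
  refine Finset.sum_congr rfl fun i _ => ?_
  rw [primaryWeight, mul_left_comm, natCast_mul_min_inv]
  split_ifs with h0
  · rw [h0]; simp
  · rfl

theorem primaryMass_le (t : ℤ) (c : ZMod N) : primaryMass s M h l t c ≤ (N : ℝ≥0)⁻¹ := by
  rw [primaryMass_eq]
  calc _ ≤ (M : ℝ≥0)⁻¹ * ∑ i : Fin M, (N : ℝ≥0)⁻¹ := by
        gcongr
        exact min_le_left _ _
    _ = ((M : ℝ≥0)⁻¹ * M) * (N : ℝ≥0)⁻¹ := by simp [mul_assoc]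
    _ ≤ 1 * (N : ℝ≥0)⁻¹ := by
        gcongr
        exact inv_mul_le_one
    _ = _ := one_mul _

/-- For one window, the gap between 1/N and the capped frequency m / l^h is the truncated difference
l^h - N m divided by N l^h. Summed over residues this is the normalised block deficit, and the
hypothesis bounds its average over the `M` windows. -/
theorem sum_leftover_le {p : ℕ} (hM : 0 < M) (hl : 0 < l) (hp : 0 < p) (t : ℤ)
    (hd : p * ∑ i : Fin M, blockDeficit s.shiftAt (t + (i * (h * l) : ℕ)) l h ≤ M * (N * l ^ h)) :
    ∑ c, leftover s M h l t c ≤ (p : ℝ≥0)⁻¹ := by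
  have hN0 : (N : ℝ≥0) ≠ 0 := by exact_mod_cast NeZero.ne N
  have hM0 : (M : ℝ≥0) ≠ 0 := by exact_mod_cast hM.ne'
  have hl0 : (l : ℝ≥0) ≠ 0 := by exact_mod_cast hl.ne'
  have hp0 : (p : ℝ≥0) ≠ 0 := by exact_mod_cast hp.ne'
  have hB : (l : ℝ≥0) ^ h ≠ 0 := pow_ne_zero _ hl0
  have key : ∀ c, leftover s M h l t c ≤ (M : ℝ≥0)⁻¹ * ∑ i : Fin M,
      ((l ^ h - N * blockCount s.shiftAt (t + (i * (h * l) : ℕ)) l h c : ℕ) : ℝ≥0) /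
        (N * (l : ℝ≥0) ^ h) := by
    intro c
    rw [leftover, tsub_le_iff_right, primaryMass_eq, ← mul_add, ← Finset.sum_add_distrib]
    calc (N : ℝ≥0)⁻¹ = (M : ℝ≥0)⁻¹ * ∑ i : Fin M, (N : ℝ≥0)⁻¹ := by
          simp only [Finset.sum_const, Finset.card_univ, Fintype.card_fin, nsmul_eq_mul]
          rw [← mul_assoc, inv_mul_cancel₀ hM0, one_mul]
      _ ≤ _ := by
          gcongr with i _
          set m := blockCount s.shiftAt (t + (i * (h * l) : ℕ)) l h c
          rcases le_total ((N : ℝ≥0)⁻¹) (m / (l : ℝ≥0) ^ h) with h1 | h1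
          · rw [min_eq_left h1]
            exact le_add_self
          · rw [min_eq_right h1]
            have h2 : (l : ℝ≥0) ^ h ≤ ((l ^ h - N * m : ℕ) : ℝ≥0) + N * m := by
              have : l ^ h ≤ (l ^ h - N * m) + N * m := by omega
              exact_mod_cast this
            have h3 : (m : ℝ≥0) / (l : ℝ≥0) ^ h = N * m / (N * (l : ℝ≥0) ^ h) := by
              rw [mul_div_mul_left _ _ hN0]
            rw [h3, ← add_div, le_div_iff₀ (by positivity), ← mul_assoc, inv_mul_cancel₀ hN0,
              one_mul]
            exact h2
  calc ∑ c, leftover s M h l t c ≤ _ := Finset.sum_le_sum fun c _ => key c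
    _ = (∑ i : Fin M, (blockDeficit s.shiftAt (t + (i * (h * l) : ℕ)) l h : ℝ≥0)) /
        (M * (N * (l : ℝ≥0) ^ h)) := by
        rw [← Finset.mul_sum, Finset.sum_comm]
        simp only [← Finset.sum_div, blockDeficit, Nat.cast_sum]
        field_simp
    _ ≤ _ := by
        rw [div_le_iff₀ (by positivity), ← div_eq_inv_mul, le_div_iff₀' (by positivity)]
        exact_mod_cast hd

/-- The weight of a pair of fallback hop sequences with block sums `c` and `d`. -/
def fallbackWeight (t : ℤ) (c d : ZMod N) : ℝ≥0 :=
  leftover s M h l t (c + d) *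
    ((N * blockCount s.shiftAt (t + (M * (h * l) : ℕ)) b k c : ℝ≥0)⁻¹ *
      (blockCount s.shiftAt (t + (M * (h * l) + k * b : ℕ)) b k d : ℝ≥0)⁻¹)

/-- The number of second-round sequences with sum `d` cancels against its inverse, and `c + d` runs
over all residues. So a first-round sequence sees the leftover mass only through its total. This is
the purpose of the second round: a single one would concentrate the load on the few sequences that
reach a badly covered residue. -/
theorem sum_fallbackWeight_left (hpos : ∀ t c, 0 < blockCount s.shiftAt t b k c) (t : ℤ)
    (c : ZMod N) :
    ∑ z : Fin k → Fin b, fallbackWeight s M h l b k t c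
      (blockSum s.shiftAt (t + (M * (h * l) + k * b : ℕ)) z) =
    (N * blockCount s.shiftAt (t + (M * (h * l) : ℕ)) b k c : ℝ≥0)⁻¹ *
      ∑ d, leftover s M h l t d := by
  rw [sum_blockSum, ← Equiv.sum_comp (Equiv.addLeft c) (leftover s M h l t), Finset.mul_sum]
  refine Finset.sum_congr rfl fun d _ => ?_
  have : (blockCount s.shiftAt (t + (M * (h * l) + k * b : ℕ)) b k d : ℝ≥0) ≠ 0 := by
    exact_mod_cast (hpos _ _).ne'
  rw [fallbackWeight, Equiv.coe_addLeft]
  field_simp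

theorem sum_fallbackWeight_right (hpos : ∀ t c, 0 < blockCount s.shiftAt t b k c) (t : ℤ)
    (d : ZMod N) :
    ∑ y : Fin k → Fin b, fallbackWeight s M h l b k t
      (blockSum s.shiftAt (t + (M * (h * l) : ℕ)) y) d =
    (N * blockCount s.shiftAt (t + (M * (h * l) + k * b : ℕ)) b k d : ℝ≥0)⁻¹ *
      ∑ c, leftover s M h l t c := by
  rw [sum_blockSum s.shiftAt (t + (M * (h * l) : ℕ)) b k
    (fun c => fallbackWeight s M h l b k t c d),
    ← Equiv.sum_comp (Equiv.addRight d) (leftover s M h l t), Finset.mul_sum]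
  refine Finset.sum_congr rfl fun c _ => ?_
  have : (blockCount s.shiftAt (t + (M * (h * l) : ℕ)) b k c : ℝ≥0) ≠ 0 := by
    exact_mod_cast (hpos _ _).ne'
  rw [fallbackWeight, Equiv.coe_addRight]
  field_simp

/-- For each first sum `c` the second must be `e - c`, and both counts cancel; this leaves 1/N of
the leftover at `e` for each of the `N` values of `c`. -/
theorem sum_fallbackWeight_eq (hpos : ∀ t c, 0 < blockCount s.shiftAt t b k c) (t : ℤ)
    (e : ZMod N) :
    ∑ y : Fin k → Fin b, ∑ z : Fin k → Fin b,
      (if blockSum s.shiftAt (t + (M * (h * l) : ℕ)) y +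
          blockSum s.shiftAt (t + (M * (h * l) + k * b : ℕ)) z = e then
        fallbackWeight s M h l b k t (blockSum s.shiftAt (t + (M * (h * l) : ℕ)) y)
          (blockSum s.shiftAt (t + (M * (h * l) + k * b : ℕ)) z) else 0) =
    leftover s M h l t e := by
  have hN0 : (N : ℝ≥0) ≠ 0 := by exact_mod_cast NeZero.ne N
  rw [Finset.sum_congr rfl fun y _ => sum_blockSum s.shiftAt (t + (M * (h * l) + k * b : ℕ)) b k
    (fun d => if blockSum s.shiftAt (t + (M * (h * l) : ℕ)) y + d = e then
      fallbackWeight s M h l b k t (blockSum s.shiftAt (t + (M * (h * l) : ℕ)) y) d else 0),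
    sum_blockSum s.shiftAt (t + (M * (h * l) : ℕ)) b k (fun c => ∑ d,
      (blockCount s.shiftAt (t + (M * (h * l) + k * b : ℕ)) b k d : ℝ≥0) *
        if c + d = e then fallbackWeight s M h l b k t c d else 0)]
  have : ∀ c : ZMod N, (blockCount s.shiftAt (t + (M * (h * l) : ℕ)) b k c : ℝ≥0) *
      ∑ d, (blockCount s.shiftAt (t + (M * (h * l) + k * b : ℕ)) b k d : ℝ≥0) *
        (if c + d = e then fallbackWeight s M h l b k t c d else 0) =
      (N : ℝ≥0)⁻¹ * leftover s M h l t e := by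
    intro c
    rw [Finset.sum_eq_single (e - c)]
    · have h1 : (blockCount s.shiftAt (t + (M * (h * l) : ℕ)) b k c : ℝ≥0) ≠ 0 := by
        exact_mod_cast (hpos _ _).ne'
      have h2 : (blockCount s.shiftAt (t + (M * (h * l) + k * b : ℕ)) b k (e - c) : ℝ≥0) ≠ 0 := by
        exact_mod_cast (hpos _ _).ne'
      rw [if_pos (by ring), fallbackWeight, add_sub_cancel]
      field_simp
    · intro d _ hd
      rw [if_neg, mul_zero]
      rintro rfl
      exact hd (by ring)
    · simp
  simp only [this]
  simp [hN0]

theorem sum_primaryWeight_eq (t : ℤ) (c : ZMod N) :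
    ∑ i : Fin M, ∑ x : Fin h → Fin l,
      (if blockSum s.shiftAt (t + (i * (h * l) : ℕ)) x = c then primaryWeight s M h l t i
        (blockSum s.shiftAt (t + (i * (h * l) : ℕ)) x) else 0) = primaryMass s M h l t c := by
  refine Finset.sum_congr rfl fun i _ => ?_
  rw [sum_blockSum s.shiftAt (t + (i * (h * l) : ℕ)) l h
    (fun d => if d = c then primaryWeight s M h l t i d else 0)]
  simp

/-- The offsets of the hops of the semi-route with a fallback. -/
def fallbackOff : (Fin M × (Fin h → Fin l)) ⊕ ((Fin k → Fin b) × (Fin k → Fin b)) → Finset ℕ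
  | .inl (i, x) => hopSet (i * (h * l)) x
  | .inr (y, z) => hopSet (M * (h * l)) y ∪ hopSet (M * (h * l) + k * b) z

/-- The weights of the semi-route with a fallback. -/
def fallbackRouteWeight (t : ℤ) :
    (Fin M × (Fin h → Fin l)) ⊕ ((Fin k → Fin b) × (Fin k → Fin b)) → ℝ≥0
  | .inl (i, x) => primaryWeight s M h l t i (blockSum s.shiftAt (t + (i * (h * l) : ℕ)) x)
  | .inr (y, z) => fallbackWeight s M h l b k t
      (blockSum s.shiftAt (t + (M * (h * l) : ℕ)) y)
      (blockSum s.shiftAt (t + (M * (h * l) + k * b : ℕ)) z)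

/-- Wait for a random number `i < M` of windows, then take `h` hops, each in a block of length `l`,
using no slot more than its fair share; the displacements that are not covered in this way are
reached by two rounds of `k` hops in blocks of length `b`. -/
def fallbackRoute (hpos : ∀ t c, 0 < blockCount s.shiftAt t b k c) (Φ : ℝ≥0∞)
    (hΦ : ∀ u : ℤ, ∑ ω, ∑ i ∈ fallbackOff M h l b k ω,
      (fallbackRouteWeight s M h l b k (u - i) ω : ℝ≥0∞) ≤ Φ) :
    SemiRoute s (M * (h * l) + 2 * (k * b)) Φ where
  Ω := (Fin M × (Fin h → Fin l)) ⊕ ((Fin k → Fin b) × (Fin k → Fin b))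
  off _ := fallbackOff M h l b k
  weight t ω := fallbackRouteWeight s M h l b k t ω
  off_lt t ω i hi := by
    rcases ω with ⟨j, x⟩ | ⟨y, z⟩
    · have h1 := mem_hopSet hi
      have h2 : ((j : ℕ) + 1) * (h * l) ≤ M * (h * l) := Nat.mul_le_mul_right _ j.2
      rw [add_mul, one_mul] at h2
      omega
    · rcases Finset.mem_union.1 hi with h1 | h1
      · have h1 := mem_hopSet h1
        omega
      · have h1 := mem_hopSet h1
        omega
  off_periodic _ _ := rfl
  weight_periodic t ω := by
    have hc : ∀ (i : ℤ) b h, blockCount s.shiftAt (t + s.period + i) b h =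
        blockCount s.shiftAt (t + i) b h := by
      intro i b h
      rw [add_right_comm, blockCount_shiftAt_add_period]
    have hw : ∀ i : ℕ, primaryWeight s M h l (t + s.period) i = primaryWeight s M h l t i := by
      intro i
      funext c
      rw [primaryWeight, hc, primaryWeight]
    have hl : leftover s M h l (t + s.period) = leftover s M h l t := by
      funext c
      simp only [leftover, primaryMass, hw, hc]
    have hs : ∀ (i : ℕ) {b h : ℕ} (x : Fin h → Fin b),
        blockSum s.shiftAt (t + s.period + (i : ℤ)) x = blockSum s.shiftAt (t + (i : ℤ)) x := by
      intro i b h x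
      refine Finset.sum_congr rfl fun j _ => ?_
      rw [add_right_comm t, add_right_comm _ (s.period : ℤ), s.shiftAt_add_period]
    rcases ω with ⟨j, x⟩ | ⟨y, z⟩
    · simp only [fallbackRouteWeight, hw, hs]
    · simp only [fallbackRouteWeight, fallbackWeight, hs, hl]
      simp only [hc]
  uniform t c := by
    have hN0 : (N : ℝ≥0) ≠ 0 := by exact_mod_cast NeZero.ne N
    have h1 : ∑ ω, (if s.disp t (fallbackOff M h l b k ω) = c then
        fallbackRouteWeight s M h l b k t ω else 0) = (N : ℝ≥0)⁻¹ := by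
      rw [Fintype.sum_sum_type, Fintype.sum_prod_type, Fintype.sum_prod_type]
      have hu : ∀ y z : Fin k → Fin b, s.disp t (fallbackOff M h l b k (.inr (y, z))) =
          blockSum s.shiftAt (t + (M * (h * l) : ℕ)) y +
          blockSum s.shiftAt (t + (M * (h * l) + k * b : ℕ)) z := by
        intro y z
        rw [← disp_hopSet, ← disp_hopSet]
        refine Finset.sum_union ?_
        rw [Finset.disjoint_left]
        intro i h1 h2
        have h1 := mem_hopSet h1
        have h2 := mem_hopSet h2
        omega
      have hv : ∀ (i : Fin M) (x : Fin h → Fin l), s.disp t (fallbackOff M h l b k (.inl (i, x))) =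
          blockSum s.shiftAt (t + (i * (h * l) : ℕ)) x := fun i x => disp_hopSet _ _ _ _
      simp only [hu, hv, fallbackRouteWeight]
      rw [sum_primaryWeight_eq, sum_fallbackWeight_eq _ _ _ _ _ _ hpos, leftover]
      exact add_tsub_cancel_of_le (primaryMass_le s M h l t c)
    have h2 := congrArg (fun r : ℝ≥0 => (r : ℝ≥0∞)) h1
    simp only [ENNReal.ofNNReal_finsetSum] at h2
    rw [ENNReal.coe_inv hN0, ENNReal.coe_natCast] at h2
    rw [← h2]
    refine Finset.sum_congr rfl fun ω _ => ?_
    split_ifs <;> simp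
  load u := (tsum_load_le _ _ u).trans (hΦ u)

/-- A primary sequence has weight at most 1/(M l^h) and `h` hops, and there are M l^h of them: load
`h`. A fallback sequence of either round has, after summing out the other round, weight at most (2 /
b^k)(1/p) because all counts are at least half of the average; with `k` hops and b^k sequences this
is 2k/p per round. -/
theorem load_fallbackRoute_le {p : ℕ} (hM : 0 < M) (hl : 0 < l) (hb : 0 < b) (hp : 0 < p)
    (hprim : ∀ t : ℤ, p * ∑ i : Fin M, blockDeficit s.shiftAt (t + (i * (h * l) : ℕ)) l h ≤
      M * (N * l ^ h))
    (hfall : ∀ (t : ℤ) c, b ^ k ≤ 2 * (N * blockCount s.shiftAt t b k c)) (u : ℤ) :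
    ∑ ω, ∑ i ∈ fallbackOff M h l b k ω, fallbackRouteWeight s M h l b k (u - i) ω ≤
      (h + 4 * k * (p : ℝ≥0)⁻¹ : ℝ≥0) := by
  have hN0 : (N : ℝ≥0) ≠ 0 := by exact_mod_cast NeZero.ne N
  have hM0 : (M : ℝ≥0) ≠ 0 := by exact_mod_cast hM.ne'
  have hl0 : (l : ℝ≥0) ≠ 0 := by exact_mod_cast hl.ne'
  have hb0 : (b : ℝ≥0) ≠ 0 := by exact_mod_cast hb.ne'
  have hbk : 0 < b ^ k := pow_pos hb k
  have hpos : ∀ (t : ℤ) c, 0 < blockCount s.shiftAt t b k c := by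
    intro t c
    have h1 := hfall t c
    by_contra h2
    have h3 : blockCount s.shiftAt t b k c = 0 := by omega
    simp only [h3, mul_zero] at h1
    omega
  have hinv : ∀ (t : ℤ) c, (N * blockCount s.shiftAt t b k c : ℝ≥0)⁻¹ ≤ 2 / (b : ℝ≥0) ^ k := by
    intro t c
    have h1 : (b : ℝ≥0) ^ k ≤ 2 * (N * blockCount s.shiftAt t b k c) := by exact_mod_cast hfall t c
    have h2 : (blockCount s.shiftAt t b k c : ℝ≥0) ≠ 0 := by exact_mod_cast (hpos t c).ne'
    rw [inv_eq_one_div, div_le_div_iff₀ (by positivity) (by positivity), one_mul]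
    exact h1
  have hsum : ∀ (o : ℕ), ∑ y : Fin k → Fin b, ∑ i ∈ hopSet o y,
      (2 / (b : ℝ≥0) ^ k * (p : ℝ≥0)⁻¹) ≤ 2 * k * (p : ℝ≥0)⁻¹ := by
    intro o
    calc _ ≤ ∑ y : Fin k → Fin b, k * (2 / (b : ℝ≥0) ^ k * (p : ℝ≥0)⁻¹) := by
          refine Finset.sum_le_sum fun y _ => ?_
          rw [Finset.sum_const, nsmul_eq_mul]
          gcongr
          exact_mod_cast card_hopSet_le o y
      _ = 2 * k * (p : ℝ≥0)⁻¹ := by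
          rw [Finset.sum_const, nsmul_eq_mul]
          simp only [Finset.card_univ, Fintype.card_fun, Fintype.card_fin, Nat.cast_pow]
          field_simp
  rw [Fintype.sum_sum_type, Fintype.sum_prod_type, Fintype.sum_prod_type]
  have hA : ∑ i : Fin M, ∑ x : Fin h → Fin l, ∑ j ∈ fallbackOff M h l b k (.inl (i, x)),
      fallbackRouteWeight s M h l b k (u - j) (.inl (i, x)) ≤ h := by
    calc _ ≤ ∑ i : Fin M, ∑ x : Fin h → Fin l, h * ((M : ℝ≥0)⁻¹ * ((l : ℝ≥0) ^ h)⁻¹) := by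
          refine Finset.sum_le_sum fun i _ => Finset.sum_le_sum fun x _ => ?_
          calc _ ≤ ∑ j ∈ hopSet (i * (h * l)) x, ((M : ℝ≥0)⁻¹ * ((l : ℝ≥0) ^ h)⁻¹) := by
                refine Finset.sum_le_sum fun j _ => ?_
                exact mul_le_mul_right (min_le_right _ _) _
            _ ≤ _ := by
                rw [Finset.sum_const, nsmul_eq_mul]
                gcongr
                exact_mod_cast card_hopSet_le _ x
      _ = h := by
          simp only [Finset.sum_const, nsmul_eq_mul, Finset.card_univ, Fintype.card_fun,
            Fintype.card_fin, Nat.cast_pow]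
          field_simp
  have hB : ∑ y : Fin k → Fin b, ∑ z : Fin k → Fin b, ∑ j ∈ fallbackOff M h l b k (.inr (y, z)),
      fallbackRouteWeight s M h l b k (u - j) (.inr (y, z)) ≤
      2 * k * (p : ℝ≥0)⁻¹ + 2 * k * (p : ℝ≥0)⁻¹ := by
    have hsplit : ∀ y z : Fin k → Fin b, ∑ j ∈ fallbackOff M h l b k (.inr (y, z)),
        fallbackRouteWeight s M h l b k (u - j) (.inr (y, z)) ≤
        ∑ j ∈ hopSet (M * (h * l)) y, fallbackRouteWeight s M h l b k (u - j) (.inr (y, z)) +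
        ∑ j ∈ hopSet (M * (h * l) + k * b) z,
          fallbackRouteWeight s M h l b k (u - j) (.inr (y, z)) := by
      intro y z
      rw [← Finset.sum_union_inter]
      exact le_self_add
    calc _ ≤ _ := Finset.sum_le_sum fun y _ => Finset.sum_le_sum fun z _ => hsplit y z
      -- In each round the other round is summed out first, while the slot and hence the starting
      -- time `u - j` are fixed.
      _ = ∑ y : Fin k → Fin b, ∑ j ∈ hopSet (M * (h * l)) y, ∑ z : Fin k → Fin b,
            fallbackRouteWeight s M h l b k (u - j) (.inr (y, z)) +
          ∑ z : Fin k → Fin b, ∑ j ∈ hopSet (M * (h * l) + k * b) z, ∑ y : Fin k → Fin b,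
            fallbackRouteWeight s M h l b k (u - j) (.inr (y, z)) := by
          simp only [Finset.sum_add_distrib]
          congr 1
          · exact Finset.sum_congr rfl fun y _ => Finset.sum_comm
          · rw [Finset.sum_comm]
            exact Finset.sum_congr rfl fun y _ => Finset.sum_comm
      _ ≤ _ := by
          refine add_le_add ?_ ?_
          · refine le_trans ?_ (hsum (M * (h * l)))
            refine Finset.sum_le_sum fun y _ => Finset.sum_le_sum fun j _ => ?_
            simp only [fallbackRouteWeight]
            rw [sum_fallbackWeight_left _ _ _ _ _ _ hpos]
            gcongr
            · exact hinv _ _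
            · exact sum_leftover_le s M h l hM hl hp _ (hprim _)
          · refine le_trans ?_ (hsum (M * (h * l) + k * b))
            refine Finset.sum_le_sum fun z _ => Finset.sum_le_sum fun j _ => ?_
            simp only [fallbackRouteWeight]
            rw [sum_fallbackWeight_right _ _ _ _ _ _ hpos]
            gcongr
            · exact hinv _ _
            · exact sum_leftover_le s M h l hM hl hp _ (hprim _)
  refine (add_le_add hA hB).trans (le_of_eq ?_)
  ring

end Fallback

/-! ## Concentration on finite product spaces -/

section Probability

open scoped BigOperators Classical

/-- The probability of an event under the uniform distribution, as a real number. -/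
def prob {Ω : Type*} [Fintype Ω] (E : Ω → Prop) : ℝ := 𝔼 ω, if E ω then (1 : ℝ) else 0

section Basic

variable {Ω : Type*} [Fintype Ω]

theorem prob_le_expect {E : Ω → Prop} {g : Ω → ℝ} (h0 : ∀ ω, 0 ≤ g ω) (h1 : ∀ ω, E ω → 1 ≤ g ω) :
    prob E ≤ 𝔼 ω, g ω := by
  refine Finset.expect_le_expect fun ω _ => ?_
  split_ifs with h
  · exact h1 ω h
  · exact h0 ω

theorem prob_mono {E F : Ω → Prop} (h : ∀ ω, E ω → F ω) : prob E ≤ prob F := by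
  refine prob_le_expect (fun ω => by split_ifs <;> norm_num) fun ω hω => ?_
  rw [if_pos (h ω hω)]

theorem prob_or_le (E F : Ω → Prop) : prob (fun ω => E ω ∨ F ω) ≤ prob E + prob F := by
  simp only [prob]
  rw [← Finset.expect_add_distrib]
  refine Finset.expect_le_expect fun ω _ => ?_
  by_cases h1 : E ω <;> by_cases h2 : F ω <;> simp [h1, h2]

theorem prob_exists_le {ι : Type*} (I : Finset ι) (E : ι → Ω → Prop) :
    prob (fun ω => ∃ i ∈ I, E i ω) ≤ ∑ i ∈ I, prob (E i) := by
  simp only [prob]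
  rw [← Finset.expect_sum_comm]
  refine Finset.expect_le_expect fun ω _ => ?_
  split_ifs with h
  · obtain ⟨i, hi, hE⟩ := h
    refine le_trans (le_of_eq ?_) (Finset.single_le_sum
      (f := fun i => if E i ω then (1 : ℝ) else 0) (fun _ _ => by split_ifs <;> norm_num) hi)
    simp [hE]
  · exact Finset.sum_nonneg fun _ _ => by split_ifs <;> norm_num

theorem prob_exists_le_card_mul {ι : Type*} (I : Finset ι) (E : ι → Ω → Prop) {δ : ℝ}
    (h : ∀ i ∈ I, prob (E i) ≤ δ) : prob (fun ω => ∃ i ∈ I, E i ω) ≤ I.card * δ :=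
  (prob_exists_le I E).trans (by simpa using Finset.sum_le_sum h)

theorem half_le_unifProb [Nonempty Ω] (E : Set Ω) (h : prob (fun ω => ω ∉ E) ≤ 1 / 2) :
    1 / 2 ≤ unifProb E := by
  have hc : (0 : ℝ) < Fintype.card Ω := by exact_mod_cast Fintype.card_pos
  rw [unifProb, PMF.toOuterMeasure_uniformOfFintype_apply]
  have h1 : prob (fun ω => ω ∉ E) = 1 - (Fintype.card E : ℝ) / Fintype.card Ω := by
    have h2 : ∀ ω, (if ω ∉ E then (1 : ℝ) else 0) = 1 - if ω ∈ E then 1 else 0 := by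
      intro ω
      by_cases h : ω ∈ E <;> simp [h]
    have h3 : prob (fun ω => ω ∉ E) = 𝔼 ω, (1 - if ω ∈ E then (1 : ℝ) else 0) :=
      Finset.expect_congr rfl fun ω _ => by rw [← h2 ω]; congr
    rw [h3, Finset.expect_sub_distrib, Fintype.expect_const, Fintype.expect_eq_sum_div_card]
    congr 2
    rw [Finset.sum_boole, ← Set.toFinset_card]
    congr 2
    ext ω
    simp
  have h3 : (1 : ℝ) / 2 ≤ Fintype.card E / Fintype.card Ω := by linarith
  have h4 := ENNReal.ofReal_le_ofReal h3
  rw [ENNReal.ofReal_div_of_pos hc, ENNReal.ofReal_natCast, ENNReal.ofReal_natCast,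
    ENNReal.ofReal_div_of_pos two_pos] at h4
  simpa using h4

theorem expect_prod_type {Ω' : Type*} [Fintype Ω'] (f : Ω × Ω' → ℝ) :
    𝔼 x, f x = 𝔼 a, 𝔼 b, f (a, b) := by
  rw [← Finset.univ_product_univ, Finset.expect_product]

end Basic

/-- Marginals of the uniform distribution on a power are uniform. -/
theorem expect_comp_injective {ι κ A : Type*} [Fintype ι] [DecidableEq ι]
    [Fintype κ] [DecidableEq κ] [Fintype A] [Nonempty A]
    (e : κ → ι) (he : Function.Injective e) (g : (κ → A) → ℝ) :
    𝔼 w : ι → A, g (w ∘ e) = 𝔼 v : κ → A, g v := by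
  let E := Equiv.piEquivPiSubtypeProd (fun i => i ∈ Set.range e) (fun _ => A)
  let E' : (κ → A) ≃ ({i // i ∈ Set.range e} → A) :=
    Equiv.arrowCongr (Equiv.ofInjective e he) (Equiv.refl A)
  rw [Fintype.expect_equiv E (fun w => g (w ∘ e)) (fun p => g (E'.symm p.1))]
  · rw [expect_prod_type]
    simp only [Fintype.expect_const]
    exact Fintype.expect_equiv E'.symm _ _ fun _ => rfl
  · intro w
    congr 1

theorem prob_comp_injective {ι κ A : Type*} [Fintype ι] [DecidableEq ι]
    [Fintype κ] [DecidableEq κ] [Fintype A] [Nonempty A]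
    (e : κ → ι) (he : Function.Injective e) (E : (κ → A) → Prop) :
    prob (fun w : ι → A => E (w ∘ e)) = prob E :=
  expect_comp_injective e he fun v => if E v then (1 : ℝ) else 0

/-- Uses e^x ≤ 1 + x + x² for |x| ≤ 1. This elementary substitute for Hoeffding's lemma loses only a
constant factor in the exponent. -/
theorem expect_exp_le_of_abs_le {A : Type*} [Fintype A] [Nonempty A] {X : A → ℝ} {c : ℝ}
    (hc : c ≤ 1) (hX : ∀ a, |X a| ≤ c) (h0 : 𝔼 a, X a = 0) :
    𝔼 a, Real.exp (X a) ≤ Real.exp (c ^ 2) := by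
  calc 𝔼 a, Real.exp (X a) ≤ 𝔼 a, (1 + X a + c ^ 2) := by
        refine Finset.expect_le_expect fun a _ => ?_
        have h1 := (abs_le.1 (Real.abs_exp_sub_one_sub_id_le ((hX a).trans hc))).2
        have h2 : X a ^ 2 ≤ c ^ 2 := sq_le_sq' (neg_le_of_abs_le (hX a)) (le_of_abs_le (hX a))
        linarith
    _ = 1 + c ^ 2 := by
        rw [Finset.expect_add_distrib, Finset.expect_add_distrib, h0, Fintype.expect_const,
          Fintype.expect_const]
        ring
    _ ≤ Real.exp (c ^ 2) := by
        have := Real.add_one_le_exp (c ^ 2)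
        linarith

/-- Exponential moments of functions with bounded differences. -/
theorem expect_exp_le_of_boundedDifferences {A : Type*} [Fintype A] [Nonempty A] {r c : ℝ}
    (hr : 0 ≤ r) (hrc : r * c ≤ 1) :
    ∀ (m : ℕ) (F : (Fin m → A) → ℝ), (∀ x i a, |F (Function.update x i a) - F x| ≤ c) →
      𝔼 x, Real.exp (r * (F x - 𝔼 y, F y)) ≤ Real.exp (m * (r * c) ^ 2) := by
  intro m
  induction m with
  | zero =>
    intro F _
    have : ∀ x : Fin 0 → A, F x = 𝔼 y, F y := by
      intro x
      rw [Finset.expect_congr rfl (g := fun _ => F x) (fun y _ => by rw [Subsingleton.elim y x]),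
        Fintype.expect_const]
    simp
  | succ m ih =>
    intro F hF
    -- Averaging out the first coordinate keeps the differences bounded. Conditionally on the rest,
    -- `F - G` has mean zero and is at most `c` in absolute value, so one coordinate costs the
    -- factor exp((rc)²).
    let G : (Fin m → A) → ℝ := fun y => 𝔼 a, F (Fin.cons a y)
    have hdec : ∀ g : (Fin (m + 1) → A) → ℝ, 𝔼 x, g x = 𝔼 y, 𝔼 a, g (Fin.cons a y) := by
      intro g
      rw [Finset.expect_comm, ← expect_prod_type (fun p : A × (Fin m → A) => g (Fin.cons p.1 p.2))]
      exact (Fintype.expect_equiv (Fin.consEquiv fun _ => A) _ _ fun _ => rfl).symm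
    have hG : ∀ x i a, |G (Function.update x i a) - G x| ≤ c := by
      intro x i a
      simp only [G]
      rw [← Finset.expect_sub_distrib]
      refine (Finset.abs_expect_le _ _).trans ?_
      refine (Finset.expect_le_expect (g := fun _ => c) fun b _ => ?_).trans
        (Fintype.expect_const c).le
      rw [Fin.cons_update]
      exact hF _ _ _
    have hEG : 𝔼 y, F y = 𝔼 y, G y := hdec F
    rw [hdec]
    calc _ ≤ 𝔼 y, Real.exp (r * (G y - 𝔼 z, G z)) * Real.exp ((r * c) ^ 2) := by
          refine Finset.expect_le_expect fun y _ => ?_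
          have h1 : ∀ a, Real.exp (r * (F (Fin.cons a y) - 𝔼 z, F z)) =
              Real.exp (r * (G y - 𝔼 z, G z)) * Real.exp (r * (F (Fin.cons a y) - G y)) := by
            intro a
            rw [← Real.exp_add, hEG]
            congr 1; ring
          simp only [h1]
          rw [← Finset.mul_expect]
          refine mul_le_mul_of_nonneg_left ?_ (Real.exp_pos _).le
          refine expect_exp_le_of_abs_le hrc (fun a => ?_) ?_
          · rw [abs_mul, abs_of_nonneg hr]
            refine mul_le_mul_of_nonneg_left ?_ hr
            have h2 : F (Fin.cons a y) - G y = 𝔼 b, (F (Fin.cons a y) - F (Fin.cons b y)) := by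
              rw [Finset.expect_sub_distrib, Fintype.expect_const]
            rw [h2]
            refine (Finset.abs_expect_le _ _).trans ?_
            refine (Finset.expect_le_expect (g := fun _ => c) fun b _ => ?_).trans
              (Fintype.expect_const c).le
            have h3 := hF (Fin.cons b y) 0 a
            rwa [Fin.update_cons_zero] at h3
          · rw [← Finset.mul_expect, Finset.expect_sub_distrib, Fintype.expect_const, sub_self,
              mul_zero]
      _ = (𝔼 y, Real.exp (r * (G y - 𝔼 z, G z))) * Real.exp ((r * c) ^ 2) := by
          rw [Finset.expect_mul]
      _ ≤ Real.exp (m * (r * c) ^ 2) * Real.exp ((r * c) ^ 2) :=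
          mul_le_mul_of_nonneg_right (ih G hG) (Real.exp_pos _).le
      _ = _ := by
          rw [← Real.exp_add]
          congr 1; push_cast; ring

/-- A bounded differences inequality. -/
theorem prob_boundedDifferences_le {A : Type*} [Fintype A] [Nonempty A] {m : ℕ} {c₀ l μ : ℝ}
    (hm : 0 < m) (hc₀ : 1 ≤ c₀) (hl0 : 0 ≤ l) (hl1 : l ≤ 1) (F : (Fin m → A) → ℝ)
    (hF : ∀ x i a, |F (Function.update x i a) - F x| ≤ c₀ / m) (hμ : 𝔼 x, F x ≤ μ) :
    prob (fun x => μ + l ≤ F x) ≤ Real.exp (-(l ^ 2 * m / (4 * c₀ ^ 2))) := by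
  have hm' : (0 : ℝ) < m := by exact_mod_cast hm
  have hc : 0 < c₀ := by linarith
  -- This `r` minimises the exponent m (r c₀ / m)² - r l of Chernoff's bound.
  set r : ℝ := m * l / (2 * c₀ ^ 2) with hr
  have hr0 : 0 ≤ r := by positivity
  have hrc : r * (c₀ / m) = l / (2 * c₀) := by rw [hr]; field_simp
  have hrc1 : r * (c₀ / m) ≤ 1 := by
    rw [hrc, div_le_one (by positivity)]
    linarith
  calc prob (fun x => μ + l ≤ F x)
      ≤ 𝔼 x, Real.exp (r * (F x - 𝔼 y, F y)) * Real.exp (-(r * l)) := by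
        refine prob_le_expect (fun x => by positivity) fun x hx => ?_
        rw [← Real.exp_add]
        refine Real.one_le_exp ?_
        have : l ≤ F x - 𝔼 y, F y := by linarith
        have := mul_le_mul_of_nonneg_left this hr0
        linarith
    _ = (𝔼 x, Real.exp (r * (F x - 𝔼 y, F y))) * Real.exp (-(r * l)) := by rw [Finset.expect_mul]
    _ ≤ Real.exp (m * (r * (c₀ / m)) ^ 2) * Real.exp (-(r * l)) :=
        mul_le_mul_of_nonneg_right (expect_exp_le_of_boundedDifferences hr0 hrc1 m F hF)
          (Real.exp_pos _).le
    _ = _ := by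
        rw [← Real.exp_add, hrc, hr]
        congr 1
        field_simp
        ring

end Probability

/-! ## Block sums of random shifts -/

section RandomBlocks

open scoped BigOperators Classical

variable {N : ℕ} {h b : ℕ}

/-- The sum of the entries of the table `v` chosen by `x`, one from each row. -/
def tableSum (v : Fin h × Fin b → ZMod N) (x : Fin h → Fin b) : ZMod N := ∑ j, v (j, x j)

/-- The number of choices with sum `c`. -/
def tableCount (v : Fin h × Fin b → ZMod N) (c : ZMod N) : ℕ :=
  (Finset.univ.filter fun x => tableSum v x = c).card

/-- The amount by which the counts fall short of the uniform distribution. -/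
def tableDeficit [NeZero N] (v : Fin h × Fin b → ZMod N) : ℕ :=
  ∑ c, (b ^ h - N * tableCount v c)

theorem blockDeficit_eq_tableDeficit [NeZero N] (sh : ℤ → ZMod N) (t : ℤ) :
    blockDeficit sh t b h = tableDeficit fun p : Fin h × Fin b =>
      sh (t + ((p.1 * b + p.2 : ℕ) : ℤ)) := by
  simp only [blockDeficit, tableDeficit, blockCount, tableCount]
  refine Finset.sum_congr rfl fun c _ => ?_
  congr 3

variable [NeZero N]

theorem sum_tableCount (v : Fin h × Fin b → ZMod N) : ∑ c, tableCount v c = b ^ h := by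
  simp only [tableCount]
  rw [← Finset.card_eq_sum_card_fiberwise (fun _ _ => Finset.mem_univ _)]
  simp

/-- The sum of the squared counts is the number of pairs of choices with equal sums, which brings in
pairwise independence. -/
theorem sum_tableCount_sq (v : Fin h × Fin b → ZMod N) :
    ∑ c, (tableCount v c : ℝ) ^ 2 = ∑ x, ∑ y, if tableSum v x = tableSum v y then 1 else 0 := by
  have h1 : ∀ c, (tableCount v c : ℝ) = ∑ x, if tableSum v x = c then 1 else 0 := by
    intro c
    rw [tableCount, Finset.sum_boole]
  simp only [sq]
  calc _ = ∑ c, ∑ x, ∑ y, (if tableSum v x = c then (1 : ℝ) else 0) *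
        (if tableSum v y = c then 1 else 0) := by
        simp only [h1, Finset.sum_mul_sum]
    _ = ∑ x, ∑ y, ∑ c, (if tableSum v x = c then (1 : ℝ) else 0) *
        (if tableSum v y = c then 1 else 0) := by
        rw [Finset.sum_comm]
        exact Finset.sum_congr rfl fun x _ => Finset.sum_comm
    _ = _ := by
        refine Finset.sum_congr rfl fun x _ => Finset.sum_congr rfl fun y _ => ?_
        simp [eq_comm]

theorem sum_sq_tableCount_sub (v : Fin h × Fin b → ZMod N) :
    ∑ c, ((N : ℝ) * tableCount v c - (b : ℝ) ^ h) ^ 2 =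
      (N : ℝ) ^ 2 * ∑ c, (tableCount v c : ℝ) ^ 2 - N * ((b : ℝ) ^ h) ^ 2 := by
  have h1 : ∑ c, (tableCount v c : ℝ) = (b : ℝ) ^ h := by exact_mod_cast sum_tableCount v
  have h2 : ∀ c, ((N : ℝ) * tableCount v c - (b : ℝ) ^ h) ^ 2 =
      (N : ℝ) ^ 2 * (tableCount v c : ℝ) ^ 2 - 2 * N * (b : ℝ) ^ h * tableCount v c +
        ((b : ℝ) ^ h) ^ 2 := fun c => by ring
  simp only [h2]
  rw [Finset.sum_add_distrib, Finset.sum_sub_distrib, ← Finset.mul_sum, ← Finset.mul_sum, h1,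
    Finset.sum_const, Finset.card_univ, ZMod.card, nsmul_eq_mul]
  ring

/-- Different choices have pairwise independent sums. -/
theorem expect_tableSum_eq {x y : Fin h → Fin b} (hxy : x ≠ y) :
    𝔼 v : Fin h × Fin b → ZMod N, (if tableSum v x = tableSum v y then (1 : ℝ) else 0) =
      (N : ℝ)⁻¹ := by
  obtain ⟨j, hj⟩ := Function.ne_iff.1 hxy
  have hN : (N : ℝ) ≠ 0 := by exact_mod_cast NeZero.ne N
  -- Adding `a` to the entry `(j, x j)`, which `x` uses and `y` does not, is a measure-preserving
  -- change that translates the difference of the two sums by `a`. Hence that difference is uniform.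
  let δ : ZMod N → (Fin h × Fin b → ZMod N) := fun a => Pi.single (j, x j) a
  have hadd : ∀ v a, tableSum (v + δ a) x - tableSum (v + δ a) y =
      tableSum v x - tableSum v y + a := by
    intro v a
    have h1 : tableSum (δ a) x = a := by
      rw [tableSum, Finset.sum_eq_single j]
      · simp [δ]
      · intro k _ hk
        simp [δ, hk]
      · simp
    have h2 : tableSum (δ a) y = 0 := by
      refine Finset.sum_eq_zero fun k _ => ?_
      simp only [δ, Pi.single_apply, Prod.mk.injEq]
      rw [if_neg]
      rintro ⟨rfl, h⟩
      exact hj h.symm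
    have h3 : ∀ z, tableSum (v + δ a) z = tableSum v z + tableSum (δ a) z := by
      intro z
      simp [tableSum, Finset.sum_add_distrib]
    rw [h3, h3, h1, h2]
    ring
  have hinv : ∀ a : ZMod N, 𝔼 v : Fin h × Fin b → ZMod N,
      (if tableSum v x = tableSum v y then (1 : ℝ) else 0) =
      𝔼 v : Fin h × Fin b → ZMod N, (if tableSum v x - tableSum v y = a then (1 : ℝ) else 0) := by
    intro a
    refine (Fintype.expect_equiv (Equiv.addRight (δ a)) _ _ fun v => ?_)
    simp only [Equiv.coe_addRight, hadd]
    refine if_congr ⟨fun h => by rw [h]; ring, fun h => sub_eq_zero.1 ?_⟩ rfl rfl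
    linear_combination h
  have hsum : (N : ℝ) * 𝔼 v : Fin h × Fin b → ZMod N,
      (if tableSum v x = tableSum v y then (1 : ℝ) else 0) = 1 := by
    calc _ = ∑ a : ZMod N, 𝔼 v : Fin h × Fin b → ZMod N,
          (if tableSum v x = tableSum v y then (1 : ℝ) else 0) := by
          rw [Finset.sum_const, Finset.card_univ, ZMod.card, nsmul_eq_mul]
      _ = ∑ a : ZMod N, 𝔼 v : Fin h × Fin b → ZMod N,
          (if tableSum v x - tableSum v y = a then (1 : ℝ) else 0) :=
          Finset.sum_congr rfl fun a _ => hinv a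
      _ = 1 := by
          rw [← Finset.expect_sum_comm]
          simp
  field_simp
  linarith

/-- The second moment of the counts. -/
theorem expect_sum_sq_le : 𝔼 v : Fin h × Fin b → ZMod N,
    ∑ c, ((N : ℝ) * tableCount v c - (b : ℝ) ^ h) ^ 2 ≤ (N : ℝ) ^ 2 * (b : ℝ) ^ h := by
  have hN : (N : ℝ) ≠ 0 := by exact_mod_cast NeZero.ne N
  simp only [sum_sq_tableCount_sub, sum_tableCount_sq]
  rw [Finset.expect_sub_distrib, Fintype.expect_const, ← Finset.mul_expect,
    Finset.expect_sum_comm]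
  simp only [Finset.expect_sum_comm]
  have h1 : ∀ x y : Fin h → Fin b, 𝔼 v : Fin h × Fin b → ZMod N,
      (if tableSum v x = tableSum v y then (1 : ℝ) else 0) ≤
      (if x = y then 1 else 0) + (N : ℝ)⁻¹ := by
    intro x y
    by_cases hxy : x = y
    · subst hxy
      simp
    · rw [expect_tableSum_eq hxy]
      simp [hxy]
  have h2 : ∑ x, ∑ y, 𝔼 v : Fin h × Fin b → ZMod N,
      (if tableSum v x = tableSum v y then (1 : ℝ) else 0) ≤
      (b : ℝ) ^ h + ((b : ℝ) ^ h) ^ 2 * (N : ℝ)⁻¹ := by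
    refine (Finset.sum_le_sum fun x _ => Finset.sum_le_sum fun y _ => h1 x y).trans
      (le_of_eq ?_)
    simp only [Finset.sum_add_distrib, Finset.sum_ite_eq, Finset.mem_univ, if_true,
      Finset.sum_const, Finset.card_univ, Fintype.card_fun, Fintype.card_fin, nsmul_eq_mul]
    push_cast
    ring
  have h3 := mul_le_mul_of_nonneg_left h2 (sq_nonneg (N : ℝ))
  have h4 : (N : ℝ) ^ 2 * ((b : ℝ) ^ h + ((b : ℝ) ^ h) ^ 2 * (N : ℝ)⁻¹) =
      (N : ℝ) ^ 2 * (b : ℝ) ^ h + N * ((b : ℝ) ^ h) ^ 2 := by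
    field_simp
  linarith

theorem cast_sub_sq_le (B m : ℕ) : ((B - m : ℕ) : ℝ) ^ 2 ≤ ((m : ℝ) - B) ^ 2 := by
  rcases le_total m B with h | h
  · rw [Nat.cast_sub h]
    apply le_of_eq; ring
  · rw [Nat.sub_eq_zero_of_le h]
    simpa using sq_nonneg _

/-- Markov's inequality for the sum of the squared deviations: by Cauchy–Schwarz, the squared
deficit is at most `N` times that sum. -/
theorem prob_tableDeficit_gt (hb : 0 < b) :
    prob (fun v : Fin h × Fin b → ZMod N => N * b ^ h < 2 * N * tableDeficit v) ≤
      4 * (N : ℝ) ^ 3 / (b : ℝ) ^ h := by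
  have hN : (0 : ℝ) < N := by exact_mod_cast Nat.pos_of_ne_zero (NeZero.ne N)
  have hB : (0 : ℝ) < (b : ℝ) ^ h := by positivity
  calc _ ≤ 𝔼 v : Fin h × Fin b → ZMod N, (4 * N / ((b : ℝ) ^ h) ^ 2) *
        ∑ c, ((N : ℝ) * tableCount v c - (b : ℝ) ^ h) ^ 2 := by
        refine prob_le_expect (fun v => by positivity) fun v hv => ?_
        have h1 : (b : ℝ) ^ h < 2 * tableDeficit v := by
          have : (N : ℝ) * (b : ℝ) ^ h < 2 * N * tableDeficit v := by exact_mod_cast hv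
          have h' : (N : ℝ) * (b : ℝ) ^ h < N * (2 * tableDeficit v) := by linarith
          exact lt_of_mul_lt_mul_left h' hN.le
        have h2 : (tableDeficit v : ℝ) ^ 2 ≤
            N * ∑ c, ((N : ℝ) * tableCount v c - (b : ℝ) ^ h) ^ 2 := by
          have h3 := sq_sum_le_card_mul_sum_sq (s := (Finset.univ : Finset (ZMod N)))
            (f := fun c => ((b ^ h - N * tableCount v c : ℕ) : ℝ))
          rw [Finset.card_univ, ZMod.card] at h3
          rw [tableDeficit, Nat.cast_sum]
          refine h3.trans (mul_le_mul_of_nonneg_left (Finset.sum_le_sum fun c _ => ?_) hN.le)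
          have := cast_sub_sq_le (b ^ h) (N * tableCount v c)
          push_cast at this ⊢
          exact this
        rw [div_mul_eq_mul_div, le_div_iff₀ (by positivity), one_mul]
        nlinarith
    _ = (4 * N / ((b : ℝ) ^ h) ^ 2) * 𝔼 v : Fin h × Fin b → ZMod N,
        ∑ c, ((N : ℝ) * tableCount v c - (b : ℝ) ^ h) ^ 2 := by rw [Finset.mul_expect]
    _ ≤ (4 * N / ((b : ℝ) ^ h) ^ 2) * ((N : ℝ) ^ 2 * (b : ℝ) ^ h) :=
        mul_le_mul_of_nonneg_left expect_sum_sq_le (by positivity)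
    _ = _ := by field_simp

/-- With B = b^h, the inequality d ≤ (p/B) d² + B/(4p) passes from the shortfall of one residue to
its square. By the second moment bound the first terms contribute at most pN/B, which is at most
1/(4p) when an average residue is hit at least 4p² times; the second terms contribute 1/(4p). -/
theorem expect_tableDeficit_le {p : ℕ} (hp : 0 < p) (hB : 4 * p ^ 2 * N ≤ b ^ h) :
    𝔼 v : Fin h × Fin b → ZMod N, (tableDeficit v : ℝ) / (N * (b : ℝ) ^ h) ≤ 1 / (2 * p) := by
  have hN : (0 : ℝ) < N := by exact_mod_cast Nat.pos_of_ne_zero (NeZero.ne N)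
  have hp' : (0 : ℝ) < p := by exact_mod_cast hp
  have hB' : 4 * (p : ℝ) ^ 2 * N ≤ (b : ℝ) ^ h := by exact_mod_cast hB
  set B : ℝ := (b : ℝ) ^ h with hBdef
  have hB0 : 0 < B := lt_of_lt_of_le (by positivity) hB'
  calc _ ≤ 𝔼 v : Fin h × Fin b → ZMod N, (p / (N * B ^ 2) *
        ∑ c, ((N : ℝ) * tableCount v c - B) ^ 2 + 1 / (4 * p)) := by
        refine Finset.expect_le_expect fun v _ => ?_
        have h1 : (tableDeficit v : ℝ) ≤ ∑ c, (p / B * ((N : ℝ) * tableCount v c - B) ^ 2 +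
            B / (4 * p)) := by
          rw [tableDeficit, Nat.cast_sum]
          refine Finset.sum_le_sum fun c _ => ?_
          have h2 := cast_sub_sq_le (b ^ h) (N * tableCount v c)
          set d : ℝ := ((b ^ h - N * tableCount v c : ℕ) : ℝ) with hd
          push_cast at h2
          rw [← hBdef] at h2
          have h3 : d ≤ p / B * d ^ 2 + B / (4 * p) := by
            have h4 : p / B * d ^ 2 + B / (4 * p) - d =
                (2 * p * d - B) ^ 2 / (4 * p * B) := by
              field_simp
              ring
            have h5 : 0 ≤ (2 * p * d - B) ^ 2 / (4 * p * B) := by positivity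
            linarith
          have h6 : p / B * d ^ 2 ≤ p / B * ((N : ℝ) * tableCount v c - B) ^ 2 :=
            mul_le_mul_of_nonneg_left h2 (by positivity)
          linarith
        rw [Finset.sum_add_distrib, ← Finset.mul_sum, Finset.sum_const, Finset.card_univ,
          ZMod.card, nsmul_eq_mul] at h1
        rw [div_le_iff₀ (by positivity)]
        refine h1.trans (le_of_eq ?_)
        field_simp
    _ = p / (N * B ^ 2) * (𝔼 v : Fin h × Fin b → ZMod N,
        ∑ c, ((N : ℝ) * tableCount v c - B) ^ 2) + 1 / (4 * p) := by
        rw [Finset.expect_add_distrib, Fintype.expect_const, Finset.mul_expect]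
    _ ≤ p / (N * B ^ 2) * ((N : ℝ) ^ 2 * B) + 1 / (4 * p) := by
        gcongr
        exact expect_sum_sq_le
    _ ≤ 1 / (4 * p) + 1 / (4 * p) := by
        gcongr ?_ + _
        rw [div_mul_eq_mul_div, div_le_div_iff₀ (by positivity) (by positivity)]
        have := mul_le_mul_of_nonneg_left hB' (show 0 ≤ N * B by positivity)
        nlinarith
    _ = _ := by field_simp; norm_num

theorem tableDeficit_le (v : Fin h × Fin b → ZMod N) : tableDeficit v ≤ N * b ^ h := by
  calc tableDeficit v ≤ ∑ _c : ZMod N, b ^ h := Finset.sum_le_sum fun c _ => Nat.sub_le _ _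
    _ = N * b ^ h := by simp [ZMod.card]

/-- Changing one column of the table changes few of the sums. -/
theorem abs_tableDeficit_sub_le (v v' : Fin h × Fin b → ZMod N) (i : Fin b)
    (hv : ∀ j k, k ≠ i → v (j, k) = v' (j, k)) :
    |(tableDeficit v : ℝ) - tableDeficit v'| ≤ N * (2 * h * (b : ℝ) ^ (h - 1)) := by
  -- Only choices that use column `i` in some row change their sum. There are at most h b^(h-1) of
  -- them, and each affects at most two counts.
  let S : Finset (Fin h → Fin b) := Finset.univ.filter fun x => ∃ j, x j = i
  have hS : (S.card : ℝ) ≤ h * (b : ℝ) ^ (h - 1) := by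
    have h1 : S ⊆ Finset.univ.biUnion fun j : Fin h =>
        (Finset.univ.filter fun x : Fin h → Fin b => x j = i) := by
      intro x hx
      simpa [S] using hx
    have h2 : ∀ j : Fin h, (Finset.univ.filter fun x : Fin h → Fin b => x j = i).card =
        b ^ (h - 1) := by
      intro j
      have := Fintype.card_filter_piFinset_const_eq_of_mem (Finset.univ : Finset (Fin b)) j
        (Finset.mem_univ i)
      rw [Fintype.piFinset_univ] at this
      simpa using this
    have h3 := (Finset.card_le_card h1).trans Finset.card_biUnion_le
    simp only [h2, Finset.sum_const, Finset.card_univ, Fintype.card_fin, smul_eq_mul] at h3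
    exact_mod_cast h3
  have hcount : ∀ c, |(tableCount v c : ℝ) - tableCount v' c| ≤
      ∑ x ∈ S, ((if tableSum v x = c then 1 else 0) + if tableSum v' x = c then 1 else 0) := by
    intro c
    have h1 : ∀ u : Fin h × Fin b → ZMod N,
        (tableCount u c : ℝ) = ∑ x, if tableSum u x = c then 1 else 0 := by
      intro u
      rw [tableCount, Finset.sum_boole]
    rw [h1, h1, ← Finset.sum_sub_distrib,
      ← Finset.sum_subset (Finset.subset_univ S) (fun x _ hx => ?_)]
    · refine (Finset.abs_sum_le_sum_abs _ _).trans (Finset.sum_le_sum fun x _ => ?_)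
      split_ifs <;> norm_num
    · have : tableSum v x = tableSum v' x := by
        refine Finset.sum_congr rfl fun j _ => hv j _ fun hj => hx ?_
        simp only [S, Finset.mem_filter, Finset.mem_univ, true_and]
        exact ⟨j, hj⟩
      rw [this, sub_self]
  have hterm : ∀ a m m' : ℕ, |((a - N * m : ℕ) : ℝ) - ((a - N * m' : ℕ) : ℝ)| ≤
      N * |(m : ℝ) - m'| := by
    intro a m m'
    have h1 : ∀ k : ℕ, ((a - N * k : ℕ) : ℝ) = max ((a : ℝ) - N * k) 0 := by
      intro k
      rcases le_total (N * k) a with h | h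
      · rw [Nat.cast_sub h, max_eq_left]
        · push_cast; ring
        · rw [sub_nonneg]; exact_mod_cast h
      · rw [Nat.sub_eq_zero_of_le h, max_eq_right]
        · simp
        · rw [sub_nonpos]; exact_mod_cast h
    rw [h1, h1]
    refine (abs_max_sub_max_le_abs _ _ _).trans (le_of_eq ?_)
    rw [show (a : ℝ) - N * m - (a - N * m') = N * (m' - m) by ring, abs_mul, Nat.abs_cast,
      abs_sub_comm]
  calc _ ≤ ∑ c, |((b ^ h - N * tableCount v c : ℕ) : ℝ) - ((b ^ h - N * tableCount v' c : ℕ) : ℝ)| := by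
        rw [tableDeficit, tableDeficit, Nat.cast_sum, Nat.cast_sum, ← Finset.sum_sub_distrib]
        exact Finset.abs_sum_le_sum_abs _ _
    _ ≤ ∑ c, (N : ℝ) * ∑ x ∈ S, ((if tableSum v x = c then 1 else 0) +
          if tableSum v' x = c then 1 else 0) := by
        refine Finset.sum_le_sum fun c _ => (hterm _ _ _).trans ?_
        exact mul_le_mul_of_nonneg_left (hcount c) (Nat.cast_nonneg _)
    _ = N * (2 * S.card) := by
        rw [← Finset.mul_sum, Finset.sum_comm]
        simp only [Finset.sum_add_distrib, Finset.sum_ite_eq, Finset.mem_univ, if_true,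
          Finset.sum_const, nsmul_eq_mul]
        ring
    _ ≤ _ := by
        rw [mul_assoc 2]
        gcongr

theorem prob_equiv {Ω Ω' : Type*} [Fintype Ω] [Fintype Ω'] (e : Ω ≃ Ω') (E : Ω' → Prop) :
    prob (fun ω => E (e ω)) = prob E :=
  Fintype.expect_equiv e _ _ fun _ => rfl

/-- The independent coordinates are the `b` columns of the table, and each moves the normalised
deficit by at most 2h/b. The mean is at most 1/(2p), so a deviation of another 1/(2p) has to be
excluded. This is effective only if `b` is large compared with p² h² log N. -/
theorem prob_single_window {p : ℕ} (hh : 0 < h) (hb : 0 < b) (hp : 0 < p)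
    (hB : 4 * p ^ 2 * N ≤ b ^ h) :
    prob (fun v : Fin h × Fin b → ZMod N => N * b ^ h < p * tableDeficit v) ≤
      Real.exp (-((b : ℝ) / (64 * p ^ 2 * h ^ 2))) := by
  have hN : (0 : ℝ) < N := by exact_mod_cast Nat.pos_of_ne_zero (NeZero.ne N)
  have hp' : (0 : ℝ) < p := by exact_mod_cast hp
  have hp1 : (1 : ℝ) ≤ p := by exact_mod_cast hp
  have hh' : (0 : ℝ) < h := by exact_mod_cast hh
  have hh1 : (1 : ℝ) ≤ h := by exact_mod_cast hh
  have hb' : (0 : ℝ) < b := by exact_mod_cast hb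
  let e : (Fin b → Fin h → ZMod N) ≃ (Fin h × Fin b → ZMod N) :=
    { toFun := fun u q => u q.2 q.1
      invFun := fun v i j => v (j, i)
      left_inv := fun _ => rfl
      right_inv := fun _ => rfl }
  let F : (Fin b → Fin h → ZMod N) → ℝ := fun u =>
    (tableDeficit (e u) : ℝ) / (N * (b : ℝ) ^ h)
  have hF : ∀ x i a, |F (Function.update x i a) - F x| ≤ (2 * h : ℝ) / b := by
    intro x i a
    have h1 := abs_tableDeficit_sub_le (e (Function.update x i a)) (e x) i (fun j k hk => by
      simp [e, Function.update_of_ne hk])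
    simp only [F]
    rw [← sub_div, abs_div, abs_of_pos (show (0 : ℝ) < N * (b : ℝ) ^ h by positivity),
      div_le_div_iff₀ (by positivity) hb']
    calc _ ≤ (N * (2 * h * (b : ℝ) ^ (h - 1))) * b := mul_le_mul_of_nonneg_right h1 hb'.le
      _ = N * (2 * h * (b : ℝ) ^ (h - 1 + 1)) := by ring
      _ = _ := by rw [Nat.sub_add_cancel hh]; ring
  have hE : 𝔼 u, F u ≤ 1 / (2 * p) := by
    refine le_trans (le_of_eq ?_) (expect_tableDeficit_le (h := h) (b := b) hp hB)
    exact Fintype.expect_equiv e _ _ fun _ => rfl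
  have h1 := prob_boundedDifferences_le (l := 1 / (2 * p)) hb (by linarith) (by positivity)
    (by rw [div_le_one (by positivity)]; linarith) F hF hE
  rw [← prob_equiv e]
  refine (prob_mono fun u hu => ?_).trans (h1.trans (le_of_eq ?_))
  · have h2 : (N : ℝ) * (b : ℝ) ^ h < p * tableDeficit (e u) := by exact_mod_cast hu
    have h3 : (1 : ℝ) / (2 * p) + 1 / (2 * p) = 1 / p := by field_simp; norm_num
    rw [h3]
    simp only [F]
    rw [div_le_div_iff₀ hp' (by positivity)]
    linarith
  · congr 2
    field_simp
    norm_num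

/-- Here the coordinates are whole windows. Each normalised deficit lies in [0, 1], so one window
moves the average by at most 1/M. The bound does not depend on the block length and so covers hop
counts for which the blocks have bounded length. -/
theorem prob_windows {M p : ℕ} (hM : 0 < M) (hp : 0 < p) (hb : 0 < b)
    (hB : 4 * p ^ 2 * N ≤ b ^ h) :
    prob (fun V : Fin M → Fin h × Fin b → ZMod N => M * (N * b ^ h) < p * ∑ i, tableDeficit (V i)) ≤
      Real.exp (-((M : ℝ) / (16 * p ^ 2))) := by
  have hN : (0 : ℝ) < N := by exact_mod_cast Nat.pos_of_ne_zero (NeZero.ne N)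
  have hp' : (0 : ℝ) < p := by exact_mod_cast hp
  have hp1 : (1 : ℝ) ≤ p := by exact_mod_cast hp
  have hM' : (0 : ℝ) < M := by exact_mod_cast hM
  have hb' : (0 : ℝ) < b := by exact_mod_cast hb
  let f : (Fin h × Fin b → ZMod N) → ℝ := fun v => (tableDeficit v : ℝ) / (N * (b : ℝ) ^ h)
  have hf0 : ∀ v, 0 ≤ f v := fun v => by positivity
  have hf1 : ∀ v, f v ≤ 1 := by
    intro v
    rw [div_le_one (by positivity)]
    exact_mod_cast tableDeficit_le v
  let F : (Fin M → Fin h × Fin b → ZMod N) → ℝ := fun V => (∑ i, f (V i)) / M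
  have hF : ∀ x i a, |F (Function.update x i a) - F x| ≤ (1 : ℝ) / M := by
    intro x i a
    simp only [F]
    rw [← sub_div, abs_div, abs_of_pos hM', ← Finset.sum_sub_distrib, Finset.sum_eq_single i]
    · rw [Function.update_self]
      gcongr
      rw [abs_le]
      constructor <;> linarith [hf0 a, hf1 a, hf0 (x i), hf1 (x i)]
    · intro j _ hj
      rw [Function.update_of_ne hj, sub_self]
    · simp
  have hE : 𝔼 V, F V ≤ 1 / (2 * p) := by
    simp only [F]
    rw [← Finset.expect_div, Finset.expect_sum_comm, div_le_iff₀ hM']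
    calc _ ≤ ∑ _i : Fin M, (1 : ℝ) / (2 * p) := by
          refine Finset.sum_le_sum fun i _ => ?_
          refine le_trans (le_of_eq ?_) (expect_tableDeficit_le (h := h) (b := b) (N := N) hp hB)
          have h1 := expect_comp_injective (A := Fin h × Fin b → ZMod N) (fun _ : Unit => i)
            (fun _ _ _ => rfl) (fun u => f (u ()))
          refine h1.trans ?_
          exact Fintype.expect_equiv (Equiv.funUnique Unit _) _ _ fun _ => rfl
      _ = _ := by
          rw [Finset.sum_const, Finset.card_univ, Fintype.card_fin, nsmul_eq_mul, mul_comm]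
  have h1 := prob_boundedDifferences_le (l := 1 / (2 * p)) hM le_rfl (by positivity)
    (by rw [div_le_one (by positivity)]; linarith) F hF hE
  refine (prob_mono fun V hV => ?_).trans (h1.trans (le_of_eq ?_))
  · have h2 : (M : ℝ) * (N * (b : ℝ) ^ h) < p * ∑ i, (tableDeficit (V i) : ℝ) := by
      exact_mod_cast hV
    have h3 : (1 : ℝ) / (2 * p) + 1 / (2 * p) = 1 / p := by field_simp; norm_num
    rw [h3]
    simp only [F, f]
    rw [← Finset.sum_div, div_div, div_le_div_iff₀ hp' (by positivity)]
    linarith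
  · congr 2
    field_simp
    norm_num

end RandomBlocks

/-! ### Windows of a random schedule -/

set_option linter.unusedSectionVars false

section RandomSchedule

variable {N T : ℕ} [NeZero N]

/-- The schedule that is given by all entries of `w`. -/
def ShiftSchedule.ofFn (hT : 0 < T) (w : Fin T → ZMod N) : ShiftSchedule N :=
  ShiftSchedule.ofPrefix w T hT le_rfl

/-- The index of the shift in force at time `t`. -/
def slotIndex (hT : 0 < T) (t : ℤ) : Fin T :=
  ⟨(t % (T : ℤ)).toNat, by
    have h : (0 : ℤ) < T := by exact_mod_cast hT
    have h1 := Int.emod_nonneg t h.ne'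
    have h2 := Int.emod_lt_of_pos t h
    omega⟩

theorem shiftAt_ofFn (hT : 0 < T) (w : Fin T → ZMod N) (t : ℤ) :
    (ShiftSchedule.ofFn hT w).shiftAt t = w (slotIndex hT t) := rfl

theorem slotIndex_inj (hT : 0 < T) (t : ℤ) {i j : ℕ} (hi : i < T) (hj : j < T)
    (h : slotIndex hT (t + i) = slotIndex hT (t + j)) : i = j := by
  have hT' : (0 : ℤ) < T := by exact_mod_cast hT
  have h1 : ((t + i) % (T : ℤ)).toNat = ((t + j) % (T : ℤ)).toNat := congrArg Fin.val h
  have h2 := Int.emod_nonneg (t + i) hT'.ne'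
  have h3 := Int.emod_nonneg (t + j) hT'.ne'
  have h4 : (t + i) % (T : ℤ) = (t + j) % (T : ℤ) := by omega
  have h5 : (T : ℤ) ∣ (i : ℤ) - j := by
    have := Int.emod_emod_of_dvd
    have h6 := Int.emod_eq_emod_iff_emod_sub_eq_zero.1 h4
    have h7 := Int.dvd_of_emod_eq_zero h6
    rwa [show t + (i : ℤ) - (t + j) = i - j by ring] at h7
  have h6 : |(i : ℤ) - j| < T := by
    rw [abs_lt]
    constructor <;> omega
  have := Int.eq_zero_of_abs_lt_dvd h5 h6
  omega

theorem blockSlot_lt {h b : ℕ} (q : Fin h × Fin b) : (q.1 : ℕ) * b + q.2 < h * b := by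
  have h1 : ((q.1 : ℕ) + 1) * b ≤ h * b := Nat.mul_le_mul_right _ q.1.2
  have h2 := q.2.2
  rw [add_mul, one_mul] at h1
  omega

theorem blockSlot_inj {h b : ℕ} {q q' : Fin h × Fin b}
    (hq : (q.1 : ℕ) * b + q.2 = q'.1 * b + q'.2) : q = q' := by
  have hb : 0 < b := (Nat.zero_le _).trans_lt q.2.2
  have h1 := congrArg (· / b) hq
  have h2 := congrArg (· % b) hq
  simp only [Nat.add_comm ((_ : ℕ) * b), Nat.add_mul_div_right _ _ hb, Nat.add_mul_mod_self_right,
    Nat.div_eq_of_lt q.2.2, Nat.div_eq_of_lt q'.2.2, Nat.mod_eq_of_lt q.2.2,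
    Nat.mod_eq_of_lt q'.2.2, zero_add] at h1 h2
  exact Prod.ext (Fin.ext h1) (Fin.ext h2)

/-- A stretch of time no longer than the period, even one that wraps around, meets every entry of
the schedule at most once. So the shifts seen there are independent and uniform. -/
theorem prob_ofFn_table (hT : 0 < T) (t : ℤ) {h b : ℕ} (hhb : h * b ≤ T)
    (E : (Fin h × Fin b → ZMod N) → Prop) :
    prob (fun w : Fin T → ZMod N => E fun q => (ShiftSchedule.ofFn hT w).shiftAt
      (t + ((q.1 * b + q.2 : ℕ) : ℤ))) = prob E := by
  refine prob_comp_injective (fun q : Fin h × Fin b => slotIndex hT (t + (q.1 * b + q.2 : ℕ)))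
    (fun q q' hq => ?_) E
  exact blockSlot_inj (slotIndex_inj hT t ((blockSlot_lt q).trans_le hhb)
    ((blockSlot_lt q').trans_le hhb) hq)

theorem prob_fallback_fails (hT : 0 < T) (t : ℤ) {h b : ℕ} (hb : 0 < b) (hhb : h * b ≤ T) :
    prob (fun w : Fin T → ZMod N =>
      N * b ^ h < 2 * N * blockDeficit (ShiftSchedule.ofFn hT w).shiftAt t b h) ≤
      4 * (N : ℝ) ^ 3 / (b : ℝ) ^ h := by
  simp only [blockDeficit_eq_tableDeficit]
  exact (prob_ofFn_table hT t hhb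
    (fun v => N * b ^ h < 2 * N * tableDeficit v)).trans_le (prob_tableDeficit_gt hb)

theorem prob_single_window_fails (hT : 0 < T) (t : ℤ) {h b p : ℕ} (hh : 0 < h) (hb : 0 < b)
    (hhb : h * b ≤ T) (hp : 0 < p) (hB : 4 * p ^ 2 * N ≤ b ^ h) :
    prob (fun w : Fin T → ZMod N =>
      N * b ^ h < p * blockDeficit (ShiftSchedule.ofFn hT w).shiftAt t b h) ≤
      Real.exp (-((b : ℝ) / (64 * p ^ 2 * h ^ 2))) := by
  simp only [blockDeficit_eq_tableDeficit]
  exact (prob_ofFn_table hT t hhb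
    (fun v => N * b ^ h < p * tableDeficit v)).trans_le (prob_single_window hh hb hp hB)

theorem prob_windows_fail (hT : 0 < T) (t : ℤ) {M h b p : ℕ} (hM : 0 < M) (hb : 0 < b)
    (hhb : M * (h * b) ≤ T) (hp : 0 < p) (hB : 4 * p ^ 2 * N ≤ b ^ h) :
    prob (fun w : Fin T → ZMod N => M * (N * b ^ h) < p * ∑ i : Fin M,
      blockDeficit (ShiftSchedule.ofFn hT w).shiftAt (t + (i * (h * b) : ℕ)) b h) ≤
      Real.exp (-((M : ℝ) / (16 * p ^ 2))) := by
  simp only [blockDeficit_eq_tableDeficit]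
  refine le_trans (le_of_eq ?_) (prob_windows (N := N) hM hp hb hB)
  have hlt : ∀ q : Fin M × (Fin h × Fin b),
      (q.1 : ℕ) * (h * b) + (q.2.1 * b + q.2.2) < M * (h * b) := fun q =>
    blockSlot_lt (b := h * b) (q.1, ⟨_, blockSlot_lt q.2⟩)
  have h1 := prob_comp_injective (A := ZMod N)
    (fun q : Fin M × (Fin h × Fin b) =>
      slotIndex hT (t + (q.1 * (h * b) + (q.2.1 * b + q.2.2) : ℕ)))
    (fun q q' hq => by
      have h2 := slotIndex_inj hT t ((hlt q).trans_le hhb) ((hlt q').trans_le hhb) hq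
      have h3 := blockSlot_inj (b := h * b) (q := (q.1, ⟨_, blockSlot_lt q.2⟩))
        (q' := (q'.1, ⟨_, blockSlot_lt q'.2⟩)) h2
      have h4 : q.1 = q'.1 := (Prod.ext_iff.1 h3).1
      have h5 := congrArg Fin.val (Prod.ext_iff.1 h3).2
      exact Prod.ext h4 (blockSlot_inj h5))
    (fun v => M * (N * b ^ h) < p * ∑ i : Fin M, tableDeficit fun q => v (i, q))
  have h2 := prob_equiv (Equiv.curry (Fin M) (Fin h × Fin b) (ZMod N))
    (fun V => M * (N * b ^ h) < p * ∑ i : Fin M, tableDeficit (V i))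
  rw [← h2]
  refine Eq.trans ?_ h1
  congr 1
  funext w
  simp only [shiftAt_ofFn, Function.comp_def, add_assoc, Nat.cast_add]

end RandomSchedule

/-! ## Reasoning about programs -/

infixr:60 " ;; " => Prog.seq

/-- `Accepts` asks only for some accepting execution; determinism is what makes rejection provable
from one computed run. -/
theorem Exec.det {p : Prog} {st st₁ : MachineState} {m : ℕ} (h₁ : Exec p st st₁ m) :
    ∀ {st₂ : MachineState} {n : ℕ}, Exec p st st₂ n → st₁ = st₂ ∧ m = n := by
  induction h₁ with
  | const | add | sub | load | store => intro st₂ n h; cases h; exact ⟨rfl, rfl⟩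
  | seq _ _ ih₁ ih₂ =>
    intro st₂ n h
    cases h with
    | seq h₁ h₂ =>
      obtain ⟨rfl, rfl⟩ := ih₁ h₁
      obtain ⟨rfl, rfl⟩ := ih₂ h₂
      exact ⟨rfl, rfl⟩
  | ite_true ha _ ih =>
    intro st₂ n h
    cases h with
    | ite_true _ h => obtain ⟨rfl, rfl⟩ := ih h; exact ⟨rfl, rfl⟩
    | ite_false hb _ => exact absurd hb ha
  | ite_false ha _ ih =>
    intro st₂ n h
    cases h with
    | ite_true hb _ => exact absurd ha hb
    | ite_false _ h => obtain ⟨rfl, rfl⟩ := ih h; exact ⟨rfl, rfl⟩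
  | while_true ha _ _ ih₁ ih₂ =>
    intro st₂ n h
    cases h with
    | while_true _ h₁ h₂ =>
      obtain ⟨rfl, rfl⟩ := ih₁ h₁
      obtain ⟨rfl, rfl⟩ := ih₂ h₂
      exact ⟨rfl, rfl⟩
    | while_false hb => exact absurd hb ha
  | while_false ha =>
    intro st₂ n h
    cases h with
    | while_true hb _ _ => exact absurd ha hb
    | while_false _ => exact ⟨rfl, rfl⟩

namespace MachineState

@[simp]
theorem reg_setReg (st : MachineState) (d v r : ℕ) :
    (st.setReg d v).reg r = if r = d then v else st.reg r := by
  simp [setReg, Function.update_apply]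

@[simp]
theorem arr_setReg (st : MachineState) (d v : ℕ) : (st.setReg d v).arr = st.arr := rfl

@[simp]
theorem reg_setArr (st : MachineState) (A i v : ℕ) : (st.setArr A i v).reg = st.reg := rfl

@[simp]
theorem arr_setArr (st : MachineState) (A i v A' : ℕ) :
    (st.setArr A i v).arr A' = if A' = A then Function.update (st.arr A) i v else st.arr A' := by
  simp [setArr, Function.update_apply]

end MachineState

namespace Prog

/-- The registers that a program may change. -/
def regs : Prog → List ℕ
  | const d _ => [d]
  | add d _ _ => [d]
  | sub d _ _ => [d]
  | load d _ _ => [d]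
  | store _ _ _ => []
  | seq p q => p.regs ++ q.regs
  | ite _ p q => p.regs ++ q.regs
  | .while _ p => p.regs

/-- The arrays that a program may change. -/
def arrs : Prog → List ℕ
  | const _ _ => []
  | add _ _ _ => []
  | sub _ _ _ => []
  | load _ _ _ => []
  | store A _ _ => [A]
  | seq p q => p.arrs ++ q.arrs
  | ite _ p q => p.arrs ++ q.arrs
  | .while _ p => p.arrs

/-- The single instructions. -/
def isBasic : Prog → Bool
  | seq _ _ => false
  | ite _ _ _ => false
  | .while _ _ => false
  | _ => true

/-- The effect of a single instruction. -/
@[simp]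
def effect : Prog → MachineState → MachineState
  | const d n, st => st.setReg d n
  | add d a b, st => st.setReg d (st.reg a + st.reg b)
  | sub d a b, st => st.setReg d (st.reg a - st.reg b)
  | load d A i, st => st.setReg d (st.arr A (st.reg i))
  | store A i a, st => st.setArr A (st.reg i) (st.reg a)
  | _, st => st

/-- Repeat `p` as often as register `c` says; register 3 has to hold the value 1. -/
def rep (c : ℕ) (p : Prog) : Prog := .while c (.sub c c 3 ;; p)

end Prog

theorem Exec.reg_eq {p : Prog} {st st' : MachineState} {n : ℕ} (h : Exec p st st' n) (r : ℕ)
    (hr : r ∉ p.regs) : st'.reg r = st.reg r := by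
  induction h with
  | const | add | sub | load =>
    simp only [Prog.regs, List.mem_singleton] at hr
    exact Function.update_of_ne hr _ _
  | store => rfl
  | seq _ _ ih₁ ih₂ =>
    simp only [Prog.regs, List.mem_append, not_or] at hr
    rw [ih₂ hr.2, ih₁ hr.1]
  | ite_true _ _ ih =>
    simp only [Prog.regs, List.mem_append, not_or] at hr
    exact ih hr.1
  | ite_false _ _ ih =>
    simp only [Prog.regs, List.mem_append, not_or] at hr
    exact ih hr.2
  | while_true _ _ _ ih₁ ih₂ => rw [ih₂ hr, ih₁ hr]
  | while_false => rfl

theorem Exec.arr_eq {p : Prog} {st st' : MachineState} {n : ℕ} (h : Exec p st st' n) (A : ℕ)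
    (hA : A ∉ p.arrs) : st'.arr A = st.arr A := by
  induction h with
  | const | add | sub | load => rfl
  | store =>
    simp only [Prog.arrs, List.mem_singleton] at hA
    exact Function.update_of_ne hA _ _
  | seq _ _ ih₁ ih₂ =>
    simp only [Prog.arrs, List.mem_append, not_or] at hA
    rw [ih₂ hA.2, ih₁ hA.1]
  | ite_true _ _ ih =>
    simp only [Prog.arrs, List.mem_append, not_or] at hA
    exact ih hA.1
  | ite_false _ _ ih =>
    simp only [Prog.arrs, List.mem_append, not_or] at hA
    exact ih hA.2
  | while_true _ _ _ ih₁ ih₂ => rw [ih₂ hA, ih₁ hA]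
  | while_false => rfl

/-- Started in `st`, the program `p` halts within `B` steps in a state that satisfies `Q`. -/
def Runs (p : Prog) (B : ℕ) (st : MachineState) (Q : MachineState → Prop) : Prop :=
  ∃ (st' : MachineState) (n : ℕ), Exec p st st' n ∧ n ≤ B ∧ Q st'

/-- `st'` agrees with `st` except for what `p` may change. -/
def Frame (p : Prog) (st st' : MachineState) : Prop :=
  (∀ r, r ∉ p.regs → st'.reg r = st.reg r) ∧ ∀ A, A ∉ p.arrs → st'.arr A = st.arr A

namespace Runs

variable {p q : Prog} {B B' : ℕ} {st : MachineState} {Q Q' : MachineState → Prop}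

theorem mono (h : Runs p B st Q) (hB : B ≤ B') (hQ : ∀ st', Frame p st st' → Q st' → Q' st') :
    Runs p B' st Q' := by
  obtain ⟨st', n, h1, h2, h3⟩ := h
  exact ⟨st', n, h1, h2.trans hB, hQ st' ⟨h1.reg_eq, h1.arr_eq⟩ h3⟩

theorem basic (hp : p.isBasic = true) (h : Q (p.effect st)) : Runs p (B + 1) st Q := by
  refine ⟨p.effect st, 1, ?_, Nat.le_add_left _ _, h⟩
  cases p with
  | const d n => exact Exec.const d n st
  | add d a b => exact Exec.add d a b st
  | sub d a b => exact Exec.sub d a b st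
  | load d A i => exact Exec.load d A i st
  | store A i a => exact Exec.store A i a st
  | _ => simp [Prog.isBasic] at hp

theorem seq (h : Runs p B st fun st' => Runs q B' st' Q) : Runs (p ;; q) (B + B') st Q := by
  obtain ⟨st', n, h1, h2, st'', m, h3, h4, h5⟩ := h
  exact ⟨st'', n + m, h1.seq h3, add_le_add h2 h4, h5⟩

theorem basic_seq (hp : p.isBasic = true) (h : Runs q B (p.effect st) Q) :
    Runs (p ;; q) (B + 1) st Q := by
  rw [add_comm]
  exact seq (basic (B := 0) hp h)

theorem ite {a : ℕ} (h1 : st.reg a ≠ 0 → Runs p B st Q) (h2 : st.reg a = 0 → Runs q B st Q) :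
    Runs (.ite a p q) (B + 1) st Q := by
  by_cases ha : st.reg a = 0
  · obtain ⟨st', n, h3, h4, h5⟩ := h2 ha
    exact ⟨st', n + 1, h3.ite_false ha, by omega, h5⟩
  · obtain ⟨st', n, h3, h4, h5⟩ := h1 ha
    exact ⟨st', n + 1, h3.ite_true ha, by omega, h5⟩

/-- The rule for counted loops: `I j` holds after `j` rounds. The invariant must be insensitive to
the counter, which is decremented before the body runs. The frame passed to `hstep` and `hQ` spares
the invariant from listing untouched memory. Each round costs 2 steps besides the body: the test and
the subtraction. -/
theorem rep {c k : ℕ} (I : ℕ → MachineState → Prop) (hk : st.reg c = k) (h3 : st.reg 3 = 1)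
    (hc : c ∉ p.regs) (hp : 3 ∉ p.regs) (hc3 : c ≠ 3) (h0 : I 0 st)
    (hset : ∀ j st' v, I j st' → I j (st'.setReg c v))
    (hstep : ∀ j < k, ∀ st', Frame (p.rep c) st st' → I j st' → Runs p B st' (I (j + 1)))
    (hQ : ∀ st', Frame (p.rep c) st st' → I k st' → Q st') :
    Runs (p.rep c) (k * (B + 2) + 1) st Q := by
  have hregs : ∀ r, r ∉ (p.rep c).regs → r ≠ c ∧ r ∉ p.regs := by
    intro r hr
    simpa [Prog.rep, Prog.regs] using hr
  have harrs : (p.rep c).arrs = p.arrs := by simp [Prog.rep, Prog.arrs]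
  have key : ∀ i j st', i + j = k → st'.reg c = i → Frame (p.rep c) st st' → I j st' →
      ∃ st'' n, Exec (p.rep c) st' st'' n ∧ n ≤ i * (B + 2) + 1 ∧ I k st'' := by
    intro i
    induction i with
    | zero =>
      intro j st' hj hi _ hI
      refine ⟨st', 1, Exec.while_false hi, by omega, ?_⟩
      rw [zero_add] at hj
      exact hj ▸ hI
    | succ i ih =>
      intro j st' hj hi hf hI
      have h3' : st'.reg 3 = 1 := by
        by_cases h : 3 ∈ (p.rep c).regs
        · exfalso
          simp only [Prog.rep, Prog.regs, List.mem_append, List.mem_singleton] at h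
          rcases h with h | h
          · exact hc3 h.symm
          · exact hp h
        · rw [hf.1 3 h, h3]
      set st₁ := st'.setReg c i with hst₁
      have hf₁ : Frame (p.rep c) st st₁ := by
        refine ⟨fun r hr => ?_, fun A hA => hf.2 A hA⟩
        rw [← hf.1 r hr]
        exact Function.update_of_ne (hregs r hr).1 _ _
      obtain ⟨st₂, n, hE, hn, hI₂⟩ := hstep j (by omega) st₁ hf₁ (hset j st' i hI)
      have hc₂ : st₂.reg c = i := by
        rw [hE.reg_eq c hc]
        simp [hst₁, MachineState.setReg]
      have hf₂ : Frame (p.rep c) st st₂ := by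
        refine ⟨fun r hr => ?_, fun A hA => ?_⟩
        · rw [hE.reg_eq r (hregs r hr).2, hf₁.1 r hr]
        · rw [hE.arr_eq A (harrs ▸ hA), hf₁.2 A hA]
      obtain ⟨st₃, m, hE₃, hm, hI₃⟩ := ih (j + 1) st₂ (by omega) hc₂ hf₂ hI₂
      refine ⟨st₃, (1 + n) + m + 1, Exec.while_true (by omega) (Exec.seq ?_ hE) hE₃, ?_, hI₃⟩
      · have := Exec.sub c c 3 st'
        rw [hi, h3'] at this
        exact this
      · rw [add_mul]
        omega
  obtain ⟨st', n, hE, hn, hI⟩ := key k 0 st (by simp) hk ⟨fun _ _ => rfl, fun _ _ => rfl⟩ h0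
  exact ⟨st', n, hE, hn, hQ st' ⟨hE.reg_eq, hE.arr_eq⟩ hI⟩

end Runs

/-! ## Elementary arithmetic in registers -/

/-- `reg d := c * reg a`, with register 20 as the counter. -/
def mulConst (d a c : ℕ) : Prog :=
  .const d 0 ;; .const 20 c ;; Prog.rep 20 (.add d d a)

theorem runs_mulConst {d a c : ℕ} {st : MachineState} (h3 : st.reg 3 = 1) (hd3 : d ≠ 3)
    (hd : d ≠ 20) (ha : a ≠ 20) (had : a ≠ d) :
    Runs (mulConst d a c) (3 * c + 3) st fun st' => st'.reg d = c * st.reg a := by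
  have : Runs (mulConst d a c) (c * (0 + 1 + 2) + 1 + 1 + 1) st
      fun st' => st'.reg d = c * st.reg a := by
    refine Runs.basic_seq rfl (Runs.basic_seq rfl ?_)
    refine Runs.rep (fun j st' => st'.reg d = j * st.reg a) ?_ ?_ ?_ ?_ (by norm_num) ?_ ?_ ?_ ?_
    · simp
    · simp [h3, hd3.symm]
    · simp [Prog.regs, hd.symm]
    · simp [Prog.regs, hd3.symm]
    · simp [hd]
    · intro j st' v h
      simpa [hd] using h
    · intro j hj st' hf hI
      refine Runs.basic rfl ?_
      have ha' : st'.reg a = st.reg a := by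
        rw [hf.1 a (by simp [Prog.rep, Prog.regs, ha, had])]
        simp [ha, had]
      simp [hI, ha']
      ring
    · intro st' _ h
      exact h
  exact this.mono (by omega) fun _ _ h => h

/-- `reg 26 := ⌈log₂ (reg 0)⌉`. -/
def clogProg : Prog :=
  .const 25 1 ;; .const 26 0 ;; .add 20 0 2 ;; Prog.rep 20 (.sub 21 0 25 ;;
    .ite 21 (.add 25 25 25 ;; .add 26 26 3) (.const 21 0))

theorem runs_clogProg {st : MachineState} {N : ℕ} (h0 : st.reg 0 = N) (h2 : st.reg 2 = 0)
    (h3 : st.reg 3 = 1) :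
    Runs clogProg (N * 6 + 4) st fun st' => st'.reg 26 = Nat.clog 2 N := by
  refine Runs.basic_seq rfl (Runs.basic_seq rfl (Runs.basic_seq rfl ?_))
  -- The power of two is doubled until it reaches `N` and then left alone, hence the minimum; `N`
  -- rounds suffice because ⌈log₂ N⌉ ≤ N.
  refine Runs.rep (B := 4) (fun j st' => st'.reg 25 = 2 ^ min j (Nat.clog 2 N) ∧
    st'.reg 26 = min j (Nat.clog 2 N)) ?_ ?_ (by decide) (by decide) (by norm_num) ?_ ?_ ?_ ?_
  · simp [h0, h2]
  · simp [h3]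
  · simp
  · intro j st' v h
    simpa using h
  · intro j hj st' hf hI
    have e0 : st'.reg 0 = N := by
      rw [hf.1 0 (by decide)]
      simp [h0]
    have e3 : st'.reg 3 = 1 := by
      rw [hf.1 3 (by decide)]
      simp [h3]
    have hlt : N - 2 ^ min j (Nat.clog 2 N) ≠ 0 ↔ j < Nat.clog 2 N := by
      rw [Nat.sub_ne_zero_iff_lt, ← not_le, ← not_le,
        ← Nat.clog_le_iff_le_pow (by norm_num : 1 < 2), le_min_iff]
      simp
    refine Runs.basic_seq rfl (Runs.ite (fun h => ?_) fun h => ?_)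
    · simp [e0, hI.1] at h
      rw [← ne_eq, hlt] at h
      refine Runs.basic_seq rfl (Runs.basic rfl ?_)
      simp [hI.1, hI.2, e3, min_eq_left h.le, min_eq_left (Nat.succ_le_of_lt h), pow_succ]
      ring
    · refine Runs.basic rfl ?_
      simp [e0, hI.1] at h
      have h' : ¬ j < Nat.clog 2 N := fun hj => by
        have := hlt.2 hj
        omega
      simp [hI.1, hI.2,
        min_eq_right (not_lt.1 h'), min_eq_right ((not_lt.1 h').trans (Nat.le_succ j))]
  · rintro st' - ⟨-, h⟩
    rw [h, min_eq_right]
    exact (Nat.clog_le_iff_le_pow (by norm_num)).2 Nat.lt_two_pow_self.le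

/-- `reg 34 := 2 ^ ⌈reg 26 / reg 32⌉`. -/
def rootProg : Prog :=
  .const 34 1 ;; .const 35 0 ;; .add 20 26 2 ;; Prog.rep 20 (.sub 21 26 35 ;;
    .ite 21 (.add 34 34 34 ;; .add 35 35 32) (.const 21 0))

/-- The division is done by repeated addition: register 35 climbs in steps of `h` while register 34
doubles, until register 35 reaches `n`. -/
theorem runs_rootProg {st : MachineState} {n h : ℕ} (h26 : st.reg 26 = n) (h32 : st.reg 32 = h)
    (hh : 0 < h) (h2 : st.reg 2 = 0) (h3 : st.reg 3 = 1) :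
    Runs rootProg (n * 6 + 4) st fun st' => st'.reg 34 = 2 ^ (n ⌈/⌉ h) := by
  refine Runs.basic_seq rfl (Runs.basic_seq rfl (Runs.basic_seq rfl ?_))
  refine Runs.rep (B := 4) (fun j st' => st'.reg 34 = 2 ^ min j (n ⌈/⌉ h) ∧
    st'.reg 35 = h * min j (n ⌈/⌉ h)) ?_ ?_ (by decide) (by decide) (by norm_num) ?_ ?_ ?_ ?_
  · simp [h26, h2]
  · simp [h3]
  · simp
  · intro j st' v h
    simpa using h
  · intro j hj st' hf hI
    have e26 : st'.reg 26 = n := by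
      rw [hf.1 26 (by decide)]
      simp [h26]
    have e32 : st'.reg 32 = h := by
      rw [hf.1 32 (by decide)]
      simp [h32]
    have hlt : n - h * min j (n ⌈/⌉ h) ≠ 0 ↔ j < n ⌈/⌉ h := by
      rw [Nat.sub_ne_zero_iff_lt, ← not_le, ← not_le, ← ceilDiv_le_iff_le_mul hh, le_min_iff]
      simp
    refine Runs.basic_seq rfl (Runs.ite (fun h => ?_) fun h => ?_)
    · simp [e26, hI.2] at h
      rw [← ne_eq, hlt] at h
      refine Runs.basic_seq rfl (Runs.basic rfl ?_)
      simp [hI.1, hI.2, e32, min_eq_left h.le, min_eq_left (Nat.succ_le_of_lt h), pow_succ, mul_add]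
      ring
    · refine Runs.basic rfl ?_
      simp [e26, hI.2] at h
      have h' : ¬ j < n ⌈/⌉ _ := fun hj => by
        have := hlt.2 hj
        omega
      simp [hI.1, hI.2,
        min_eq_right (not_lt.1 h'), min_eq_right ((not_lt.1 h').trans (Nat.le_succ j))]
  · rintro st' - ⟨h', -⟩
    rw [h', min_eq_right]
    rw [ceilDiv_le_iff_le_mul hh]
    exact Nat.le_mul_of_pos_left n hh

/-! ## The program that checks the block counts -/

section Recursion

variable {N : ℕ}

theorem blockCount_zero (sh : ℤ → ZMod N) (t : ℤ) (b : ℕ) (c : ZMod N) :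
    blockCount sh t b 0 c = if c = 0 then 1 else 0 := by
  split_ifs with h <;> simp [blockCount, blockSum, h, eq_comm]

/-- Splitting off the choice in the last block writes the counts as a convolution with one block of
shifts. This recursion computes b^h choices in time proportional to N b h. -/
theorem blockCount_succ (sh : ℤ → ZMod N) (t : ℤ) (b h : ℕ) (c : ZMod N) :
    blockCount sh t b (h + 1) c =
      ∑ i ∈ Finset.range b, blockCount sh t b h (c - sh (t + (h * b : ℕ) + (i : ℕ))) := by
  have key : ∀ (k : ℕ) (d : ZMod N), blockCount sh t b k d =
      ∑ x : Fin k → Fin b, if blockSum sh t x = d then 1 else 0 := by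
    intro k d
    rw [blockCount, Finset.sum_boole, Nat.cast_id]
  rw [key, ← (Fin.snocEquiv fun _ => Fin b).sum_comp, Fintype.sum_prod_type, Finset.sum_range]
  refine Finset.sum_congr rfl fun i _ => ?_
  rw [key]
  refine Finset.sum_congr rfl fun x _ => ?_
  have : blockSum sh t (Fin.snocEquiv (fun _ => Fin b) (i, x)) =
      blockSum sh t x + sh (t + (h * b : ℕ) + (i : ℕ)) := by
    rw [blockSum, Fin.sum_univ_castSucc, blockSum]
    simp only [Fin.snocEquiv, Equiv.coe_fn_mk, Fin.snoc_castSucc, Fin.snoc_last, Fin.val_castSucc,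
      Fin.val_last, Nat.cast_add, add_assoc]
  rw [this]
  exact if_congr eq_sub_iff_add_eq.symm rfl rfl

end Recursion

namespace ShiftSchedule

variable {N : ℕ}

/-- The position of the shift in force at time `t` in the list of shifts. -/
def index (s : ShiftSchedule N) (t : ℤ) : ℕ := (t % (s.period : ℤ)).toNat

theorem index_lt (s : ShiftSchedule N) (t : ℤ) : s.index t < s.period := by
  have h : (0 : ℤ) < s.period := by exact_mod_cast s.period_pos
  have h1 := Int.emod_nonneg t h.ne'
  have h2 := Int.emod_lt_of_pos t h
  rw [index]
  omega

theorem index_natCast (s : ShiftSchedule N) {t : ℕ} (ht : t < s.period) : s.index t = t := by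
  rw [index, Int.emod_eq_of_lt (by omega) (by exact_mod_cast ht), Int.toNat_natCast]

/-- Cyclic increment in the form the machine can execute: the truncated difference vanishes exactly
when the position has to wrap to zero. -/
theorem index_succ (s : ShiftSchedule N) (t : ℤ) :
    s.index (t + 1) = if s.period - (s.index t + 1) ≠ 0 then s.index t + 1 else 0 := by
  have h : (0 : ℤ) < s.period := by exact_mod_cast s.period_pos
  have h1 := Int.emod_nonneg t h.ne'
  have h2 := s.index_lt t
  have h3 : (t + 1) % (s.period : ℤ) = ((s.index t : ℤ) + 1) % s.period := by
    rw [index, Int.toNat_of_nonneg h1, Int.emod_add_emod]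
  split_ifs with h4
  · rw [index, h3, Int.emod_eq_of_lt (by omega) (by omega)]
    omega
  · have : (s.index t : ℤ) + 1 = s.period := by omega
    rw [index, h3, this, Int.emod_self]
    rfl

end ShiftSchedule

theorem ZMod.val_add_one_eq {N : ℕ} [NeZero N] (a : ZMod N) :
    (a + 1).val = if N - (a.val + 1) ≠ 0 then a.val + 1 else 0 := by
  have h1 : a + 1 = ((a.val + 1 : ℕ) : ZMod N) := by simp
  have h2 := a.val_lt
  rw [h1, ZMod.val_natCast]
  split_ifs with h
  · exact Nat.mod_eq_of_lt (by omega)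
  · rw [show a.val + 1 = N by omega, Nat.mod_self]

/-! ### Memory invariants for the counting programs -/

section Memory

variable {N : ℕ}

/-- The memory holds the schedule `s` and the constants 0 and 1. -/
structure Loaded (s : ShiftSchedule N) (st : MachineState) : Prop where
  size : st.reg 0 = N
  period : st.reg 1 = s.period
  zero : st.reg 2 = 0
  one : st.reg 3 = 1
  shifts : ∀ i : Fin s.period, st.arr 0 i = (s.shift i).val

/-- The program does not change the input or the constants. -/
def Prog.preservesInput (p : Prog) : Bool := p.regs.all (4 ≤ ·) && p.arrs.all (1 ≤ ·)

theorem Loaded.frame {s : ShiftSchedule N} {st st' : MachineState} (h : Loaded s st) {p : Prog}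
    (hf : Frame p st st') (hp : p.preservesInput = true) : Loaded s st' := by
  simp only [Prog.preservesInput, Bool.and_eq_true, List.all_eq_true, decide_eq_true_eq] at hp
  have hr : ∀ r < 4, st'.reg r = st.reg r := fun r hr => hf.1 r fun h => by
    have := hp.1 r h
    omega
  have ha : st'.arr 0 = st.arr 0 := hf.2 0 fun h => by
    have := hp.2 0 h
    omega
  exact ⟨by rw [hr 0 (by norm_num), h.size], by rw [hr 1 (by norm_num), h.period],
    by rw [hr 2 (by norm_num), h.zero], by rw [hr 3 (by norm_num), h.one],
    fun i => by rw [ha, h.shifts]⟩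

theorem frame_effect (p : Prog) (st : MachineState) : Frame p st (p.effect st) := by
  cases p <;> refine ⟨fun r hr => ?_, fun A hA => ?_⟩ <;>
    simp_all [Prog.regs, Prog.arrs]

theorem Loaded.effect {s : ShiftSchedule N} {st : MachineState} (h : Loaded s st) {p : Prog}
    (hp : p.preservesInput = true) : Loaded s (p.effect st) :=
  h.frame (frame_effect p st) hp

theorem Loaded.shiftAt {s : ShiftSchedule N} {st : MachineState} (h : Loaded s st) (t : ℤ) :
    st.arr 0 (s.index t) = (s.shiftAt t).val :=
  h.shifts ⟨_, s.index_lt t⟩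

/-- Array `A` holds the function `g` on `ℤ/N`. -/
def Holds (st : MachineState) (A : ℕ) (g : ZMod N → ℕ) : Prop := ∀ c : ZMod N, st.arr A c.val = g c

end Memory

/-- Add array 1, shifted by register 18, to array 2. -/
def shiftAddProg : Prog :=
  .const 19 0 ;; .add 20 0 2 ;; Prog.rep 20 (.load 21 1 19 ;; .load 22 2 18 ;; .add 22 22 21 ;;
    .store 2 18 22 ;; .add 19 19 3 ;; .add 18 18 3 ;; .sub 21 0 18 ;;
    .ite 21 (.const 21 0) (.const 18 0))

/-- Move array 2 to array 1 and clear array 2. -/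
def moveProg : Prog :=
  .const 19 0 ;; .add 20 0 2 ;; Prog.rep 20 (.load 21 2 19 ;; .store 1 19 21 ;; .store 2 19 2 ;;
    .add 19 19 3)

/-- Replace array 1 by its convolution with the next block of shifts; register 10 is the position in
the schedule, register 5 the block length, register 14 the number of hop sequences so far. -/
def hopProg : Prog :=
  .const 16 0 ;; .add 17 5 2 ;; Prog.rep 17 (.load 18 0 10 ;; .add 10 10 3 ;; .sub 21 1 10 ;;
    .ite 21 (.const 21 0) (.const 10 0) ;; .add 16 16 14 ;; shiftAddProg) ;;
  .add 14 16 2 ;; moveProg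

/-- Add the deficit to register 11 and the total mass to register 12, and clear array 1. -/
def evalProg : Prog :=
  .const 19 0 ;; .add 20 0 2 ;; Prog.rep 20 (.load 21 1 19 ;; .sub 22 14 21 ;; .add 11 11 22 ;;
    .add 12 12 21 ;; .store 1 19 2 ;; .add 19 19 3)

/-- Evaluate one window of `reg 6` blocks. -/
def windowProg : Prog :=
  .store 1 2 0 ;; .const 14 1 ;; .add 15 6 2 ;; Prog.rep 15 hopProg ;; evalProg

/-- Evaluate `reg 7` consecutive windows that start at time `reg 4`, and set register 9 if
`reg 8` times the sum of the deficits exceeds the total mass. -/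
def checkProg : Prog :=
  .add 10 4 2 ;; .const 11 0 ;; .const 12 0 ;; .add 13 7 2 ;; Prog.rep 13 windowProg ;;
  .const 23 0 ;; .add 13 8 2 ;; Prog.rep 13 (.add 23 23 11) ;; .sub 21 23 12 ;;
  .ite 21 (.const 9 1) (.const 21 0)

/-! ### Correctness and running time of the counting programs -/

section Specifications

variable {N : ℕ} [NeZero N] {s : ShiftSchedule N} {st : MachineState}

theorem runs_shiftAddProg (hL : Loaded s st) {g g' : ZMod N → ℕ} {y : ZMod N}
    (h1 : Holds st 1 g) (h2 : Holds st 2 g') (hy : st.reg 18 = y.val) :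
    Runs shiftAddProg (N * 11 + 3) st fun st' => Holds st' 2 fun c => g' c + g (c - y) := by
  refine Runs.basic_seq rfl (Runs.basic_seq rfl ?_)
  -- After `j` rounds the cells y, y + 1, …, y + j - 1 (cyclically) have been updated, that is, the
  -- residues `c` for which `c - y` has a representative below `j`.
  refine Runs.rep (B := 9) (fun j st' => st'.reg 19 = j ∧ st'.reg 18 = ((j : ZMod N) + y).val ∧
    Holds st' 2 fun c => g' c + if (c - y).val < j then g (c - y) else 0)
    ?_ ?_ (by decide) (by decide) (by norm_num) ?_ ?_ ?_ ?_
  · simp [hL.size, hL.zero]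
  · simp [hL.one]
  · refine ⟨by simp, by simp [hy], fun c => by simpa using h2 c⟩
  · intro j st' v h
    simpa [Holds] using h
  · rintro j hj st' hf ⟨h19, h18, h2'⟩
    have hL' : Loaded s st' := ((hL.effect rfl).effect rfl).frame hf rfl
    have h1' : Holds st' 1 g := fun c => by
      rw [hf.2 1 (by decide)]
      exact h1 c
    have hjv : ((j : ZMod N)).val = j := ZMod.val_cast_of_lt hj
    have hj1 : st'.arr 1 j = g j := by
      rw [← h1' (j : ZMod N), hjv]
    have hj2 : st'.arr 2 ((j : ZMod N) + y).val = g' (j + y) := by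
      rw [h2' ((j : ZMod N) + y)]
      simp [hjv]
    have hupd : ∀ c : ZMod N, (if c.val = ((j : ZMod N) + y).val then g' (j + y) + g j else
        st'.arr 2 c.val) = g' c + if (c - y).val < j + 1 then g (c - y) else 0 := by
      intro c
      rw [h2' c]
      by_cases hc : c = j + y
      · subst hc
        simp [hjv]
      · have hc1 : c.val ≠ ((j : ZMod N) + y).val := fun h => hc (ZMod.val_injective N h)
        have hc2 : (c - y).val ≠ j := fun h => by
          apply hc
          rw [← sub_eq_iff_eq_add]
          apply ZMod.val_injective N
          rw [h, hjv]
        rw [if_neg hc1]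
        beta_reduce
        by_cases h3 : (c - y).val < j
        · rw [if_pos h3, if_pos (by omega)]
        · rw [if_neg h3, if_neg (by omega)]
    have hsucc := ZMod.val_add_one_eq ((j : ZMod N) + y)
    refine Runs.basic_seq rfl (Runs.basic_seq rfl (Runs.basic_seq rfl (Runs.basic_seq rfl
      (Runs.basic_seq rfl (Runs.basic_seq rfl (Runs.basic_seq rfl
      (Runs.ite (fun h => Runs.basic rfl ?_) fun h => Runs.basic rfl ?_)))))))
    · simp [hL'.size, hL'.one, h18] at h
      rw [if_pos h] at hsucc
      refine ⟨by simp [h19, hL'.one], ?_, fun c => ?_⟩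
      · rw [Nat.cast_add, Nat.cast_one, add_right_comm, hsucc]
        simp [h18, hL'.one]
      · refine Eq.trans ?_ (hupd c)
        simp [h18, h19, hj1, hj2, Function.update_apply]
    · simp [hL'.size, hL'.one, h18] at h
      rw [if_neg (not_not.2 h)] at hsucc
      refine ⟨by simp [h19, hL'.one], ?_, fun c => ?_⟩
      · rw [Nat.cast_add, Nat.cast_one, add_right_comm, hsucc]
        simp
      · refine Eq.trans ?_ (hupd c)
        simp [h18, h19, hj1, hj2, Function.update_apply]
  · rintro st' - ⟨-, -, h⟩ c
    rw [h c]
    beta_reduce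
    rw [if_pos (ZMod.val_lt _)]

theorem runs_moveProg (hL : Loaded s st) {g : ZMod N → ℕ} (h2 : Holds st 2 g) :
    Runs moveProg (N * 6 + 3) st fun st' => Holds st' 1 g ∧ Holds st' 2 (fun _ : ZMod N => 0) := by
  refine Runs.basic_seq rfl (Runs.basic_seq rfl ?_)
  refine Runs.rep (B := 4) (fun j st' => st'.reg 19 = j ∧
    (∀ c : ZMod N, c.val < j → st'.arr 1 c.val = g c) ∧
    ∀ c : ZMod N, st'.arr 2 c.val = if c.val < j then 0 else g c)
    ?_ ?_ (by decide) (by decide) (by norm_num) ?_ ?_ ?_ ?_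
  · simp [hL.size, hL.zero]
  · simp [hL.one]
  · refine ⟨by simp, by simp, fun c => by simpa using h2 c⟩
  · intro j st' v h
    simpa using h
  · rintro j hj st' hf ⟨h19, h1', h2'⟩
    have hL' : Loaded s st' := ((hL.effect rfl).effect rfl).frame hf rfl
    have hjv : ((j : ZMod N)).val = j := ZMod.val_cast_of_lt hj
    have hj2 : st'.arr 2 j = g j := by
      have := h2' (j : ZMod N)
      rwa [hjv, if_neg (lt_irrefl _)] at this
    refine Runs.basic_seq rfl (Runs.basic_seq rfl (Runs.basic_seq rfl (Runs.basic rfl ?_)))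
    refine ⟨by simp [h19, hL'.one], fun c hc => ?_, fun c => ?_⟩
    · simp only [Prog.effect]
      simp [h19, hj2, Function.update_apply]
      split_ifs with h
      · rw [← h, ZMod.natCast_zmod_val]
      · exact h1' c (by omega)
    · simp [h19, Function.update_apply, hL'.zero]
      rw [h2' c]
      split_ifs <;> first | rfl | omega
  · rintro st' - ⟨-, h1, h2⟩
    exact ⟨fun c => h1 c c.val_lt, fun c => by rw [h2, if_pos c.val_lt]⟩

theorem runs_hopProg (hL : Loaded s st) {g : ZMod N → ℕ} {τ : ℤ} {b w : ℕ}
    (h5 : st.reg 5 = b) (h10 : st.reg 10 = s.index τ) (h14 : st.reg 14 = w)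
    (h1 : Holds st 1 g) (h2 : Holds st 2 (fun _ : ZMod N => 0)) :
    Runs hopProg (b * (N * 11 + 11) + N * 6 + 8) st fun st' =>
      st'.reg 10 = s.index (τ + b) ∧ st'.reg 14 = b * w ∧
      Holds st' 1 (fun c => ∑ i ∈ Finset.range b, g (c - s.shiftAt (τ + (i : ℕ)))) ∧
      Holds st' 2 (fun _ : ZMod N => 0) := by
  refine Runs.basic_seq rfl (Runs.basic_seq rfl ?_)
  refine Runs.mono (Runs.seq (B := b * (N * 11 + 11) + 1) (B' := N * 6 + 3 + 1) ?_)
    (by omega) fun _ _ h => h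
  refine Runs.rep (B := N * 11 + 9) (fun j st' => st'.reg 10 = s.index (τ + (j : ℕ)) ∧ st'.reg 16 = j * w ∧
    Holds st' 2 fun c => ∑ i ∈ Finset.range j, g (c - s.shiftAt (τ + (i : ℕ))))
    ?_ ?_ (by decide) (by decide) (by norm_num) ?_ ?_ ?_ ?_
  · simp [h5, hL.zero]
  · simp [hL.one]
  · exact ⟨by simp [h10], by simp, fun c => by simpa using h2 c⟩
  · intro j st' v h
    simpa [Holds] using h
  · rintro j hj st' hf ⟨h10', h16, h2'⟩
    have hL' : Loaded s st' := ((hL.effect rfl).effect rfl).frame hf rfl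
    have h1' : Holds st' 1 g := fun c => by
      rw [hf.2 1 (by decide)]
      exact h1 c
    have h14' : st'.reg 14 = w := by
      rw [hf.1 14 (by decide)]
      simpa using h14
    have hsucc := s.index_succ (τ + (j : ℕ))
    refine Runs.basic_seq rfl (Runs.basic_seq rfl (Runs.basic_seq rfl ?_))
    refine Runs.mono (Runs.seq (B := 2) (B' := N * 11 + 3 + 1)
      (Q := fun st'' => st''.reg 10 = s.index (τ + ((j + 1 : ℕ) : ℤ)) ∧
        st''.reg 16 = (j + 1 : ℕ) * w ∧ Holds st'' 2 fun c => ∑ i ∈ Finset.range (j + 1),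
          g (c - s.shiftAt (τ + (i : ℕ)))) ?_) (by omega) fun _ _ h => h
    -- The rest of the round is the same whether or not the position in the schedule wrapped around.
    have hrest : ∀ st₁ : MachineState, Loaded s st₁ → st₁.reg 18 = (s.shiftAt (τ + (j : ℕ))).val →
        st₁.reg 10 = s.index (τ + ((j + 1 : ℕ) : ℤ)) → st₁.reg 16 = j * w → st₁.reg 14 = w →
        st₁.arr = st'.arr → Runs (.add 16 16 14 ;; shiftAddProg) (N * 11 + 3 + 1) st₁ fun st'' =>
          st''.reg 10 = s.index (τ + ((j + 1 : ℕ) : ℤ)) ∧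
          st''.reg 16 = (j + 1 : ℕ) * w ∧ Holds st'' 2 fun c => ∑ i ∈ Finset.range (j + 1),
            g (c - s.shiftAt (τ + (i : ℕ))) := by
      intro st₁ hL₁ e18 e10 e16 e14 earr
      refine Runs.basic_seq rfl ?_
      have hrun := runs_shiftAddProg (st := (Prog.add 16 16 14).effect st₁)
        (y := s.shiftAt (τ + (j : ℕ))) (hL₁.effect rfl)
        (g := g) (g' := fun c => ∑ i ∈ Finset.range j, g (c - s.shiftAt (τ + (i : ℕ))))
        (fun c => by simpa [earr] using h1' c) (fun c => by simpa [earr] using h2' c)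
        (by simpa using e18)
      refine hrun.mono le_rfl fun st₂ hf₂ h => ⟨?_, ?_, ?_⟩
      · rw [hf₂.1 10 (by decide)]
        simpa using e10
      · rw [hf₂.1 16 (by decide)]
        simp [e16, e14]
        ring
      · intro c
        rw [h c]
        exact (Finset.sum_range_succ _ _).symm
    have hload : st'.arr 0 (st'.reg 10) = (s.shiftAt (τ + (j : ℕ))).val := by
      rw [h10', hL'.shiftAt]
    have hcast : τ + ((j + 1 : ℕ) : ℤ) = τ + (j : ℕ) + 1 := by push_cast; ring
    have hL₂ := ((hL'.effect (p := .load 18 0 10) rfl).effect (p := .add 10 10 3) rfl).effect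
      (p := .sub 21 1 10) rfl
    refine Runs.ite (fun h => Runs.basic rfl ?_) fun h => Runs.basic rfl ?_
    · simp [hL'.period, hL'.one, h10'] at h
      rw [if_pos h] at hsucc
      refine hrest _ (hL₂.effect rfl) ?_ ?_ ?_ ?_ rfl
      · simpa using hload
      · rw [hcast, hsucc]
        simp [h10', hL'.one]
      · simpa using h16
      · simpa using h14'
    · simp [hL'.period, hL'.one, h10'] at h
      rw [if_neg (not_not.2 h)] at hsucc
      refine hrest _ (hL₂.effect rfl) ?_ ?_ ?_ ?_ rfl
      · simpa using hload
      · rw [hcast, hsucc]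
        simp
      · simpa using h16
      · simpa using h14'
  · rintro st' hf ⟨h10', h16, h2'⟩
    have hL' : Loaded s st' := ((hL.effect rfl).effect rfl).frame hf rfl
    refine Runs.basic_seq rfl ?_
    have hrun := runs_moveProg (st := (Prog.add 14 16 2).effect st') (hL'.effect rfl)
      (g := fun c => ∑ i ∈ Finset.range b, g (c - s.shiftAt (τ + (i : ℕ)))) (fun c => h2' c)
    refine hrun.mono le_rfl fun st₂ hf₂ h => ⟨?_, ?_, h.1, h.2⟩
    · rw [hf₂.1 10 (by decide)]
      simpa using h10'
    · rw [hf₂.1 14 (by decide)]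
      simp [h16, hL'.zero]

theorem ZMod.sum_eq_sum_range {N : ℕ} [NeZero N] {M : Type*} [AddCommMonoid M] (f : ZMod N → M) :
    ∑ c, f c = ∑ j ∈ Finset.range N, f j := by
  refine Finset.sum_bij' (fun c _ => c.val) (fun j _ => (j : ZMod N)) ?_ ?_ ?_ ?_ ?_
  · intro c _
    simpa using c.val_lt
  · simp
  · simp
  · intro j hj
    exact ZMod.val_cast_of_lt (Finset.mem_range.1 hj)
  · simp

theorem runs_evalProg (hL : Loaded s st) {g : ZMod N → ℕ} (h1 : Holds st 1 g) :
    Runs evalProg (N * 8 + 3) st fun st' =>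
      st'.reg 11 = st.reg 11 + ∑ c, (st.reg 14 - g c) ∧ st'.reg 12 = st.reg 12 + ∑ c, g c ∧
      Holds st' 1 (fun _ : ZMod N => 0) := by
  refine Runs.basic_seq rfl (Runs.basic_seq rfl ?_)
  refine Runs.rep (B := 6) (fun j st' => st'.reg 19 = j ∧
    st'.reg 11 = st.reg 11 + ∑ i ∈ Finset.range j, (st.reg 14 - g (i : ZMod N)) ∧
    st'.reg 12 = st.reg 12 + ∑ i ∈ Finset.range j, g (i : ZMod N) ∧
    ∀ c : ZMod N, st'.arr 1 c.val = if c.val < j then 0 else g c)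
    ?_ ?_ (by decide) (by decide) (by norm_num) ?_ ?_ ?_ ?_
  · simp [hL.size, hL.zero]
  · simp [hL.one]
  · refine ⟨by simp, by simp, by simp, fun c => by simpa using h1 c⟩
  · intro j st' v h
    simpa using h
  · rintro j hj st' hf ⟨h19, h11, h12, h1'⟩
    have hL' : Loaded s st' := ((hL.effect rfl).effect rfl).frame hf rfl
    have hjv : ((j : ZMod N)).val = j := ZMod.val_cast_of_lt hj
    have hj1 : st'.arr 1 j = g j := by
      have := h1' (j : ZMod N)
      rwa [hjv, if_neg (lt_irrefl _)] at this
    have h14 : st'.reg 14 = st.reg 14 := by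
      rw [hf.1 14 (by decide)]
      simp
    refine Runs.basic_seq rfl (Runs.basic_seq rfl (Runs.basic_seq rfl (Runs.basic_seq rfl
      (Runs.basic_seq rfl (Runs.basic rfl ?_)))))
    refine ⟨by simp [h19, hL'.one], ?_, ?_, fun c => ?_⟩
    · simp [h19, hj1, h14, h11, Finset.sum_range_succ, add_assoc]
    · simp [h19, hj1, h12, Finset.sum_range_succ, add_assoc]
    · simp [h19, Function.update_apply, hL'.zero]
      rw [h1' c]
      split_ifs <;> first | rfl | omega
  · rintro st' - ⟨-, h11, h12, h1⟩
    refine ⟨?_, ?_, fun c => by rw [h1, if_pos c.val_lt]⟩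
    · rw [h11, ZMod.sum_eq_sum_range]
    · rw [h12, ZMod.sum_eq_sum_range]

/-- A bound for the running time of `windowProg`. -/
def windowTime (N b h : ℕ) : ℕ := h * (b * (N * 11 + 11) + N * 6 + 10) + N * 8 + 7

/-- The convolution starts from the value `N`, not 1, at residue 0, so array 1 always holds `N`
times the counts. Deficits and the total mass N b^h then arise by additions and truncated
subtractions alone. Clearing array 1 on the way makes the program reusable. -/
theorem runs_windowProg (hL : Loaded s st) {τ : ℤ} {b h : ℕ}
    (h5 : st.reg 5 = b) (h6 : st.reg 6 = h) (h10 : st.reg 10 = s.index τ)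
    (h1 : Holds st 1 (fun _ : ZMod N => 0)) (h2 : Holds st 2 (fun _ : ZMod N => 0)) :
    Runs windowProg (windowTime N b h) st fun st' =>
      st'.reg 10 = s.index (τ + (h * b : ℕ)) ∧
      st'.reg 11 = st.reg 11 + blockDeficit s.shiftAt τ b h ∧
      st'.reg 12 = st.reg 12 + N * b ^ h ∧
      Holds st' 1 (fun _ : ZMod N => 0) ∧ Holds st' 2 (fun _ : ZMod N => 0) := by
  refine Runs.basic_seq rfl (Runs.basic_seq rfl (Runs.basic_seq rfl ?_))
  refine Runs.mono (Runs.seq (B := h * (b * (N * 11 + 11) + N * 6 + 10) + 1)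
    (B' := N * 8 + 3) ?_) (by omega) fun _ _ h => h
  refine Runs.rep (B := b * (N * 11 + 11) + N * 6 + 8)
    (fun j st' => st'.reg 10 = s.index (τ + (j * b : ℕ)) ∧ st'.reg 14 = b ^ j ∧
    Holds st' 1 (fun c => N * blockCount s.shiftAt τ b j c) ∧
    Holds st' 2 (fun _ : ZMod N => 0))
    ?_ ?_ (by decide) (by decide) (by norm_num) ?_ ?_ ?_ ?_
  · simp [h6, hL.zero]
  · simp [hL.one]
  · refine ⟨by simp [h10], by simp, fun c => ?_, fun c => by simpa using h2 c⟩
    beta_reduce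
    rw [blockCount_zero]
    simp [hL.zero, hL.size, Function.update_apply, ZMod.val_eq_zero, h1 c]
  · intro j st' v h
    simpa [Holds] using h
  · rintro j hj st' hf ⟨h10', h14, h1', h2'⟩
    have hL' : Loaded s st' := (((hL.effect rfl).effect rfl).effect rfl).frame hf rfl
    have h5' : st'.reg 5 = b := by
      rw [hf.1 5 (by decide)]
      simpa using h5
    refine (runs_hopProg hL' h5' h10' h14 h1' h2').mono le_rfl ?_
    rintro st'' - ⟨e10, e14, e1, e2⟩
    refine ⟨?_, by rw [e14, pow_succ'], fun c => ?_, e2⟩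
    · rw [e10]
      congr 1
      push_cast
      ring
    · rw [e1]
      beta_reduce
      rw [blockCount_succ, Finset.mul_sum]
  · rintro st' hf ⟨h10', h14, h1', h2'⟩
    have hL' : Loaded s st' := (((hL.effect rfl).effect rfl).effect rfl).frame hf rfl
    have e11 : st'.reg 11 = st.reg 11 := by
      rw [hf.1 11 (by decide)]
      simp
    have e12 : st'.reg 12 = st.reg 12 := by
      rw [hf.1 12 (by decide)]
      simp
    refine (runs_evalProg hL' h1').mono le_rfl ?_
    rintro st'' hf'' ⟨f11, f12, f1⟩
    refine ⟨?_, ?_, ?_, f1, fun c => ?_⟩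
    · rw [hf''.1 10 (by decide), h10']
    · rw [f11, e11, h14]
      rfl
    · rw [f12, e12, ← Finset.mul_sum, sum_blockCount]
    · rw [hf''.2 2 (by decide)]
      exact h2' c

/-- The condition that `checkProg` tests. -/
def Passes (s : ShiftSchedule N) (t b h M κ : ℕ) : Prop :=
  κ * ∑ i ∈ Finset.range M, blockDeficit s.shiftAt (t + (i * (h * b) : ℕ)) b h ≤ M * (N * b ^ h)

/-- A bound for the running time of `checkProg`. -/
def checkTime (N b h M κ : ℕ) : ℕ := M * (windowTime N b h + 2) + κ * 3 + 12

theorem runs_checkProg (hL : Loaded s st) {t b h M κ : ℕ} (ht : t < s.period)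
    (h4 : st.reg 4 = t) (h5 : st.reg 5 = b) (h6 : st.reg 6 = h) (h7 : st.reg 7 = M)
    (h8 : st.reg 8 = κ)
    (h1 : Holds st 1 (fun _ : ZMod N => 0)) (h2 : Holds st 2 (fun _ : ZMod N => 0)) :
    Runs checkProg (checkTime N b h M κ) st fun st' =>
      (st'.reg 9 = 0 ↔ st.reg 9 = 0 ∧ Passes s t b h M κ) ∧
      Holds st' 1 (fun _ : ZMod N => 0) ∧ Holds st' 2 (fun _ : ZMod N => 0) := by
  refine Runs.basic_seq rfl (Runs.basic_seq rfl (Runs.basic_seq rfl (Runs.basic_seq rfl ?_)))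
  refine Runs.mono (Runs.seq (B := M * (windowTime N b h + 2) + 1)
    (B' := κ * 3 + 1 + 3 + 2) ?_) (by omega) fun _ _ h => h
  refine Runs.rep (fun j st' => st'.reg 10 = s.index (t + (j * (h * b) : ℕ)) ∧
    st'.reg 11 = ∑ i ∈ Finset.range j, blockDeficit s.shiftAt (t + (i * (h * b) : ℕ)) b h ∧
    st'.reg 12 = j * (N * b ^ h) ∧
    Holds st' 1 (fun _ : ZMod N => 0) ∧ Holds st' 2 (fun _ : ZMod N => 0))
    ?_ ?_ (by decide) (by decide) (by norm_num) ?_ ?_ ?_ ?_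
  · simp [h7, hL.zero]
  · simp [hL.one]
  · refine ⟨?_, by simp, by simp, fun c => by simpa using h1 c, fun c => by simpa using h2 c⟩
    simp [h4, hL.zero, s.index_natCast ht]
  · intro j st' v h
    simpa [Holds] using h
  · rintro j hj st' hf ⟨h10', h11, h12, h1', h2'⟩
    have hL' : Loaded s st' :=
      ((((hL.effect rfl).effect rfl).effect rfl).effect rfl).frame hf rfl
    have h5' : st'.reg 5 = b := by
      rw [hf.1 5 (by decide)]
      simpa using h5
    have h6' : st'.reg 6 = h := by
      rw [hf.1 6 (by decide)]
      simpa using h6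
    refine (runs_windowProg hL' h5' h6' h10' h1' h2').mono le_rfl ?_
    rintro st'' - ⟨e10, e11, e12, e1, e2⟩
    refine ⟨?_, ?_, ?_, e1, e2⟩
    · rw [e10]
      congr 1
      push_cast
      ring
    · rw [e11, h11, Finset.sum_range_succ]
    · rw [e12, h12]
      ring
  · rintro st' hf ⟨h10', h11, h12, h1', h2'⟩
    have hL' : Loaded s st' :=
      ((((hL.effect rfl).effect rfl).effect rfl).effect rfl).frame hf rfl
    have h8' : st'.reg 8 = κ := by
      rw [hf.1 8 (by decide)]
      simpa using h8
    have h9' : st'.reg 9 = st.reg 9 := by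
      rw [hf.1 9 (by decide)]
      simp
    refine Runs.basic_seq rfl (Runs.basic_seq rfl ?_)
    refine Runs.mono (Runs.seq (B := κ * (0 + 1 + 2) + 1) (B' := 3) ?_) (by omega) fun _ _ h => h
    refine Runs.rep (fun j st'' => st''.reg 23 = j * st'.reg 11)
      ?_ ?_ (by decide) (by decide) (by norm_num) ?_ ?_ ?_ ?_
    · simp [h8', hL'.zero]
    · simp [hL'.one]
    · simp
    · intro j st' v h
      simpa using h
    · intro j hj st'' hf' hI
      refine Runs.basic rfl ?_
      have : st''.reg 11 = st'.reg 11 := by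
        rw [hf'.1 11 (by decide)]
        simp
      simp [hI, this]
      ring
    · intro st'' hf' hI
      have e12 : st''.reg 12 = st'.reg 12 := by
        rw [hf'.1 12 (by decide)]
        simp
      have e9 : st''.reg 9 = st.reg 9 := by
        rw [hf'.1 9 (by decide)]
        simpa using h9'
      have earr : st''.arr = st'.arr := by
        funext A
        exact hf'.2 A (by simp [Prog.rep, Prog.arrs])
      have hP : Passes s t b h M κ ↔ st''.reg 23 - st''.reg 12 = 0 := by
        rw [hI, e12, h11, h12, Nat.sub_eq_zero_iff_le]
        rfl
      refine Runs.basic_seq rfl (Runs.ite (fun h => Runs.basic rfl ?_) fun h => Runs.basic rfl ?_)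
      · simp at h
        rw [← hP.not] at h
        refine ⟨?_, fun c => by simpa [earr] using h1' c, fun c => by simpa [earr] using h2' c⟩
        simp [h]
      · simp at h
        rw [← hP] at h
        refine ⟨?_, fun c => by simpa [earr] using h1' c, fun c => by simpa [earr] using h2' c⟩
        simp [h, e9]

end Specifications

/-! ## The certifier -/

/-- The checks for the hop count `reg 32 + 1`. -/
def hopCountProg (h₀ C : ℕ) : Prog :=
  .add 32 32 3 ;; rootProg ;; mulConst 5 34 C ;; .add 6 32 2 ;; .add 7 29 2 ;; .const 21 h₀ ;;
  .sub 21 32 21 ;; .ite 21 (.const 21 0) (.const 7 1) ;; .add 8 30 2 ;; checkProg ;;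
  .add 5 34 2 ;; mulConst 6 32 10 ;; .const 7 1 ;; .add 8 27 2 ;; checkProg

/-- The checks for the starting time `reg 4`. -/
def timeProg (h₀ C : ℕ) : Prog :=
  .const 5 2 ;; .add 6 28 2 ;; .const 7 1 ;; .add 8 27 2 ;; checkProg ;; .const 32 0 ;;
  .add 33 26 2 ;; Prog.rep 33 (hopCountProg h₀ C) ;; .add 4 4 3

/-- The certifier for the parameters `h₀`, `p`, `C` and `K`. -/
def certifier (h₀ p C K : ℕ) : Prog :=
  .const 2 0 ;; .const 3 1 ;; clogProg ;; .add 27 0 0 ;; mulConst 28 26 10 ;; mulConst 29 26 K ;;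
  .const 30 p ;; .const 4 0 ;; .add 31 1 2 ;; Prog.rep 31 (timeProg h₀ C) ;; .const 0 1 ;;
  .ite 9 (.const 0 0) (.const 21 0)

theorem Runs.weaken {q : Prog} {B B' : ℕ} {st : MachineState} {Q : MachineState → Prop}
    (h : Runs q B st Q) (hB : B ≤ B') : Runs q B' st Q :=
  h.mono hB fun _ _ h => h

set_option linter.unusedSectionVars false

section Certifier

variable {N : ℕ} [NeZero N] {s : ShiftSchedule N} {st : MachineState}

/-- The integer `2 ^ ⌈⌈log₂ N⌉ / h⌉`, which exceeds `N^{1/h}` by at most a constant factor. -/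
def hopRoot (N h : ℕ) : ℕ := 2 ^ (Nat.clog 2 N ⌈/⌉ h)

/-- The number of windows among which the semi-routes with `h` hops choose. -/
def windowCount (N h₀ K h : ℕ) : ℕ := if h ≤ h₀ then 1 else K * Nat.clog 2 N

/-- The block counts from time `t` are balanced enough for routing with `h` hops. -/
def HopCountOK (s : ShiftSchedule N) (h₀ p C K t h : ℕ) : Prop :=
  Passes s t (C * hopRoot N h) h (windowCount N h₀ K h) p ∧
    Passes s t (hopRoot N h) (10 * h) 1 (2 * N)

/-- The condition that the certifier tests. -/
def Certified (s : ShiftSchedule N) (h₀ p C K : ℕ) : Prop :=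
  ∀ t < s.period, Passes s t 2 (10 * Nat.clog 2 N) 1 (2 * N) ∧
    ∀ h, 1 ≤ h → h ≤ Nat.clog 2 N → HopCountOK s h₀ p C K t h

/-- The memory before the checks for time `t`. -/
structure Ready (s : ShiftSchedule N) (p K t : ℕ) (st : MachineState) : Prop where
  loaded : Loaded s st
  time : st.reg 4 = t
  clog : st.reg 26 = Nat.clog 2 N
  double : st.reg 27 = 2 * N
  hops : st.reg 28 = 10 * Nat.clog 2 N
  windows : st.reg 29 = K * Nat.clog 2 N
  factor : st.reg 30 = p
  clear₁ : Holds st 1 (fun _ : ZMod N => 0)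
  clear₂ : Holds st 2 (fun _ : ZMod N => 0)

/-- The program preserves the registers that `Ready` mentions. -/
def Prog.preservesReady (q : Prog) : Bool :=
  q.preservesInput && [4, 26, 27, 28, 29, 30].all fun r => !q.regs.contains r

theorem Ready.frame {p K t : ℕ} {st st' : MachineState} (h : Ready s p K t st) {q : Prog}
    (hf : Frame q st st') (hq : q.preservesReady = true)
    (h1 : Holds st' 1 (fun _ : ZMod N => 0)) (h2 : Holds st' 2 (fun _ : ZMod N => 0)) :
    Ready s p K t st' := by
  simp only [Prog.preservesReady, Bool.and_eq_true, List.all_cons, List.all_nil,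
    Bool.not_eq_true', List.contains_eq_mem, decide_eq_false_iff_not, and_true] at hq
  obtain ⟨h0, h4, h26, h27, h28, h29, h30⟩ := hq
  exact ⟨h.loaded.frame hf h0, by rw [hf.1 4 h4, h.time], by rw [hf.1 26 h26, h.clog],
    by rw [hf.1 27 h27, h.double], by rw [hf.1 28 h28, h.hops], by rw [hf.1 29 h29, h.windows],
    by rw [hf.1 30 h30, h.factor], h1, h2⟩

theorem Ready.frame_of_notMem {p K t : ℕ} {st st' : MachineState} (h : Ready s p K t st) {q : Prog}
    (hf : Frame q st st') (hq : q.preservesReady = true)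
    (h1 : 1 ∉ q.arrs) (h2 : 2 ∉ q.arrs) : Ready s p K t st' := by
  refine h.frame hf hq ?_ ?_
  · intro c
    rw [hf.2 1 h1]
    exact h.clear₁ c
  · intro c
    rw [hf.2 2 h2]
    exact h.clear₂ c

theorem Ready.effect {p K t : ℕ} {st : MachineState} (h : Ready s p K t st) {q : Prog}
    (hq : q.preservesReady = true) (h1 : q.arrs = []) : Ready s p K t (q.effect st) :=
  h.frame_of_notMem (frame_effect q st) hq (by simp [h1]) (by simp [h1])

theorem runs_check_of_ready {p K t b h M κ : ℕ} (hR : Ready s p K t st) (ht : t < s.period)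
    (h5 : st.reg 5 = b) (h6 : st.reg 6 = h) (h7 : st.reg 7 = M) (h8 : st.reg 8 = κ) :
    Runs checkProg (checkTime N b h M κ) st fun st' =>
      (st'.reg 9 = 0 ↔ st.reg 9 = 0 ∧ Passes s t b h M κ) ∧ Ready s p K t st' :=
  (runs_checkProg hR.loaded ht hR.time h5 h6 h7 h8 hR.clear₁ hR.clear₂).mono le_rfl
    fun _ hf h => ⟨h.1, hR.frame hf (by decide) h.2.1 h.2.2⟩

/-- A bound for the running time of `hopCountProg`. -/
def hopCountTime (N h₀ p C K h : ℕ) : ℕ :=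
  checkTime N (C * hopRoot N h) h (windowCount N h₀ K h) p +
    checkTime N (hopRoot N h) (10 * h) 1 (2 * N) + Nat.clog 2 N * 6 + 3 * C + 60

theorem runs_hopCountProg {h₀ p C K t j : ℕ} (hR : Ready s p K t st) (ht : t < s.period)
    (h32 : st.reg 32 = j) :
    Runs (hopCountProg h₀ C) (hopCountTime N h₀ p C K (j + 1)) st fun st' =>
      (st'.reg 9 = 0 ↔ st.reg 9 = 0 ∧ HopCountOK s h₀ p C K t (j + 1)) ∧ Ready s p K t st' ∧
      st'.reg 32 = j + 1 := by
  refine Runs.weaken (B := Nat.clog 2 N * 6 + 4 + (3 * C + 3 + (2 + (checkTime N (C * hopRoot N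
    (j + 1)) (j + 1) (windowCount N h₀ K (j + 1)) p + (3 * 10 + 3 + (checkTime N
    (hopRoot N (j + 1)) (10 * (j + 1)) 1 (2 * N) + 1 + 1) + 1) + 1) + 1 + 1 + 1 + 1)) + 1) ?_ ?_
  · refine Runs.basic_seq rfl (Runs.seq ?_)
    have hR₁ := hR.effect (q := .add 32 32 3) rfl rfl
    have e32 : ((Prog.add 32 32 3).effect st).reg 32 = j + 1 := by
      simp [h32, hR.loaded.one]
    have e9 : ((Prog.add 32 32 3).effect st).reg 9 = st.reg 9 := by simp
    set st₁ := (Prog.add 32 32 3).effect st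
    refine (runs_rootProg hR₁.clog e32 (Nat.succ_pos j) hR₁.loaded.zero hR₁.loaded.one).mono
      le_rfl fun st₂ hf₂ h34 => ?_
    have hR₂ := hR₁.frame_of_notMem hf₂ (by decide) (by decide) (by decide)
    have e32₂ : st₂.reg 32 = j + 1 := by rw [hf₂.1 32 (by decide), e32]
    have e9₂ : st₂.reg 9 = st.reg 9 := by rw [hf₂.1 9 (by decide), e9]
    refine Runs.seq ((runs_mulConst (a := 34) (c := C) hR₂.loaded.one (by norm_num) (by norm_num)
      (by norm_num) (by norm_num)).mono le_rfl fun st₃ hf₃ h5 => ?_)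
    have hR₃ := hR₂.frame_of_notMem hf₃ rfl (by simp [mulConst, Prog.rep, Prog.arrs])
      (by simp [mulConst, Prog.rep, Prog.arrs])
    have hregs₃ : ∀ r, r ≠ 5 → r ≠ 20 → st₃.reg r = st₂.reg r := fun r h1 h2 =>
      hf₃.1 r (by simp [mulConst, Prog.rep, Prog.regs, h1, h2])
    have e32₃ : st₃.reg 32 = j + 1 := by rw [hregs₃ 32 (by norm_num) (by norm_num), e32₂]
    have e9₃ : st₃.reg 9 = st.reg 9 := by rw [hregs₃ 9 (by norm_num) (by norm_num), e9₂]
    have e34₃ : st₃.reg 34 = hopRoot N (j + 1) := by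
      rw [hregs₃ 34 (by norm_num) (by norm_num), h34]
      rfl
    refine Runs.basic_seq rfl (Runs.basic_seq rfl (Runs.basic_seq rfl (Runs.basic_seq rfl
      (Runs.seq (B := 2) (Runs.mono (B := 2) (Q := fun st₄ => Ready s p K t st₄ ∧
        st₄.reg 5 = C * hopRoot N (j + 1) ∧ st₄.reg 6 = j + 1 ∧
        st₄.reg 7 = windowCount N h₀ K (j + 1) ∧ st₄.reg 9 = st.reg 9 ∧
        st₄.reg 34 = hopRoot N (j + 1) ∧ st₄.reg 32 = j + 1) ?_ le_rfl ?_)))))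
    · have hR₄ := (((hR₃.effect (q := .add 6 32 2) rfl rfl).effect (q := .add 7 29 2) rfl
        rfl).effect (q := .const 21 h₀) rfl rfl).effect (q := .sub 21 32 21) rfl rfl
      refine Runs.ite (fun h => Runs.basic (B := 0) rfl ?_) fun h => Runs.basic (B := 0) rfl ?_
      · simp [e32₃] at h
        have hc : ¬ j + 1 ≤ h₀ := by omega
        refine ⟨hR₄.effect rfl rfl, ?_, ?_, ?_, ?_, ?_, ?_⟩
        · simp [h5, h34, hopRoot]
        · simp [e32₃, hR₃.loaded.zero]
        · simp [hR₃.loaded.zero, hR₃.windows, windowCount, hc]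
        · simp [e9₃]
        · simp [e34₃]
        · simp [e32₃]
      · simp [e32₃] at h
        have hc : j + 1 ≤ h₀ := by omega
        refine ⟨hR₄.effect rfl rfl, ?_, ?_, ?_, ?_, ?_, ?_⟩
        · simp [h5, h34, hopRoot]
        · simp [e32₃, hR₃.loaded.zero]
        · simp [windowCount, hc]
        · simp [e9₃]
        · simp [e34₃]
        · simp [e32₃]
    · rintro st₄ - ⟨hR₄, f5, f6, f7, f9, f34, f32⟩
      refine Runs.basic_seq rfl (Runs.seq ((runs_check_of_ready
        (hR₄.effect (q := .add 8 30 2) rfl rfl) ht (b := C * hopRoot N (j + 1)) (h := j + 1)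
        (M := windowCount N h₀ K (j + 1)) (κ := p) ?_ ?_ ?_ ?_).mono le_rfl ?_))
      · simp [f5]
      · simp [f6]
      · simp [f7]
      · simp [hR₄.factor, hR₄.loaded.zero]
      · rintro st₅ hf₅ ⟨g9, hR₅⟩
        have g9' : st₅.reg 9 = 0 ↔ st.reg 9 = 0 ∧
            Passes s t (C * hopRoot N (j + 1)) (j + 1) (windowCount N h₀ K (j + 1)) p := by
          rw [g9, ← f9]
          simp
        have g32 : st₅.reg 32 = j + 1 := by
          rw [hf₅.1 32 (by decide)]
          simpa using f32
        have g34 : st₅.reg 34 = hopRoot N (j + 1) := by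
          rw [hf₅.1 34 (by decide)]
          simpa using f34
        have hR₅' := hR₅.effect (q := .add 5 34 2) rfl rfl
        refine Runs.basic_seq rfl (Runs.seq ((runs_mulConst (a := 32) (c := 10)
          hR₅'.loaded.one (by norm_num) (by norm_num) (by norm_num) (by norm_num)).mono
          le_rfl fun st₆ hf₆ k6 => ?_))
        have hR₆ := hR₅'.frame_of_notMem hf₆ rfl (by decide) (by decide)
        have k5 : st₆.reg 5 = hopRoot N (j + 1) := by
          rw [hf₆.1 5 (by decide)]
          simp [g34, hR₅.loaded.zero]
        have k9 : st₆.reg 9 = st₅.reg 9 := by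
          rw [hf₆.1 9 (by decide)]
          simp
        have k32 : st₆.reg 32 = j + 1 := by
          rw [hf₆.1 32 (by decide)]
          simp [g32]
        refine Runs.basic_seq rfl (Runs.basic_seq rfl ((runs_check_of_ready
          ((hR₆.effect (q := .const 7 1) rfl rfl).effect (q := .add 8 27 2) rfl rfl) ht
          (b := hopRoot N (j + 1)) (h := 10 * (j + 1)) (M := 1) (κ := 2 * N)
          ?_ ?_ ?_ ?_).mono le_rfl ?_))
        · simp [k5]
        · simp [k6, g32]
        · simp
        · simp [hR₆.double, hR₆.loaded.zero]
        · rintro st₇ hf₇ ⟨l9, hR₇⟩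
          refine ⟨?_, hR₇, ?_⟩
          · have : (((Prog.add 8 27 2).effect ((Prog.const 7 1).effect st₆)).reg 9) =
                st₆.reg 9 := by simp
            rw [l9, this, k9, g9', HopCountOK, and_assoc]
          · rw [hf₇.1 32 (by decide)]
            simpa using k32
  · rw [hopCountTime]
    omega

end Certifier

/-! ### Running time bounds that are uniform in the hop count -/

section CertifierTime

theorem two_pow_clog_le (N : ℕ) [NeZero N] : 2 ^ Nat.clog 2 N ≤ 2 * N := by
  rcases Nat.eq_zero_or_pos (Nat.clog 2 N) with h | h
  · rw [h]
    have := NeZero.pos N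
    omega
  · obtain ⟨m, hm⟩ := Nat.exists_eq_succ_of_ne_zero h.ne'
    have : 2 ^ m < N := by
      rw [← Nat.lt_clog_iff_pow_lt (by norm_num), hm]
      exact Nat.lt_succ_self m
    rw [hm, pow_succ]
    omega

theorem clog_le_self (N : ℕ) : Nat.clog 2 N ≤ N :=
  (Nat.clog_le_iff_le_pow (by norm_num)).2 Nat.lt_two_pow_self.le

theorem hopRoot_le (N : ℕ) [NeZero N] {h : ℕ} (hh : 0 < h) : hopRoot N h ≤ 2 * N := by
  refine le_trans (Nat.pow_le_pow_right (by norm_num) ?_) (two_pow_clog_le N)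
  rw [ceilDiv_le_iff_le_mul hh]
  exact Nat.le_mul_of_pos_left _ hh

theorem windowCount_le (N h₀ K h : ℕ) : windowCount N h₀ K h ≤ 1 + K * N := by
  rw [windowCount]
  split_ifs
  · omega
  · have := Nat.mul_le_mul_left K (clog_le_self N)
    omega

theorem checkTime_mono {N b b' h h' M M' κ κ' : ℕ} (hb : b ≤ b') (hh : h ≤ h') (hM : M ≤ M')
    (hκ : κ ≤ κ') : checkTime N b h M κ ≤ checkTime N b' h' M' κ' := by
  rw [checkTime, checkTime, windowTime, windowTime]
  gcongr

/-- A bound for the running time of `hopCountProg` that does not depend on the hop count. -/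
def hopCountBound (N p C K : ℕ) : ℕ :=
  checkTime N (C * (2 * N)) N (1 + K * N) p + checkTime N (2 * N) (10 * N) 1 (2 * N) +
    N * 6 + 3 * C + 60

theorem hopCountTime_le (N : ℕ) [NeZero N] {h₀ p C K h : ℕ} (hh : 0 < h)
    (hh' : h ≤ Nat.clog 2 N) : hopCountTime N h₀ p C K h ≤ hopCountBound N p C K := by
  have h1 := hopRoot_le N hh
  have h2 := windowCount_le N h₀ K h
  have h3 := clog_le_self N
  rw [hopCountTime, hopCountBound]
  have h4 := checkTime_mono (N := N) (Nat.mul_le_mul_left C h1) (hh'.trans h3) h2 le_rfl (κ := p)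
  have h5 := checkTime_mono (N := N) h1 (Nat.mul_le_mul_left 10 (hh'.trans h3)) le_rfl le_rfl
    (M := 1) (κ := 2 * N)
  omega

/-- A bound for the running time of `timeProg`. -/
def timeBound (N p C K : ℕ) : ℕ :=
  checkTime N 2 (10 * N) 1 (2 * N) + N * (hopCountBound N p C K + 2) + 9

/-- A bound for the running time of `certifier` on schedules of period `T`. -/
def certifierTime (N T p C K : ℕ) : ℕ := T * (timeBound N p C K + 2) + N * 6 + 3 * K + 60

end CertifierTime

/-! ### Correctness of the certifier -/

section Certifier

variable {N : ℕ} [NeZero N] {s : ShiftSchedule N} {st : MachineState}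

theorem not_mem_regs_hopCountProg (h₀ C : ℕ) {r : ℕ}
    (hr : (hopCountProg 0 0).regs.contains r = false) : r ∉ (hopCountProg h₀ C).regs := by
  have : (hopCountProg h₀ C).regs = (hopCountProg 0 0).regs := rfl
  rw [this]
  simpa using hr

theorem not_mem_regs_timeProg (h₀ C : ℕ) {r : ℕ}
    (hr : (timeProg 0 0).regs.contains r = false) : r ∉ (timeProg h₀ C).regs := by
  have : (timeProg h₀ C).regs = (timeProg 0 0).regs := rfl
  rw [this]
  simpa using hr

theorem runs_timeProg {h₀ p C K t : ℕ} (hR : Ready s p K t st) (ht : t < s.period) :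
    Runs (timeProg h₀ C) (timeBound N p C K) st fun st' =>
      (st'.reg 9 = 0 ↔ st.reg 9 = 0 ∧ Passes s t 2 (10 * Nat.clog 2 N) 1 (2 * N) ∧
        ∀ h, 1 ≤ h → h ≤ Nat.clog 2 N → HopCountOK s h₀ p C K t h) ∧ Ready s p K (t + 1) st' := by
  refine Runs.weaken (B := checkTime N 2 (10 * Nat.clog 2 N) 1 (2 * N) +
    ((Nat.clog 2 N * (hopCountBound N p C K + 2) + 1) + 1 + 1 + 1) + 1 + 1 + 1 + 1) ?_ ?_
  · refine Runs.basic_seq rfl (Runs.basic_seq rfl (Runs.basic_seq rfl (Runs.basic_seq rfl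
      (Runs.seq ?_))))
    have hR₁ := (((hR.effect (q := .const 5 2) rfl rfl).effect (q := .add 6 28 2) rfl rfl).effect
      (q := .const 7 1) rfl rfl).effect (q := .add 8 27 2) rfl rfl
    refine (runs_check_of_ready hR₁ ht (b := 2) (h := 10 * Nat.clog 2 N) (M := 1) (κ := 2 * N)
      ?_ ?_ ?_ ?_).mono le_rfl ?_
    · simp
    · simp [hR.hops, hR.loaded.zero]
    · simp
    · simp [hR.double, hR.loaded.zero]
    rintro st₂ - ⟨e9, hR₂⟩
    have e9' : st₂.reg 9 = 0 ↔ st.reg 9 = 0 ∧ Passes s t 2 (10 * Nat.clog 2 N) 1 (2 * N) := by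
      rw [e9]
      simp
    refine Runs.basic_seq rfl (Runs.basic_seq rfl ?_)
    refine Runs.weaken (B := Nat.clog 2 N * (hopCountBound N p C K + 2) + 1 + (0 + 1)) ?_ (by omega)
    refine Runs.seq ?_
    have hR₃ := (hR₂.effect (q := .const 32 0) rfl rfl).effect (q := .add 33 26 2) rfl rfl
    refine Runs.rep (fun j st' => (st'.reg 9 = 0 ↔ (st.reg 9 = 0 ∧
        Passes s t 2 (10 * Nat.clog 2 N) 1 (2 * N)) ∧
        ∀ h, 1 ≤ h → h ≤ j → HopCountOK s h₀ p C K t h) ∧ Ready s p K t st' ∧ st'.reg 32 = j)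
      ?_ hR₃.loaded.one (not_mem_regs_hopCountProg _ _ rfl) (not_mem_regs_hopCountProg _ _ rfl)
      (by norm_num) ?_ ?_ ?_ ?_
    · simp [hR₂.clog, hR₂.loaded.zero]
    · refine ⟨?_, hR₃, by simp⟩
      rw [← e9']
      have : ∀ h, 1 ≤ h → h ≤ 0 → HopCountOK s h₀ p C K t h := by
        intro h h1 h2
        omega
      rw [and_iff_left this]
      simp
    · rintro j st' v ⟨h1, h2, h3⟩
      exact ⟨by simpa using h1, h2.effect (q := .const 33 v) rfl rfl, by simpa using h3⟩
    · rintro j hj st' - ⟨h1, h2, h3⟩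
      refine (runs_hopCountProg h2 ht h3).mono (hopCountTime_le N (Nat.succ_pos j) hj) ?_
      rintro st'' - ⟨f1, f2, f3⟩
      refine ⟨?_, f2, f3⟩
      rw [f1, h1, and_assoc]
      refine and_congr_right fun _ => ⟨fun ⟨g1, g2⟩ h hh hh' => ?_, fun g => ⟨fun h hh hh' =>
        g h hh (hh'.trans (Nat.le_succ j)), g _ (Nat.succ_pos j) le_rfl⟩⟩
      rcases Nat.lt_or_ge h (j + 1) with hlt | hge
      · exact g1 h hh (Nat.lt_succ_iff.1 hlt)
      · rwa [le_antisymm hh' hge]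
    · rintro st' - ⟨h1, h2, -⟩
      refine Runs.basic rfl ⟨?_, ?_⟩
      · rw [← and_assoc, ← h1]
        simp
      · obtain ⟨a1, a2, a3, a4, a5, a6, a7, a8, a9⟩ := h2
        refine ⟨a1.effect rfl, ?_, ?_, ?_, ?_, ?_, ?_, ?_, ?_⟩
        · simp [a2, a1.one]
        · simpa using a3
        · simpa using a4
        · simpa using a5
        · simpa using a6
        · simpa using a7
        · exact a8
        · exact a9
  · have := Nat.mul_le_mul_right (hopCountBound N p C K + 2) (clog_le_self N)
    have h2 := checkTime_mono (N := N) (le_refl 2) (Nat.mul_le_mul_left 10 (clog_le_self N))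
      (le_refl 1) (le_refl (2 * N))
    rw [timeBound]
    omega

theorem runs_certifier (s : ShiftSchedule N) (h₀ p C K : ℕ) :
    Runs (certifier h₀ p C K) (certifierTime N s.period p C K) (inputState N s.shift) fun st' =>
      st'.reg 0 = 1 ↔ Certified s h₀ p C K := by
  obtain ⟨τ, hτ⟩ : ∃ τ, τ = s.period * (timeBound N p C K + 2) + 1 := ⟨_, rfl⟩
  refine Runs.weaken (B := N * 6 + 4 + (3 * 10 + 3 + (3 * K + 3 + (τ + (2 + 1) + 1 + 1 + 1)) + 1) +
    1 + 1) ?_ (by rw [certifierTime]; omega)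
  refine Runs.basic_seq rfl (Runs.basic_seq rfl (Runs.seq ?_))
  set st₀ := (Prog.const 3 1).effect ((Prog.const 2 0).effect (inputState N s.shift)) with hst₀
  have hL₀ : Loaded s st₀ := by
    refine ⟨?_, ?_, ?_, ?_, ?_⟩
    · simp [st₀, inputState]
    · simp [st₀, inputState]
    · simp [st₀, inputState]
    · simp [st₀, inputState]
    · intro i
      simp [st₀, inputState]
  have h9₀ : st₀.reg 9 = 0 := by simp [st₀, inputState]
  have hc₁ : Holds st₀ 1 (fun _ : ZMod N => 0) := fun c => by simp [st₀, inputState]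
  have hc₂ : Holds st₀ 2 (fun _ : ZMod N => 0) := fun c => by simp [st₀, inputState]
  refine (runs_clogProg hL₀.size hL₀.zero hL₀.one).mono le_rfl fun st₁ hf₁ e26 => ?_
  have hL₁ := hL₀.frame hf₁ (by decide)
  refine Runs.basic_seq rfl (Runs.seq ?_)
  have hL₂ := hL₁.effect (p := .add 27 0 0) rfl
  refine (runs_mulConst (a := 26) (c := 10) hL₂.one (by norm_num) (by norm_num) (by norm_num)
    (by norm_num)).mono le_rfl fun st₃ hf₃ e28 => ?_
  have hL₃ := hL₂.frame hf₃ rfl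
  refine Runs.seq ?_
  refine (runs_mulConst (a := 26) (c := K) hL₃.one (by norm_num) (by norm_num) (by norm_num)
    (by norm_num)).mono le_rfl fun st₄ hf₄ e29 => ?_
  have hL₄ := hL₃.frame hf₄ rfl
  have hregs₄ : ∀ r, r ≠ 29 → r ≠ 20 → st₄.reg r = st₃.reg r := fun r h1 h2 =>
    hf₄.1 r (by simp [mulConst, Prog.rep, Prog.regs, h1, h2])
  have harr : ∀ A, st₄.arr A = st₀.arr A := fun A => by
    rw [hf₄.2 A (by simp [mulConst, Prog.rep, Prog.arrs]),
      hf₃.2 A (by simp [mulConst, Prog.rep, Prog.arrs])]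
    exact hf₁.2 A (by simp [clogProg, Prog.rep, Prog.arrs])
  have f26₃ : st₃.reg 26 = Nat.clog 2 N := by
    rw [hf₃.1 26 (by decide)]
    simpa using e26
  have f9 : st₄.reg 9 = 0 := by
    rw [hregs₄ 9 (by norm_num) (by norm_num), hf₃.1 9 (by decide)]
    simp only [Prog.effect, MachineState.reg_setReg]
    rw [if_neg (by norm_num), hf₁.1 9 (by decide), h9₀]
  refine Runs.basic_seq rfl (Runs.basic_seq rfl (Runs.basic_seq rfl (Runs.seq
    (B := τ) (B' := 2 + 1) ?_)))
  rw [hτ]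
  have hR : Ready s p K 0 ((Prog.add 31 1 2).effect ((Prog.const 4 0).effect
      ((Prog.const 30 p).effect st₄))) := by
    refine ⟨((hL₄.effect rfl).effect rfl).effect rfl, ?_, ?_, ?_, ?_, ?_, ?_, ?_, ?_⟩
    · simp
    · simp [hregs₄ 26 (by norm_num) (by norm_num), f26₃]
    · simp [hregs₄ 27 (by norm_num) (by norm_num), hf₃.1 27 (by decide), hL₁.size, two_mul]
    · simp [hregs₄ 28 (by norm_num) (by norm_num), e28, e26]
    · simp [e29, f26₃]
    · simp
    · intro c
      simpa [harr] using hc₁ c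
    · intro c
      simpa [harr] using hc₂ c
  refine Runs.rep (c := 31) (p := timeProg h₀ C) (fun j st' => (st'.reg 9 = 0 ↔ ∀ t < j,
      Passes s t 2 (10 * Nat.clog 2 N) 1 (2 * N) ∧
        ∀ h, 1 ≤ h → h ≤ Nat.clog 2 N → HopCountOK s h₀ p C K t h) ∧ Ready s p K j st')
    ?_ hR.loaded.one (not_mem_regs_timeProg _ _ rfl) (not_mem_regs_timeProg _ _ rfl)
    (by norm_num) ?_ ?_ ?_ ?_
  · simp [hL₄.period, hL₄.zero]
  · exact ⟨by simp [f9], hR⟩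
  · rintro j st' v ⟨h1, h2⟩
    exact ⟨by simpa using h1, h2.effect (q := .const 31 v) rfl rfl⟩
  · rintro j hj st' - ⟨h1, h2⟩
    refine (runs_timeProg h2 hj).mono le_rfl ?_
    rintro st'' - ⟨g1, g2⟩
    refine ⟨?_, g2⟩
    rw [g1, h1]
    refine ⟨fun ⟨k1, k2⟩ t ht => ?_, fun k => ⟨fun t ht => k t (ht.trans (Nat.lt_succ_self j)),
      k j (Nat.lt_succ_self j)⟩⟩
    rcases Nat.lt_or_ge t j with hlt | hge
    · exact k1 t hlt
    · rw [le_antisymm (Nat.lt_succ_iff.1 ht) hge]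
      exact k2
  · rintro st' - ⟨h1, h2⟩
    have h1' : st'.reg 9 = 0 ↔ Certified s h₀ p C K := h1
    refine Runs.basic_seq rfl (Runs.ite (fun h => Runs.basic (B := 0) rfl ?_) fun h =>
      Runs.basic (B := 0) rfl ?_)
    · simp at h
      rw [h1'] at h
      simp [h]
    · simp at h
      rw [h1'] at h
      simp [h]

theorem haltsWithin_certifier (s : ShiftSchedule N) (h₀ p C K : ℕ) :
    HaltsWithin (certifier h₀ p C K) s (certifierTime N s.period p C K) := by
  obtain ⟨st, n, h1, h2, -⟩ := runs_certifier s h₀ p C K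
  exact ⟨st, n, h1, h2⟩

theorem accepts_certifier_iff (s : ShiftSchedule N) (h₀ p C K : ℕ) :
    Accepts (certifier h₀ p C K) s ↔ Certified s h₀ p C K := by
  obtain ⟨st, n, h1, -, h3⟩ := runs_certifier s h₀ p C K
  rw [← h3]
  refine ⟨?_, fun h => ⟨st, n, h1, h⟩⟩
  rintro ⟨st', n', h1', h3'⟩
  rw [(h1.det h1').1, h3']

end Certifier

/-! ## Polynomial time -/

/-- The function is given by a polynomial with natural coefficients. -/
def IsPolynomial (f : ℕ → ℕ) : Prop := ∃ q : Polynomial ℕ, ∀ n, q.eval n = f n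

namespace IsPolynomial

variable {f g : ℕ → ℕ}

theorem const (c : ℕ) : IsPolynomial fun _ => c := ⟨Polynomial.C c, by simp⟩

theorem id : IsPolynomial fun n => n := ⟨Polynomial.X, by simp⟩

theorem add (hf : IsPolynomial f) (hg : IsPolynomial g) : IsPolynomial fun n => f n + g n := by
  obtain ⟨p, hp⟩ := hf
  obtain ⟨q, hq⟩ := hg
  exact ⟨p + q, by simp [hp, hq]⟩

theorem mul (hf : IsPolynomial f) (hg : IsPolynomial g) : IsPolynomial fun n => f n * g n := by
  obtain ⟨p, hp⟩ := hf
  obtain ⟨q, hq⟩ := hg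
  exact ⟨p * q, by simp [hp, hq]⟩

end IsPolynomial

theorem certifierTime_mono {N N' T T' : ℕ} (hN : N ≤ N') (hT : T ≤ T') (p C K : ℕ) :
    certifierTime N T p C K ≤ certifierTime N' T' p C K := by
  simp only [certifierTime, timeBound, hopCountBound, checkTime, windowTime]
  gcongr

theorem isPolynomial_certifierTime (p C K : ℕ) :
    IsPolynomial fun n => certifierTime n n p C K := by
  simp only [certifierTime, timeBound, hopCountBound, checkTime, windowTime]
  repeat' first
    | exact IsPolynomial.const _
    | exact IsPolynomial.id
    | apply IsPolynomial.add
    | apply IsPolynomial.mul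

/-! ## Certified schedules support all hop counts -/

set_option linter.unusedSectionVars false

section Soundness

variable {N : ℕ} [NeZero N] {s : ShiftSchedule N}

/-- The deficits are periodic in time, so tests at the starting times of one period cover all
integers. -/
theorem sum_blockDeficit_of_passes {b h M κ : ℕ} (hp : ∀ t < s.period, Passes s t b h M κ) (t : ℤ) :
    κ * ∑ i : Fin M, blockDeficit s.shiftAt (t + (i * (h * b) : ℕ)) b h ≤ M * (N * b ^ h) := by
  have hT : (0 : ℤ) < s.period := by exact_mod_cast s.period_pos
  have hper : ∀ a : ℤ, Function.Periodic (fun t => blockDeficit s.shiftAt (t + a) b h)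
      (s.period : ℤ) := by
    intro a t
    beta_reduce
    rw [add_right_comm, blockDeficit, blockDeficit, blockCount_shiftAt_add_period]
  have h1 := Int.emod_nonneg t hT.ne'
  have h2 := Int.emod_lt_of_pos t hT
  obtain ⟨u, hu⟩ := Int.eq_ofNat_of_zero_le h1
  have h3 := hp u (by omega)
  have h4 : t = u + t / s.period * s.period := by
    rw [← hu, mul_comm, Int.emod_add_mul_ediv]
  rw [Passes, Finset.sum_range] at h3
  refine le_trans (le_of_eq ?_) h3
  congr 1
  refine Finset.sum_congr rfl fun i _ => ?_
  conv_lhs => rw [h4]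
  exact (hper _).int_mul (t / s.period) u

theorem le_blockCount_of_passes {b h : ℕ} (hp : ∀ t < s.period, Passes s t b h 1 (2 * N)) (t : ℤ)
    (c : ZMod N) : b ^ h ≤ 2 * (N * blockCount s.shiftAt t b h c) := by
  refine le_blockCount_of_deficit ?_ c
  simpa using sum_blockDeficit_of_passes hp t

theorem pos_of_le_blockCount {b h : ℕ} (hb : 0 < b)
    (H : ∀ (t : ℤ) (c : ZMod N), b ^ h ≤ 2 * (N * blockCount s.shiftAt t b h c)) (t : ℤ)
    (c : ZMod N) : 0 < blockCount s.shiftAt t b h c := by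
  have h1 := H t c
  have h2 : 0 < b ^ h := pow_pos hb h
  by_contra h3
  have h4 : blockCount s.shiftAt t b h c = 0 := by omega
  simp only [h4, mul_zero] at h1
  omega

theorem one_le_clog {N : ℕ} (hN : 2 ≤ N) : 1 ≤ Nat.clog 2 N :=
  Nat.clog_pos (by norm_num) hN

theorem clog_le_logb {N : ℕ} (hN : 2 ≤ N) : (Nat.clog 2 N : ℝ) ≤ Real.logb 2 N + 1 := by
  have h1 := one_le_clog hN
  obtain ⟨m, hm⟩ := Nat.exists_eq_add_of_le' h1
  have h2 : 2 ^ m < N := by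
    rw [← Nat.lt_clog_iff_pow_lt (by norm_num), hm]
    omega
  rw [hm]
  push_cast
  gcongr
  rw [Real.le_logb_iff_rpow_le (by norm_num) (by positivity), Real.rpow_natCast]
  exact_mod_cast h2.le

theorem clog_le_log {N : ℕ} (hN : 2 ≤ N) : (Nat.clog 2 N : ℝ) ≤ 3 * Real.log N := by
  have hl : Real.log 2 ≤ Real.log N := Real.log_le_log (by norm_num) (by exact_mod_cast hN)
  have h2 := Real.log_two_gt_d9
  have h1 := clog_le_logb hN
  rw [Real.logb] at h1
  -- Since log N ≥ log 2, the left side is at most (2 / log 2) log N, and 2 / log 2 < 3.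
  have h3 : Real.log N / Real.log 2 + 1 ≤ 3 * Real.log N := by
    rw [div_add_one (by positivity), div_le_iff₀ (by positivity)]
    nlinarith
  linarith

/-- Two values are rounded up, log₂ N and its quotient by `h`; each raises the exponent by at most
1, hence the factor 4. -/
theorem hopRoot_le_rpow {N h : ℕ} (hN : 2 ≤ N) (hh : 0 < h) :
    (hopRoot N h : ℝ) ≤ 4 * (N : ℝ) ^ (1 / (h : ℝ)) := by
  have hh' : (0 : ℝ) < h := by exact_mod_cast hh
  have hh1 : (1 : ℝ) ≤ h := by exact_mod_cast hh
  have hN' : (0 : ℝ) < N := by positivity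
  have h1 : ((Nat.clog 2 N ⌈/⌉ h : ℕ) : ℝ) ≤ Real.logb 2 N * (1 / h) + 2 := by
    have h2 : Nat.clog 2 N ⌈/⌉ h * h ≤ Nat.clog 2 N + h := by
      rw [Nat.ceilDiv_eq_add_pred_div]
      exact (Nat.div_mul_le_self _ _).trans (by omega)
    have h3 : ((Nat.clog 2 N ⌈/⌉ h : ℕ) : ℝ) * h ≤ Nat.clog 2 N + h := by exact_mod_cast h2
    have h4 := clog_le_logb hN
    rw [← mul_le_mul_iff_of_pos_right hh']
    have : (Real.logb 2 N * (1 / h) + 2) * h = Real.logb 2 N + 2 * h := by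
      field_simp
    rw [this]
    linarith
  calc (hopRoot N h : ℝ) = (2 : ℝ) ^ ((Nat.clog 2 N ⌈/⌉ h : ℕ) : ℝ) := by
        rw [hopRoot, Real.rpow_natCast]
        norm_cast
    _ ≤ (2 : ℝ) ^ (Real.logb 2 N * (1 / h) + 2) :=
        Real.rpow_le_rpow_of_exponent_le (by norm_num) h1
    _ = 4 * (N : ℝ) ^ (1 / (h : ℝ)) := by
        rw [Real.rpow_add (by norm_num), Real.rpow_mul (by norm_num),
          Real.rpow_logb (by norm_num) (by norm_num) hN']
        norm_num
        ring

theorem two_le_of_hops {N h : ℕ} [NeZero N] (hh : 1 ≤ h) (h2 : (h : ℝ) ≤ Real.logb 2 N) :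
    2 ≤ N ∧ h ≤ Nat.clog 2 N := by
  have hN : (0 : ℝ) < N := by exact_mod_cast NeZero.pos N
  rw [Real.le_logb_iff_rpow_le (by norm_num) hN, Real.rpow_natCast] at h2
  have h3 : 2 ^ h ≤ N := by exact_mod_cast h2
  have h4 : 2 ^ 1 ≤ 2 ^ h := Nat.pow_le_pow_right (by norm_num) hh
  refine ⟨by omega, ?_⟩
  rw [← Nat.pow_le_pow_iff_right (a := 2) (by norm_num)]
  exact h3.trans (Nat.le_pow_clog (by norm_num) N)

/-- The fallback route with 10h hops per round has load h + 4 (10h) / p = h (1 + 40/p). Its window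
length is h ρ (M C + 20), with ρ the rounded root and M the number of windows; the two halves double
it. -/
theorem exists_routing_of_hopCountOK {h₀ p C K h : ℕ} (hh : 1 ≤ h) (hp : 0 < p) (hC : 0 < C)
    (hM : 0 < windowCount N h₀ K h) (hs : ∀ t < s.period, HopCountOK s h₀ p C K t h) {r : ℝ}
    (hr : r * (2 * (h * (1 + 40 / p))) ≤ 1) :
    ∃ R : PathFlow (ZMod N), IsObliviousRouting s.toConnectionSchedule R ∧
      GuaranteesThroughput s.toConnectionSchedule R r ∧
      maxLatency R ≤ (2 * (h * hopRoot N h * (windowCount N h₀ K h * C + 20)) : ℕ) := by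
  have hρ : 0 < hopRoot N h := pow_pos (by norm_num) _
  have hfall := le_blockCount_of_passes fun t ht => (hs t ht).2
  have hprim := sum_blockDeficit_of_passes fun t ht => (hs t ht).1
  have hload := load_fallbackRoute_le _ _ _ _ _ _ hM (Nat.mul_pos hC hρ) hρ hp hprim hfall
  set Φ : ℝ≥0 := h + 4 * (10 * h : ℕ) * (p : ℝ≥0)⁻¹ with hΦ
  let Q := fallbackRoute s (windowCount N h₀ K h) h (C * hopRoot N h) (hopRoot N h) (10 * h)
    (pos_of_le_blockCount hρ hfall) Φ fun u => by exact_mod_cast hload u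
  refine ⟨Q.routing, Q.isObliviousRouting ?_, Q.guaranteesThroughput ?_,
    Q.maxLatency_routing_le.trans (le_of_eq ?_)⟩
  · have := Nat.mul_pos (show 0 < 10 * h by omega) hρ
    omega
  · have h1 : (2 * (Φ : ℝ≥0∞)) = ENNReal.ofReal (2 * (h * (1 + 40 / p))) := by
      have : (2 * (h * (1 + 40 / p)) : ℝ) = ((2 * Φ : ℝ≥0) : ℝ) := by
        rw [hΦ]
        push_cast
        ring
      rw [this, ENNReal.ofReal_coe_nnreal]
      push_cast
      rfl
    rcases le_or_gt r 0 with h0 | h0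
    · rw [ENNReal.ofReal_of_nonpos h0, zero_mul]
      exact zero_le_one
    · rw [h1, ← ENNReal.ofReal_mul h0.le, ← ENNReal.ofReal_one]
      exact ENNReal.ofReal_le_ofReal hr
  · congr 1
    ring

/-- Nonpositive throughput admits no demand except zero, so any load is allowed. The route has no
primary part (M = 0) and sends everything by the fallback in blocks of length 2; its window has
length 4k. With Φ = ⊤ the load condition reads 0 · ⊤ ≤ 1. -/
theorem exists_routing_of_connected {k : ℕ} (hk : 0 < k)
    (hs : ∀ t < s.period, Passes s t 2 k 1 (2 * N)) {r : ℝ} (hr : r ≤ 0) :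
    ∃ R : PathFlow (ZMod N), IsObliviousRouting s.toConnectionSchedule R ∧
      GuaranteesThroughput s.toConnectionSchedule R r ∧ maxLatency R ≤ (8 * k : ℕ) := by
  have hfall := le_blockCount_of_passes hs
  let Q := fallbackRoute s 0 0 0 2 k (pos_of_le_blockCount (by norm_num) hfall) ⊤ fun _ => le_top
  refine ⟨Q.routing, Q.isObliviousRouting (by omega), Q.guaranteesThroughput ?_,
    Q.maxLatency_routing_le.trans (le_of_eq ?_)⟩
  · rw [ENNReal.ofReal_of_nonpos hr, zero_mul]
    exact zero_le_one
  · congr 1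
    ring

theorem natCast_le_ofReal {m : ℕ} {x : ℝ} (h : (m : ℝ) ≤ x) : (m : ℝ≥0∞) ≤ ENNReal.ofReal x := by
  rw [← ENNReal.ofReal_natCast]
  exact ENNReal.ofReal_le_ofReal h

theorem two_mul_latency_le {M C h : ℕ} (hN : 2 ≤ N) (hh : 1 ≤ h) :
    ((2 * (h * hopRoot N h * (M * C + 20)) : ℕ) : ℝ) ≤ 8 * (M * C + 20) * Lstar h N := by
  have h1 := hopRoot_le_rpow hN hh
  rw [Lstar]
  push_cast
  calc (2 * (h * hopRoot N h * (M * C + 20)) : ℝ)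
      = 2 * h * (M * C + 20) * hopRoot N h := by ring
    _ ≤ 2 * h * (M * C + 20) * (4 * (N : ℝ) ^ (1 / (h : ℝ))) := by gcongr
    _ = _ := by ring

theorem Lstar_nonneg (h N : ℕ) : 0 ≤ Lstar h N := by
  rw [Lstar]
  positivity

theorem supportsAllHopCounts_mul {h₀ p C K : ℕ} {ε : ℝ} (hp : 0 < p) (hC : 0 < C) (hK : 0 < K)
    (hε : (1 - ε) * (1 + 40 / p) ≤ 1) (hs : Certified s h₀ p C K) :
    SupportsAllHopCounts s (fun h => 1 / (2 * (h : ℝ)) * (1 - ε))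
      (fun h => (8 * ((2 + 3 * K) * C + 40)) * (Lstar h N * Real.log N)) := by
  intro h hh h2
  obtain ⟨hN, hn⟩ := two_le_of_hops hh h2
  have hh0 : (0 : ℝ) < h := by exact_mod_cast hh
  have hl : Real.log 2 ≤ Real.log N := Real.log_le_log (by norm_num) (by exact_mod_cast hN)
  have hl2 := Real.log_two_gt_d9
  have hM : 0 < windowCount N h₀ K h := by
    rw [windowCount]
    split_ifs
    · norm_num
    · exact Nat.mul_pos hK (one_le_clog hN)
  have hM' : (windowCount N h₀ K h : ℝ) ≤ (2 + 3 * K) * Real.log N := by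
    have hc := clog_le_log hN
    have hK' : (0 : ℝ) ≤ K := by positivity
    rw [windowCount]
    split_ifs
    · push_cast
      nlinarith [mul_nonneg hK' (show 0 ≤ Real.log N by linarith)]
    · push_cast
      nlinarith [mul_le_mul_of_nonneg_left hc hK']
  obtain ⟨R, h3, h4, h5⟩ := exists_routing_of_hopCountOK hh hp hC hM
    (fun t ht => (hs t ht).2 h hh hn) (r := 1 / (2 * (h : ℝ)) * (1 - ε)) (by
      refine le_trans (le_of_eq ?_) hε
      field_simp)
  refine ⟨R, h3, h4, h5.trans (natCast_le_ofReal ((two_mul_latency_le hN hh).trans ?_))⟩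
  have hL := Lstar_nonneg h N
  calc 8 * ((windowCount N h₀ K h : ℝ) * C + 20) * Lstar h N
      ≤ 8 * ((2 + 3 * K) * Real.log N * C + 40 * Real.log N) * Lstar h N := by
        gcongr
        linarith
    _ = _ := by ring

theorem log_le_Lstar {h : ℕ} (hh : 1 ≤ h) : Real.log N ≤ Lstar h N := by
  have hh0 : (0 : ℝ) < h := by exact_mod_cast hh
  have hN : (0 : ℝ) < N := by exact_mod_cast NeZero.pos N
  have h1 : Real.log N = h * Real.log ((N : ℝ) ^ (1 / (h : ℝ))) := by
    rw [Real.log_rpow hN]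
    field_simp
  rw [h1, Lstar]
  gcongr
  exact Real.log_le_self (by positivity)

/-- For h ≤ h₀ there is no waiting among windows, so no logarithm is lost. For h > h₀ ≥ 1/(2ε) the
required throughput is not positive, and connectivity within 80⌈log₂ N⌉ ≤ 240 log N ≤ 240 L*(h, N)
steps is enough. -/
theorem supportsAllHopCounts_sub {h₀ p C K : ℕ} {ε : ℝ} (hp : 0 < p) (hC : 0 < C) (hε0 : 0 < ε)
    (hε : (1 - ε) * (1 + 40 / p) ≤ 1) (hh₀ : 1 / (2 * ε) ≤ h₀) (hs : Certified s h₀ p C K) :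
    SupportsAllHopCounts s (fun h => 1 / (2 * (h : ℝ)) - ε)
      (fun h => (8 * (C + 20) + 240) * Lstar h N) := by
  intro h hh h2
  obtain ⟨hN, hn⟩ := two_le_of_hops hh h2
  have hh0 : (0 : ℝ) < h := by exact_mod_cast hh
  have hh1 : (1 : ℝ) ≤ h := by exact_mod_cast hh
  have hL := Lstar_nonneg h N
  rcases le_or_gt h h₀ with hle | hlt
  · have hM : windowCount N h₀ K h = 1 := if_pos hle
    obtain ⟨R, h3, h4, h5⟩ := exists_routing_of_hopCountOK hh hp hC (hM ▸ Nat.one_pos)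
      (fun t ht => (hs t ht).2 h hh hn) (r := 1 / (2 * (h : ℝ)) - ε) (by
        refine le_trans ?_ hε
        have : (1 / (2 * (h : ℝ)) - ε) * (2 * (h * (1 + 40 / p))) =
            (1 - 2 * h * ε) * (1 + 40 / p) := by
          -- The subtracted `ε` is worth the relative error 2hε, which is at least ε.
          field_simp
        rw [this]
        gcongr
        nlinarith)
    refine ⟨R, h3, h4, h5.trans (natCast_le_ofReal ((two_mul_latency_le hN hh).trans ?_))⟩
    rw [hM]
    push_cast
    nlinarith
  · obtain ⟨R, h3, h4, h5⟩ := exists_routing_of_connected (k := 10 * Nat.clog 2 N)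
      (by have := one_le_clog hN; omega) (fun t ht => (hs t ht).1)
      (r := 1 / (2 * (h : ℝ)) - ε) (by
        have h6 : (h₀ : ℝ) ≤ h := by exact_mod_cast hlt.le
        have h7 := hh₀.trans h6
        rw [div_le_iff₀ (by positivity)] at h7
        rw [sub_nonpos, div_le_iff₀ (by positivity)]
        linarith)
    refine ⟨R, h3, h4, h5.trans (natCast_le_ofReal ?_)⟩
    have hc := clog_le_log hN
    have hl := log_le_Lstar (N := N) hh
    push_cast
    nlinarith [mul_nonneg (Nat.cast_nonneg (α := ℝ) C) hL]

end Soundness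

/-! ## Random schedules are certified -/

section Acceptance

theorem le_hopRoot_pow (N : ℕ) {h : ℕ} (hh : 0 < h) : N ≤ hopRoot N h ^ h := by
  refine (Nat.le_pow_clog (b := 2) (by norm_num) N).trans ?_
  rw [hopRoot, ← pow_mul]
  refine Nat.pow_le_pow_right (by norm_num) ?_
  rw [mul_comm]
  exact (ceilDiv_le_iff_le_mul hh).1 le_rfl

theorem rpow_le_hopRoot (N : ℕ) {h h₀ : ℕ} [NeZero N] (hh : 0 < h) (hle : h ≤ h₀) :
    (N : ℝ) ^ (1 / (h₀ : ℝ)) ≤ hopRoot N h := by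
  have hh0 : (0 : ℝ) < h := by exact_mod_cast hh
  have hN : (1 : ℝ) ≤ N := by exact_mod_cast NeZero.pos N
  have h1 : (N : ℝ) ≤ (hopRoot N h : ℝ) ^ h := by exact_mod_cast le_hopRoot_pow N hh
  calc (N : ℝ) ^ (1 / (h₀ : ℝ)) ≤ (N : ℝ) ^ (1 / (h : ℝ)) := by
        refine Real.rpow_le_rpow_of_exponent_le hN ?_
        gcongr
    _ ≤ ((hopRoot N h : ℝ) ^ h) ^ (1 / (h : ℝ)) := by gcongr
    _ = hopRoot N h := by
        rw [one_div, Real.pow_rpow_inv_natCast (by positivity) hh.ne']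

variable {N T : ℕ} [NeZero N]

/-- The failure probability 4N³ / b^h is made smaller than the union bound requires by having at
least N^10 sequences; this is why the fallback takes ten times as many hops. -/
theorem prob_fallback_not_passes (hT : 0 < T) (t : ℕ) {b h : ℕ} (hb : 0 < b) (hhb : h * b ≤ T)
    (hN : 4 ≤ N) (hbh : N ^ 10 ≤ b ^ h) :
    prob (fun w : Fin T → ZMod N => ¬ Passes (ShiftSchedule.ofFn hT w) t b h 1 (2 * N)) ≤
      1 / (N : ℝ) ^ 6 := by
  have h1 : ∀ w : Fin T → ZMod N, ¬ Passes (ShiftSchedule.ofFn hT w) t b h 1 (2 * N) →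
      N * b ^ h < 2 * N * blockDeficit (ShiftSchedule.ofFn hT w).shiftAt t b h := by
    intro w hw
    simpa [Passes] using hw
  have hN' : (4 : ℝ) ≤ N := by exact_mod_cast hN
  have hbh' : (N : ℝ) ^ 10 ≤ (b : ℝ) ^ h := by exact_mod_cast hbh
  refine (prob_mono h1).trans ((prob_fallback_fails hT t hb hhb).trans ?_)
  calc 4 * (N : ℝ) ^ 3 / (b : ℝ) ^ h ≤ N * (N : ℝ) ^ 3 / (N : ℝ) ^ 10 := by gcongr
    _ = 1 / (N : ℝ) ^ 6 := by
        field_simp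

/-- The constants serve to reach the exponent 6 log N. The factor 4p² in the block length gives the
4p² N sequences needed for the mean. For h ≤ h₀ the single-window exponent is ρ/(16h²), with ρ the
rounded root, and `hlog` provides ρ ≥ 96 h² log N; otherwise 96p²⌈log₂ N⌉ windows give the exponent
6⌈log₂ N⌉. -/
theorem prob_windowCount_not_passes (hT : 0 < T) (t : ℕ) {h h₀ p : ℕ} (hh : 0 < h) (hp : 0 < p)
    (hN : 2 ≤ N) (hlog : 96 * (h₀ : ℝ) ^ 2 * Real.log N ≤ (N : ℝ) ^ (1 / (h₀ : ℝ)))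
    (hT' : windowCount N h₀ (96 * p ^ 2) h * (h * (4 * p ^ 2 * hopRoot N h)) ≤ T) :
    prob (fun w : Fin T → ZMod N => ¬ Passes (ShiftSchedule.ofFn hT w) t (4 * p ^ 2 * hopRoot N h) h
      (windowCount N h₀ (96 * p ^ 2) h) p) ≤ 1 / (N : ℝ) ^ 6 := by
  have hρ : 0 < hopRoot N h := pow_pos (by norm_num) _
  have hl : 0 < 4 * p ^ 2 * hopRoot N h := by positivity
  have hB : 4 * p ^ 2 * N ≤ (4 * p ^ 2 * hopRoot N h) ^ h := by
    rw [mul_pow]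
    refine Nat.mul_le_mul ?_ (le_hopRoot_pow N hh)
    exact Nat.le_self_pow hh.ne' _
  have hN0 : (0 : ℝ) < N := by positivity
  have hexp : Real.exp (-(6 * Real.log N)) = 1 / (N : ℝ) ^ 6 := by
    rw [Real.exp_neg, show 6 * Real.log N = ((6 : ℕ) : ℝ) * Real.log N by norm_num,
      Real.exp_nat_mul, Real.exp_log hN0, one_div]
  have hp0 : (0 : ℝ) < p := by exact_mod_cast hp
  have hh0 : (0 : ℝ) < h := by exact_mod_cast hh
  rw [← hexp]
  rcases le_or_gt h h₀ with hle | hlt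
  · have hM : windowCount N h₀ (96 * p ^ 2) h = 1 := if_pos hle
    rw [hM, one_mul] at hT'
    have h1 : ∀ w : Fin T → ZMod N, ¬ Passes (ShiftSchedule.ofFn hT w) t
        (4 * p ^ 2 * hopRoot N h) h (windowCount N h₀ (96 * p ^ 2) h) p →
        N * (4 * p ^ 2 * hopRoot N h) ^ h <
        p * blockDeficit (ShiftSchedule.ofFn hT w).shiftAt t (4 * p ^ 2 * hopRoot N h) h := by
      intro w hw
      rw [hM] at hw
      simpa [Passes] using hw
    refine (prob_mono h1).trans ((prob_single_window_fails hT t hh hl hT' hp hB).trans ?_)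
    refine Real.exp_le_exp.2 (neg_le_neg ?_)
    have h2 := rpow_le_hopRoot N hh hle
    have hle' : (h : ℝ) ≤ h₀ := by exact_mod_cast hle
    have hlogN : 0 ≤ Real.log N := Real.log_natCast_nonneg N
    rw [le_div_iff₀ (by positivity)]
    push_cast
    calc 6 * Real.log N * (64 * p ^ 2 * h ^ 2) = 4 * p ^ 2 * (96 * h ^ 2 * Real.log N) := by ring
      _ ≤ 4 * p ^ 2 * (96 * h₀ ^ 2 * Real.log N) := by gcongr
      _ ≤ 4 * p ^ 2 * hopRoot N h := by
          gcongr
          exact hlog.trans h2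
  · have hM : windowCount N h₀ (96 * p ^ 2) h = 96 * p ^ 2 * Nat.clog 2 N := if_neg (by omega)
    have hM0 : 0 < windowCount N h₀ (96 * p ^ 2) h := by
      rw [hM]
      have := one_le_clog hN
      positivity
    have h1 : ∀ w : Fin T → ZMod N, ¬ Passes (ShiftSchedule.ofFn hT w) t
        (4 * p ^ 2 * hopRoot N h) h (windowCount N h₀ (96 * p ^ 2) h) p →
        windowCount N h₀ (96 * p ^ 2) h * (N * (4 * p ^ 2 * hopRoot N h) ^ h) <
        p * ∑ i : Fin (windowCount N h₀ (96 * p ^ 2) h),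
          blockDeficit (ShiftSchedule.ofFn hT w).shiftAt
            ((t : ℤ) + (i * (h * (4 * p ^ 2 * hopRoot N h)) : ℕ)) (4 * p ^ 2 * hopRoot N h) h := by
      intro w hw
      rw [Passes, Finset.sum_range] at hw
      exact not_le.1 hw
    refine (prob_mono h1).trans ((prob_windows_fail hT t hM0 hl hT' hp hB).trans ?_)
    refine Real.exp_le_exp.2 (neg_le_neg ?_)
    rw [hM, le_div_iff₀ (by positivity)]
    push_cast
    have h3 : Real.log N ≤ Nat.clog 2 N := by
      rw [Real.log_le_iff_le_exp hN0]
      have h4 : (N : ℝ) ≤ 2 ^ Nat.clog 2 N := by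
        exact_mod_cast Nat.le_pow_clog (b := 2) (by norm_num) N
      refine h4.trans ?_
      rw [← Real.exp_one_pow]
      gcongr
      have := Real.exp_one_gt_d9
      linarith
    calc 6 * Real.log N * (16 * p ^ 2) = 96 * p ^ 2 * Real.log N := by ring
      _ ≤ _ := by gcongr

/-- A union bound over N⁴ times and at most N hop counts, with at most 1 + 2N tests per time that
each fail with probability at most N⁻⁶: the total is at most 3/N. The period N⁴ is long enough for
all tested stretches, the longest having at most 768 p⁴ N³ slots. -/
theorem prob_not_certified_le {h₀ p : ℕ} (hT : 0 < N ^ 4) (hp : 0 < p) (hN : 20 ≤ N)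
    (hNp : 768 * p ^ 4 ≤ N)
    (hlog : 96 * (h₀ : ℝ) ^ 2 * Real.log N ≤ (N : ℝ) ^ (1 / (h₀ : ℝ))) :
    prob (fun w : Fin (N ^ 4) → ZMod N =>
      ¬ Certified (ShiftSchedule.ofFn hT w) h₀ p (4 * p ^ 2) (96 * p ^ 2)) ≤ 1 / 2 := by
  have hN2 : 2 ≤ N := by omega
  have hclog := clog_le_self N
  have hNc := Nat.le_pow_clog (b := 2) (by norm_num) N
  have hN0 : (20 : ℝ) ≤ N := by exact_mod_cast hN
  have hconn : ∀ t : ℕ, prob (fun w : Fin (N ^ 4) → ZMod N =>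
      ¬ Passes (ShiftSchedule.ofFn hT w) t 2 (10 * Nat.clog 2 N) 1 (2 * N)) ≤
      1 / (N : ℝ) ^ 6 := by
    intro t
    refine prob_fallback_not_passes hT t (by norm_num) ?_ (by omega) ?_
    · calc 10 * Nat.clog 2 N * 2 ≤ 20 * N := by omega
        _ ≤ N * N := Nat.mul_le_mul_right _ hN
        _ = N ^ 2 := by ring
        _ ≤ N ^ 4 := Nat.pow_le_pow_right (by omega) (by norm_num)
    · rw [mul_comm, pow_mul]
      exact Nat.pow_le_pow_left hNc 10
  have hfall : ∀ t h : ℕ, h ∈ Finset.Icc 1 (Nat.clog 2 N) →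
      prob (fun w : Fin (N ^ 4) → ZMod N =>
        ¬ Passes (ShiftSchedule.ofFn hT w) t (hopRoot N h) (10 * h) 1 (2 * N)) ≤
        1 / (N : ℝ) ^ 6 := by
    intro t h hh
    obtain ⟨hh1, hh2⟩ := Finset.mem_Icc.1 hh
    refine prob_fallback_not_passes hT t (pow_pos (by norm_num) _) ?_ (by omega) ?_
    · calc 10 * h * hopRoot N h ≤ 10 * N * (2 * N) :=
            Nat.mul_le_mul (by omega) (hopRoot_le N hh1)
        _ = 20 * N ^ 2 := by ring
        _ ≤ N * N ^ 2 := Nat.mul_le_mul_right _ hN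
        _ = N ^ 3 := by ring
        _ ≤ N ^ 4 := Nat.pow_le_pow_right (by omega) (by norm_num)
    · rw [mul_comm, pow_mul]
      exact Nat.pow_le_pow_left (le_hopRoot_pow N hh1) 10
  have hprim : ∀ t h : ℕ, h ∈ Finset.Icc 1 (Nat.clog 2 N) →
      prob (fun w : Fin (N ^ 4) → ZMod N =>
        ¬ Passes (ShiftSchedule.ofFn hT w) t (4 * p ^ 2 * hopRoot N h) h
          (windowCount N h₀ (96 * p ^ 2) h) p) ≤ 1 / (N : ℝ) ^ 6 := by
    intro t h hh
    obtain ⟨hh1, hh2⟩ := Finset.mem_Icc.1 hh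
    refine prob_windowCount_not_passes hT t hh1 hp hN2 hlog ?_
    have hM : windowCount N h₀ (96 * p ^ 2) h ≤ 96 * p ^ 2 * N := by
      rw [windowCount]
      split_ifs
      · exact Nat.one_le_iff_ne_zero.2 (by positivity)
      · exact Nat.mul_le_mul_left _ hclog
    calc windowCount N h₀ (96 * p ^ 2) h * (h * (4 * p ^ 2 * hopRoot N h))
        ≤ 96 * p ^ 2 * N * (N * (4 * p ^ 2 * (2 * N))) := by
          gcongr
          · omega
          · exact hopRoot_le N hh1
      _ = 768 * p ^ 4 * N ^ 3 := by ring
      _ ≤ N * N ^ 3 := Nat.mul_le_mul_right _ hNp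
      _ = N ^ 4 := by ring
  have hhop : ∀ t h : ℕ, h ∈ Finset.Icc 1 (Nat.clog 2 N) →
      prob (fun w : Fin (N ^ 4) → ZMod N => ¬ HopCountOK (ShiftSchedule.ofFn hT w) h₀ p
        (4 * p ^ 2) (96 * p ^ 2) t h) ≤ 2 / (N : ℝ) ^ 6 := by
    intro t h hh
    simp only [HopCountOK, not_and_or]
    refine (prob_or_le _ _).trans ((add_le_add (hprim t h hh) (hfall t h hh)).trans (le_of_eq ?_))
    ring
  have htime : ∀ t ∈ Finset.range (N ^ 4), prob (fun w : Fin (N ^ 4) → ZMod N =>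
      ¬ Passes (ShiftSchedule.ofFn hT w) t 2 (10 * Nat.clog 2 N) 1 (2 * N) ∨
      ∃ h ∈ Finset.Icc 1 (Nat.clog 2 N), ¬ HopCountOK (ShiftSchedule.ofFn hT w) h₀ p
        (4 * p ^ 2) (96 * p ^ 2) t h) ≤ 3 / (N : ℝ) ^ 5 := by
    intro t _
    refine (prob_or_le _ _).trans ((add_le_add (hconn t)
      (prob_exists_le_card_mul _ _ (hhop t))).trans ?_)
    have hc : (Nat.clog 2 N : ℝ) ≤ N := by exact_mod_cast hclog
    calc 1 / (N : ℝ) ^ 6 + ((Finset.Icc 1 (Nat.clog 2 N)).card : ℝ) * (2 / (N : ℝ) ^ 6)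
        ≤ N / (N : ℝ) ^ 6 + N * (2 / (N : ℝ) ^ 6) := by
          rw [Nat.card_Icc, Nat.add_sub_cancel]
          gcongr
          linarith
      _ = 3 / (N : ℝ) ^ 5 := by
          field_simp
          norm_num
  refine (prob_mono (F := fun w : Fin (N ^ 4) → ZMod N => ∃ t ∈ Finset.range (N ^ 4),
      ¬ Passes (ShiftSchedule.ofFn hT w) t 2 (10 * Nat.clog 2 N) 1 (2 * N) ∨
      ∃ h ∈ Finset.Icc 1 (Nat.clog 2 N), ¬ HopCountOK (ShiftSchedule.ofFn hT w) h₀ p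
        (4 * p ^ 2) (96 * p ^ 2) t h) ?_).trans ((prob_exists_le_card_mul _ _ htime).trans ?_)
  · intro w hw
    by_contra hcon
    refine hw fun t ht => ?_
    by_contra h1
    refine hcon ⟨t, Finset.mem_range.2 ht, ?_⟩
    rw [not_and_or] at h1
    refine h1.imp_right fun h2 => ?_
    push Not at h2
    obtain ⟨h, h3, h4, h5⟩ := h2
    exact ⟨h, Finset.mem_Icc.2 ⟨h3, h4⟩, h5⟩
  · rw [Finset.card_range]
    push_cast
    have : (N : ℝ) ^ 4 * (3 / (N : ℝ) ^ 5) = 3 / N := by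
      field_simp
    rw [this, div_le_div_iff₀ (by positivity) (by norm_num)]
    linarith

theorem exists_threshold (h₀ p : ℕ) : ∃ N₀ : ℕ, 20 ≤ N₀ ∧ 768 * p ^ 4 ≤ N₀ ∧ ∀ N : ℕ, N₀ ≤ N →
    96 * (h₀ : ℝ) ^ 2 * Real.log N ≤ (N : ℝ) ^ (1 / (h₀ : ℝ)) := by
  rcases Nat.eq_zero_or_pos h₀ with rfl | hh
  · exact ⟨20 + 768 * p ^ 4, by omega, by omega, fun N _ => by simp⟩
  have hh0 : (0 : ℝ) < h₀ := by exact_mod_cast hh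
  have h1 := (isLittleO_log_rpow_atTop (r := 1 / (h₀ : ℝ)) (by positivity)).bound
    (show (0 : ℝ) < 1 / (96 * (h₀ : ℝ) ^ 2) by positivity)
  obtain ⟨N₀, hN₀⟩ := Filter.eventually_atTop.1 (tendsto_natCast_atTop_atTop.eventually h1)
  refine ⟨N₀ + 20 + 768 * p ^ 4, by omega, by omega, fun N hN => ?_⟩
  have h2 := hN₀ N (by omega)
  rw [Real.norm_of_nonneg (Real.log_natCast_nonneg N), Real.norm_of_nonneg (by positivity),
    div_mul_eq_mul_div, one_mul, le_div_iff₀ (by positivity)] at h2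
  linarith

end Acceptance

/-! ## The randomized algorithms -/

section Randomized

/-- A program that does not change the input. -/
def keepInput : Prog := .const 5 0

/-- The random input already lies in memory in the output format, so sampling needs no work. -/
theorem computesWithin_keepInput {N T : ℕ} [NeZero N] (hT : 0 < T) (w : Fin T → ZMod N) {B : ℕ}
    (hB : 1 ≤ B) : ComputesWithin keepInput w (ShiftSchedule.ofFn hT w) B := by
  refine ⟨_, 1, Exec.const _ _ _, hB, ?_, fun i => ?_⟩
  · simp [inputState, ShiftSchedule.ofFn, ShiftSchedule.ofPrefix]
  · have hi : (i : ℕ) < T := i.2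
    simp only [MachineState.arr_setReg, inputState, hi, and_self, dite_true]
    rfl

theorem samplesAndCertifies_certifier (h₀ : ℕ) {p : ℕ} (hp : 0 < p) :
    ∃ (q : Polynomial ℕ) (N₀ : ℕ), ∀ (N : ℕ) [NeZero N], N₀ ≤ N → ∀ hT : 0 < N ^ 4,
      SamplesAndCertifies keepInput (certifier h₀ p (4 * p ^ 2) (96 * p ^ 2)) q
        (fun w : Fin (N ^ 4) → ZMod N => ShiftSchedule.ofFn hT w)
        (fun s => Certified s h₀ p (4 * p ^ 2) (96 * p ^ 2)) := by
  obtain ⟨q, hq⟩ := isPolynomial_certifierTime p (4 * p ^ 2) (96 * p ^ 2)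
  obtain ⟨N₀, h20, hNp, hlog⟩ := exists_threshold h₀ p
  refine ⟨q, N₀, fun N _ hN hT => ⟨fun w => ?_, fun s => ?_, fun s => ?_, ?_⟩⟩
  · refine computesWithin_keepInput hT w ?_
    rw [hq]
    beta_reduce
    rw [certifierTime]
    omega
  · obtain ⟨st, n, h1, h2⟩ := haltsWithin_certifier s h₀ p (4 * p ^ 2) (96 * p ^ 2)
    refine ⟨st, n, h1, h2.trans ?_⟩
    rw [hq]
    exact certifierTime_mono (Nat.le_add_right _ _) (Nat.le_add_left _ _) _ _ _
  · exact (accepts_certifier_iff s _ _ _ _).1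
  · refine half_le_unifProb _ ?_
    simp only [Set.mem_ofPred_eq, accepts_certifier_iff]
    exact prob_not_certified_le hT hp (h20.trans hN) (hNp.trans hN) (hlog N hN)

theorem SamplesAndCertifies.imp {N m : ℕ} [NeZero N] {G V : Prog} {q : Polynomial ℕ}
    {S : (Fin m → ZMod N) → ShiftSchedule N} {good good' : ShiftSchedule N → Prop}
    (h : SamplesAndCertifies G V q S good) (hg : ∀ s, good s → good' s) :
    SamplesAndCertifies G V q S good' :=
  ⟨h.1, h.2.1, fun s hs => hg s (h.2.2.1 s hs), h.2.2.2⟩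

theorem ShiftSchedule.eq_of_shift_eq {N : ℕ} {s s' : ShiftSchedule N} (h : s.period = s'.period)
    (hs : ∀ i, s.shift i = s'.shift (Fin.cast h i)) : s = s' := by
  obtain ⟨T, hT, w⟩ := s
  obtain ⟨T', hT', w'⟩ := s'
  obtain rfl : T = T' := h
  have : w = w' := funext hs
  rw [this]

theorem ShiftSchedule.convPow_one {N : ℕ} (S : ShiftSchedule N) : S.convPow 1 = S := by
  refine ShiftSchedule.eq_of_shift_eq (pow_one _) fun i => ?_
  have hi : (i : ℕ) < S.period := i.2.trans_eq (pow_one _)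
  simp only [ShiftSchedule.convPow, Finset.univ_unique, Fin.default_eq_zero, Fin.isValue,
    Fin.val_zero, pow_zero, Nat.div_one, Finset.sum_singleton]
  congr 1
  exact Fin.ext (Nat.mod_eq_of_lt hi)

theorem exists_slack {ε : ℝ} (hε : 0 < ε) : ∃ p : ℕ, 0 < p ∧ (1 - ε) * (1 + 40 / p) ≤ 1 := by
  obtain ⟨p, hp⟩ := exists_nat_gt (40 / ε)
  have hp0 : (0 : ℝ) < p := lt_trans (by positivity) hp
  refine ⟨p, by exact_mod_cast hp0, ?_⟩
  rw [div_lt_iff₀ hε] at hp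
  have h1 : 40 / (p : ℝ) ≤ ε := by
    rw [div_le_iff₀ hp0]
    linarith
  have h2 : 0 < 40 / (p : ℝ) := by positivity
  nlinarith

theorem exists_randomized_mul {ε : ℝ} (hε : 0 < ε) :
    ∃ (G V : Prog) (q : Polynomial ℕ) (k : ℕ) (C : ℝ) (N₀ : ℕ), ∀ (N : ℕ) [NeZero N], N₀ ≤ N →
      ∃ (T : ℕ) (hT : 0 < T) (hm : T ≤ N ^ k),
        SamplesAndCertifies G V q
          (fun w : Fin (N ^ k) → ZMod N => ShiftSchedule.ofPrefix w T hT hm)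
          (fun s => SupportsAllHopCounts s
            (fun h => 1 / (2 * (h : ℝ)) * (1 - ε))
            (fun h => C * (Lstar h N * Real.log N))) := by
  obtain ⟨p, hp, hεp⟩ := exists_slack hε
  -- The choice h₀ = 0 makes every hop count average over many windows, so the relative error is
  -- controlled uniformly in h.
  obtain ⟨q, N₀, H⟩ := samplesAndCertifies_certifier 0 hp
  exact ⟨_, _, q, 4, _, N₀, fun N _ hN => ⟨N ^ 4, pow_pos (NeZero.pos N) 4, le_rfl,
    (H N hN (pow_pos (NeZero.pos N) 4)).imp fun s hs =>
      supportsAllHopCounts_mul hp (by positivity) (by positivity) hεp hs⟩⟩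

theorem exists_randomized_sub {ε : ℝ} (hε : 0 < ε) :
    ∃ (G V : Prog) (q : Polynomial ℕ) (k H : ℕ) (C : ℝ) (N₀ : ℕ), 0 < H ∧
      ∀ (N : ℕ) [NeZero N], N₀ ≤ N →
      ∃ (L : ℕ) (hL : 0 < L) (hm : L ≤ N ^ k),
        SamplesAndCertifies G V q
          (fun w : Fin (N ^ k) → ZMod N => (ShiftSchedule.ofPrefix w L hL hm).convPow H)
          (fun s => SupportsAllHopCounts s
            (fun h => 1 / (2 * (h : ℝ)) - ε)
            (fun h => C * Lstar h N)) := by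
  obtain ⟨p, hp, hεp⟩ := exists_slack hε
  obtain ⟨h₀, hh₀⟩ := exists_nat_ge (1 / (2 * ε))
  obtain ⟨q, N₀, H⟩ := samplesAndCertifies_certifier h₀ hp
  refine ⟨keepInput, certifier h₀ p (4 * p ^ 2) (96 * p ^ 2), q, 4, 1,
    8 * ((4 * p ^ 2 : ℕ) + 20) + 240, N₀, one_pos, fun N _ hN => ⟨N ^ 4, pow_pos (NeZero.pos N) 4, le_rfl,
    ?_⟩⟩
  simp only [ShiftSchedule.convPow_one]
  exact (H N hN (pow_pos (NeZero.pos N) 4)).imp fun s hs =>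
    supportsAllHopCounts_sub hp (by positivity) hε hεp hh₀ hs

end Randomized

/-! ## A deterministic schedule for powers of two -/

section BitRotation

/-- The number that is obtained from the lowest `n` bits of `m` by rotating them by `r` places. -/
def bitRotate (n r m : ℕ) : ℕ := ∑ k ∈ Finset.range n, m / 2 ^ k % 2 * 2 ^ ((r + k) % n)

theorem sum_bits_lt {n : ℕ} (f : ℕ → ℕ) (hf : ∀ k, f k < 2) :
    ∑ k ∈ Finset.range n, f k * 2 ^ k < 2 ^ n := by
  rw [Finset.sum_range]
  exact (finFunctionFinEquiv (fun k : Fin n => (⟨f k, hf k⟩ : Fin 2))).2.trans_eq' (by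
    rw [finFunctionFinEquiv_apply])

theorem bitRotate_zero {n m : ℕ} (hm : m < 2 ^ n) : bitRotate n 0 m = m := by
  have h := congrArg Fin.val ((finFunctionFinEquiv (m := 2) (n := n)).apply_symm_apply ⟨m, hm⟩)
  rw [finFunctionFinEquiv_apply] at h
  rw [bitRotate, Finset.sum_range]
  refine Eq.trans (Finset.sum_congr rfl fun k _ => ?_) h
  rw [zero_add, Nat.mod_eq_of_lt k.2]
  rfl

/-- Addition of `r` permutes the residues modulo `n`. -/
theorem sum_range_add_mod {M : Type*} [AddCommMonoid M] {n : ℕ} (r : ℕ) (f : ℕ → M) :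
    ∑ k ∈ Finset.range n, f ((r + k) % n) = ∑ k ∈ Finset.range n, f k := by
  rcases Nat.eq_zero_or_pos n with rfl | hn
  · simp
  have : NeZero n := ⟨hn.ne'⟩
  rw [Finset.sum_range, Finset.sum_range]
  refine Eq.trans (Finset.sum_congr rfl fun k _ => ?_)
    (Equiv.sum_comp (Equiv.addLeft (Fin.ofNat n r)) fun k : Fin n => f k)
  simp [Fin.val_add]

theorem exists_add_mod_eq {n : ℕ} (r : ℕ) {v : ℕ} (hv : v < n) : ∃ k < n, (r + k) % n = v := by
  refine ⟨(v + (n - r % n)) % n, Nat.mod_lt _ (by omega), ?_⟩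
  have h1 : r % n < n := Nat.mod_lt _ (by omega)
  have h2 := Nat.mod_add_div r n
  have : r + (v + (n - r % n)) = v + n * (r / n + 1) := by
    rw [mul_add]
    omega
  rw [Nat.add_mod_mod, this, Nat.add_mul_mod_self_left, Nat.mod_eq_of_lt hv]

theorem add_mod_inj {n r k k' : ℕ} (hk : k < n) (hk' : k' < n)
    (h : (r + k) % n = (r + k') % n) : k = k' := by
  have : r + k ≡ r + k' [MOD n] := h
  have := Nat.ModEq.add_left_cancel' r this
  exact Nat.ModEq.eq_of_lt_of_lt this hk hk'

theorem bitRotate_lt {n : ℕ} (r m : ℕ) : bitRotate n r m < 2 ^ n := by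
  rcases Nat.eq_zero_or_pos n with rfl | hn
  · simp [bitRotate]
  have : bitRotate n r m ≤ ∑ k ∈ Finset.range n, 1 * 2 ^ ((r + k) % n) := by
    refine Finset.sum_le_sum fun k _ => Nat.mul_le_mul_right _ ?_
    have := Nat.mod_lt (m / 2 ^ k) (show 2 > 0 by norm_num)
    omega
  refine this.trans_lt ?_
  rw [sum_range_add_mod r (fun k => 1 * 2 ^ k)]
  exact sum_bits_lt (fun _ => 1) fun _ => by norm_num

/-- One more rotation doubles every place value except the top one, which wraps to 1. The test by
truncated subtraction detects whether the top bit is set, as the program does. -/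
theorem bitRotate_succ {n : ℕ} (hn : 0 < n) (r m : ℕ) : bitRotate n (r + 1) m =
    if 2 ^ n - 2 * bitRotate n r m = 0 then 2 * bitRotate n r m - 2 ^ n + 1
    else 2 * bitRotate n r m := by
  obtain ⟨k, hk, hkr⟩ := exists_add_mod_eq r (show n - 1 < n by omega)
  have hstep : ∀ j ∈ Finset.range n, j ≠ k → 2 ^ ((r + 1 + j) % n) = 2 * 2 ^ ((r + j) % n) := by
    intro j hj hjk
    have h1 : (r + j) % n < n := Nat.mod_lt _ hn
    have h2 : (r + j) % n ≠ n - 1 := fun h =>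
      hjk (add_mod_inj (Finset.mem_range.1 hj) hk (h.trans hkr.symm))
    rw [add_right_comm, Nat.add_mod, Nat.mod_eq_of_lt (show (r + j) % n + 1 % n < n from ?_)]
    · rcases Nat.lt_or_ge 1 n with h | h
      · rw [Nat.mod_eq_of_lt h, pow_succ, mul_comm]
      · omega
    · have : 1 % n ≤ 1 := Nat.mod_le _ _
      omega
  have hlast : (r + 1 + k) % n = 0 := by
    rw [add_right_comm, Nat.add_mod, hkr]
    rcases Nat.lt_or_ge 1 n with h | h
    · rw [Nat.mod_eq_of_lt h, Nat.sub_add_cancel hn, Nat.mod_self]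
    · obtain rfl : n = 1 := by omega
      rfl
  have hpow : 2 ^ n = 2 * 2 ^ (n - 1) := by
    rw [← pow_succ', Nat.sub_add_cancel hn]
  have h1 : bitRotate n (r + 1) m = m / 2 ^ k % 2 * 1 +
      ∑ j ∈ (Finset.range n).erase k, m / 2 ^ j % 2 * (2 * 2 ^ ((r + j) % n)) := by
    rw [bitRotate, ← Finset.add_sum_erase _ _ (Finset.mem_range.2 hk), hlast, pow_zero]
    congr 1
    refine Finset.sum_congr rfl fun j hj => ?_
    rw [hstep j (Finset.mem_of_mem_erase hj) (Finset.ne_of_mem_erase hj)]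
  have h2 : 2 * bitRotate n r m = m / 2 ^ k % 2 * 2 ^ n +
      ∑ j ∈ (Finset.range n).erase k, m / 2 ^ j % 2 * (2 * 2 ^ ((r + j) % n)) := by
    rw [bitRotate, ← Finset.add_sum_erase _ _ (Finset.mem_range.2 hk), hkr, hpow, mul_add,
      Finset.mul_sum]
    congr 1
    · ring
    · exact Finset.sum_congr rfl fun j _ => by ring
  have h3 := bitRotate_lt (n := n) (r + 1) m
  rcases Nat.mod_two_eq_zero_or_one (m / 2 ^ k) with h | h
  · rw [h] at h1 h2
    rw [if_neg (by omega)]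
    omega
  · rw [h] at h1 h2
    rw [if_pos (by omega)]
    omega

/-- The number of ways to choose `m` bits of which the `q`-th has the value `2 ^ ((r + q) % n)` if
they are to sum to `c`. -/
def bitCount (n r m : ℕ) (c : ZMod (2 ^ n)) : ℕ :=
  (Finset.univ.filter fun x : Fin m → Fin 2 =>
    ∑ q, ((x q : ℕ) : ZMod (2 ^ n)) * 2 ^ ((r + q) % n) = c).card

/-- `n` cyclically consecutive positions are all the binary places, so this is existence and
uniqueness of the binary expansion, up to a permutation of the digits. -/
theorem bitCount_self {n : ℕ} (r : ℕ) (c : ZMod (2 ^ n)) : bitCount n r n c = 1 := by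
  rcases Nat.eq_zero_or_pos n with rfl | hn
  · have : ∀ x : Fin 0 → Fin 2,
        ∑ q, ((x q : ℕ) : ZMod (2 ^ 0)) * 2 ^ ((r + (q : ℕ)) % 0) = c := fun x =>
      Subsingleton.elim (α := ZMod 1) _ _
    simp only [bitCount, this]
    simp
  have : NeZero n := ⟨hn.ne'⟩
  have h2 : NeZero (2 ^ n) := ⟨by positivity⟩
  set e := Equiv.addLeft (Fin.ofNat n r) with he
  have hF : ∀ x : Fin n → Fin 2, ∑ q, ((x q : ℕ) : ZMod (2 ^ n)) * 2 ^ ((r + (q : ℕ)) % n) =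
      ((finFunctionFinEquiv (x ∘ e.symm) : ℕ) : ZMod (2 ^ n)) := by
    intro x
    have h3 := Equiv.sum_comp e fun p => ((x (e.symm p) : ℕ) : ZMod (2 ^ n)) * 2 ^ (p : ℕ)
    rw [finFunctionFinEquiv_apply]
    push_cast
    refine Eq.trans (Finset.sum_congr rfl fun q _ => ?_) h3
    rw [e.symm_apply_apply]
    simp [he, Fin.val_add]
  rw [bitCount, Finset.card_eq_one]
  refine ⟨finFunctionFinEquiv.symm ⟨c.val, c.val_lt⟩ ∘ e, ?_⟩
  ext x
  rw [Finset.mem_filter, Finset.mem_singleton, hF, ← Equiv.comp_symm_eq, Equiv.eq_symm_apply,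
    Fin.ext_iff]
  simp only [Finset.mem_univ, true_and]
  constructor
  · rintro rfl
    exact (ZMod.val_cast_of_lt (Fin.is_lt _)).symm
  · intro h
    rw [h, ZMod.natCast_zmod_val]

theorem bitCount_succ {n : ℕ} (r m : ℕ) (c : ZMod (2 ^ n)) : bitCount n r (m + 1) c =
    bitCount n r m c + bitCount n r m (c - 2 ^ ((r + m) % n)) := by
  have key : ∀ (k : ℕ) (d : ZMod (2 ^ n)), bitCount n r k d = ∑ x : Fin k → Fin 2,
      if ∑ q, ((x q : ℕ) : ZMod (2 ^ n)) * 2 ^ ((r + q) % n) = d then 1 else 0 := by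
    intro k d
    rw [bitCount, Finset.sum_boole, Nat.cast_id]
  rw [key, ← (Fin.snocEquiv fun _ => Fin 2).sum_comp, Fintype.sum_prod_type, Fin.sum_univ_two,
    key, key]
  simp only [Fin.sum_univ_castSucc, Fin.snocEquiv, Equiv.coe_fn_mk, Fin.snoc_castSucc,
    Fin.snoc_last, Fin.val_castSucc, Fin.val_last]
  simp [eq_sub_iff_add_eq]

/-- A further independent bit only averages the uniform distribution with a translate of itself.
This allows h K to exceed `n`, when `h` does not divide `n`. -/
theorem two_pow_mul_bitCount {n m : ℕ} (hm : n ≤ m) (r : ℕ) (c : ZMod (2 ^ n)) :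
    2 ^ n * bitCount n r m c = 2 ^ m := by
  induction m, hm using Nat.le_induction generalizing c with
  | base => rw [bitCount_self, mul_one]
  | succ m _ ih =>
    rw [bitCount_succ, mul_add, ih, ih]
    ring

theorem card_bit_blocks (n r h K : ℕ) (c : ZMod (2 ^ n)) :
    (Finset.univ.filter fun β : Fin h → Fin K → Fin 2 =>
      ∑ j, ∑ k, ((β j k : ℕ) : ZMod (2 ^ n)) * 2 ^ ((r + (j * K + k)) % n) = c).card =
      bitCount n r (h * K) c := by
  let e : (Fin (h * K) → Fin 2) ≃ (Fin h → Fin K → Fin 2) :=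
    (Equiv.arrowCongr finProdFinEquiv.symm (Equiv.refl _)).trans (Equiv.curry _ _ _)
  have he : ∀ x j k, e x j k = x (finProdFinEquiv (j, k)) := fun _ _ _ => rfl
  rw [bitCount, ← Fintype.card_subtype, ← Fintype.card_subtype]
  refine (Fintype.card_congr (e.subtypeEquiv fun x => ?_)).symm
  rw [← finProdFinEquiv.sum_comp, Fintype.sum_prod_type]
  simp only [he, finProdFinEquiv_apply_val, mul_comm K, add_comm _ (_ * K)]

end BitRotation

/-! ### The rotation schedule and its exactly uniform semi-route -/

section RotationSchedule

/-- The schedule whose shifts are the rotations of all numbers with `n` bits. -/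
def rotationSchedule (n : ℕ) : ShiftSchedule (2 ^ n) where
  period := max 1 (2 ^ n * n)
  period_pos := lt_max_of_lt_left one_pos
  shift i := (bitRotate n (i % n) (i / n) : ℕ)

variable {n : ℕ}

theorem period_rotationSchedule (hn : 0 < n) : (rotationSchedule n).period = 2 ^ n * n :=
  max_eq_right (Nat.mul_pos (by positivity) hn)

/-- The part of the shift in the slot `r` of the window `a` that does not depend on the lowest
`K` bits. -/
def windowShift (n K : ℕ) (a : ℤ) (r : ℕ) : ZMod (2 ^ n) :=
  ∑ k ∈ Finset.Ico K n, (((a % (2 ^ (n - K) : ℕ)).toNat / 2 ^ (k - K) % 2 : ℕ) : ZMod (2 ^ n)) *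
    2 ^ ((r + k) % n)

/-- In the aligned window `a` the high n - K bits of the rotated number depend on `a` only, while
the low K bits are the free `x`. Rotation by `r` puts the latter in the places r, …, r + K - 1
modulo n. -/
theorem shiftAt_rotationSchedule (hn : 0 < n) {K : ℕ} (hK : K ≤ n) (a : ℤ) {x r : ℕ}
    (hx : x < 2 ^ K) (hr : r < n) :
    (rotationSchedule n).shiftAt ((2 ^ K * n : ℕ) * a + (r + n * x : ℕ)) = windowShift n K a r +
      ∑ k ∈ Finset.range K, ((x / 2 ^ k % 2 : ℕ) : ZMod (2 ^ n)) * 2 ^ ((r + k) % n) := by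
  have hpow : 2 ^ n = 2 ^ K * 2 ^ (n - K) := by rw [← pow_add, Nat.add_sub_cancel' hK]
  have hpos : (0 : ℤ) < (2 ^ (n - K) : ℕ) := by positivity
  obtain ⟨b, hb⟩ := Int.eq_ofNat_of_zero_le (Int.emod_nonneg a hpos.ne')
  have hb' : b < 2 ^ (n - K) := by
    have := Int.emod_lt_of_pos a hpos
    omega
  have ha : a = b + (2 ^ (n - K) : ℕ) * (a / (2 ^ (n - K) : ℕ)) := by
    rw [← hb, Int.emod_add_mul_ediv]
  have hm : b * 2 ^ K + x < 2 ^ n := by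
    have h1 : (b + 1) * 2 ^ K ≤ 2 ^ (n - K) * 2 ^ K := Nat.mul_le_mul_right _ hb'
    rw [hpow, mul_comm (2 ^ K)]
    rw [add_mul] at h1
    omega
  have hu : (r + n * (b * 2 ^ K + x)) < 2 ^ n * n := by
    have h1 : n * (b * 2 ^ K + x + 1) ≤ n * 2 ^ n := Nat.mul_le_mul_left _ hm
    rw [mul_comm (2 ^ n)]
    rw [mul_add] at h1
    omega
  have hmod : (((2 ^ K * n : ℕ) * a + (r + n * x : ℕ)) % ((rotationSchedule n).period : ℤ)).toNat =
      r + n * (b * 2 ^ K + x) := by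
    rw [period_rotationSchedule hn]
    have : ((2 ^ K * n : ℕ) * a + (r + n * x : ℕ) : ℤ) = (r + n * (b * 2 ^ K + x) : ℕ) +
        (2 ^ n * n : ℕ) * (a / (2 ^ (n - K) : ℕ)) := by
      conv_lhs => rw [ha]
      rw [hpow]
      push_cast
      ring
    rw [this, Int.add_mul_emod_self_left, Int.emod_eq_of_lt (by positivity) (by exact_mod_cast hu),
      Int.toNat_natCast]
  have hshift : (rotationSchedule n).shiftAt ((2 ^ K * n : ℕ) * a + (r + n * x : ℕ)) =
      (bitRotate n r (b * 2 ^ K + x) : ℕ) := by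
    rw [ShiftSchedule.shiftAt]
    simp only [rotationSchedule]
    have h1 : (((2 ^ K * n : ℕ) * a + (r + n * x : ℕ)) %
        ((max 1 (2 ^ n * n) : ℕ) : ℤ)).toNat = r + n * (b * 2 ^ K + x) := hmod
    rw [h1, Nat.add_mul_mod_self_left, Nat.mod_eq_of_lt hr, Nat.add_mul_div_left _ _ hn,
      Nat.div_eq_of_lt hr, zero_add]
  rw [hshift, bitRotate, windowShift, hb, ← Finset.sum_range_add_sum_Ico _ hK, add_comm]
  push_cast
  congr 1
  · refine Finset.sum_congr rfl fun k hk => ?_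
    obtain ⟨hk1, hk2⟩ := Finset.mem_Ico.1 hk
    have : (b * 2 ^ K + x) / 2 ^ k = b / 2 ^ (k - K) := by
      rw [show 2 ^ k = 2 ^ K * 2 ^ (k - K) by rw [← pow_add, Nat.add_sub_cancel' hk1],
        ← Nat.div_div_eq_div_mul, mul_comm b, Nat.mul_add_div (by positivity),
        Nat.div_eq_of_lt hx, add_zero]
    rw [this]
    simp
  · refine Finset.sum_congr rfl fun k hk => ?_
    have hk := Finset.mem_range.1 hk
    have : (b * 2 ^ K + x) / 2 ^ k % 2 = x / 2 ^ k % 2 := by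
      have h1 : b * 2 ^ K = 2 ^ k * (2 * (b * 2 ^ (K - k - 1))) := by
        rw [show 2 ^ K = 2 ^ k * (2 * 2 ^ (K - k - 1)) by
          rw [← pow_succ', ← pow_add]
          congr 1
          omega]
        ring
      rw [h1, Nat.mul_add_div (by positivity), Nat.mul_add_mod]
    rw [this]

/-- The slots that are used in consecutive windows: the type of the slots advances by `K`, and
the bits choose among the slots of that type. -/
def rotationSlot {h K : ℕ} (i : Fin n) (β : Fin h → Fin K → Fin 2) (j : Fin h) :
    Fin (2 ^ K * n) :=
  finProdFinEquiv (finFunctionFinEquiv (β j),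
    ⟨(i + j * K) % n, Nat.mod_lt _ ((Nat.zero_le _).trans_lt i.2)⟩)

theorem exists_blockSum_rotationSlot (hn : 0 < n) {h K : ℕ} (hK : K ≤ n) (a : ℤ) (i : Fin n) :
    ∃ d : ZMod (2 ^ n), ∀ β : Fin h → Fin K → Fin 2,
      blockSum (rotationSchedule n).shiftAt ((2 ^ K * n : ℕ) * a) (rotationSlot i β) =
        d + ∑ j, ∑ k, ((β j k : ℕ) : ZMod (2 ^ n)) * 2 ^ (((i : ℕ) + (j * K + k)) % n) := by
  refine ⟨∑ j : Fin h, windowShift n K (a + (j : ℕ)) ((i + j * K) % n), fun β => ?_⟩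
  rw [blockSum, ← Finset.sum_add_distrib]
  refine Finset.sum_congr rfl fun j _ => ?_
  have h1 : ((2 ^ K * n : ℕ) * a + (j * (2 ^ K * n) + rotationSlot i β j : ℕ) : ℤ) =
      (2 ^ K * n : ℕ) * (a + (j : ℕ)) +
        ((i + j * K) % n + n * finFunctionFinEquiv (β j) : ℕ) := by
    rw [rotationSlot, finProdFinEquiv_apply_val]
    push_cast
    ring
  rw [h1, shiftAt_rotationSchedule hn hK _ (Fin.is_lt _) (Nat.mod_lt _ hn), Finset.sum_range]
  congr 1
  refine Finset.sum_congr rfl fun k _ => ?_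
  have h2 : (finFunctionFinEquiv (β j) : ℕ) / 2 ^ (k : ℕ) % 2 = β j k :=
    congrArg Fin.val (congrFun (finFunctionFinEquiv.symm_apply_apply (β j)) k)
  rw [h2, Nat.mod_add_mod, add_assoc]

/-- The slot of the hop `j` determines the initial type `i` and the bits `β j`; only the bits of the
other h - 1 windows remain free. -/
theorem card_rotationSlot_eq_le {h K : ℕ} (j : Fin h) (v : Fin (2 ^ K * n)) :
    (Finset.univ.filter fun x : Fin n × (Fin h → Fin K → Fin 2) =>
      rotationSlot x.1 x.2 j = v).card * 2 ^ K ≤ 2 ^ (h * K) := by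
  have hcard : Fintype.card ({i : Fin h // i ≠ j} → Fin K → Fin 2) * 2 ^ K = 2 ^ (h * K) := by
    have h1 := Fintype.card_congr (Equiv.funSplitAt j (Fin K → Fin 2))
    simp only [Fintype.card_prod, Fintype.card_pi, Fintype.card_fin, Finset.prod_const,
      Finset.card_univ] at h1
    rw [Fintype.card_fun, Fintype.card_fun, Fintype.card_fin, Fintype.card_fin, mul_comm, ← h1,
      ← pow_mul, mul_comm]
  rw [← hcard]
  refine Nat.mul_le_mul_right _ ?_
  rw [← Finset.card_univ]
  refine Finset.card_le_card_of_injOn (fun x i => x.2 i) (fun _ _ => Finset.mem_univ _) ?_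
  rintro ⟨i, β⟩ hx ⟨i', β'⟩ hx' hxx
  simp only [Finset.coe_filter, Finset.mem_univ, true_and, Set.mem_ofPred_eq] at hx hx'
  have h1 := finProdFinEquiv.injective (hx.trans hx'.symm)
  rw [Prod.mk.injEq, finFunctionFinEquiv.injective.eq_iff, Fin.mk.injEq, add_comm,
    add_comm (i' : ℕ)] at h1
  refine Prod.ext (Fin.ext (add_mod_inj i.2 i'.2 h1.2)) (funext fun k => ?_)
  rcases eq_or_ne k j with rfl | hk
  · exact h1.1
  · exact congrFun hxx ⟨k, hk⟩

/-- The weight of one choice of bits in `rotationRoute`. -/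
def rotationWeight (n h K : ℕ) : ℝ≥0∞ := ((n : ℝ≥0∞) * 2 ^ (h * K))⁻¹

theorem mul_rotationWeight (hn : 0 < n) (h K : ℕ) :
    (n : ℝ≥0∞) * 2 ^ (h * K) * rotationWeight n h K = 1 := by
  refine ENNReal.mul_inv_cancel ?_ (by finiteness)
  have : (n : ℝ≥0∞) ≠ 0 := by exact_mod_cast hn.ne'
  exact mul_ne_zero this (by positivity)

theorem exists_wait {B : ℕ} (hB : 0 < B) (t : ℤ) : ∃ w₀ : Fin B,
    (∃ a : ℤ, t + (w₀ : ℕ) = B * a) ∧ ∀ w : Fin B, (B : ℤ) ∣ t + (w : ℕ) ↔ w = w₀ := by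
  have hB' : (0 : ℤ) < B := by exact_mod_cast hB
  have h1 := Int.emod_nonneg (-t) hB'.ne'
  have h2 := Int.emod_lt_of_pos (-t) hB'
  obtain ⟨v, hv⟩ := Int.eq_ofNat_of_zero_le h1
  have hdvd : (B : ℤ) ∣ t + (v : ℕ) := by
    have := Int.emod_add_mul_ediv (-t) B
    exact ⟨-(-t / B), by rw [← hv]; linarith⟩
  refine ⟨⟨v, by omega⟩, hdvd, fun w => ⟨fun hw => ?_, fun hw => hw ▸ hdvd⟩⟩
  have h3 : (B : ℤ) ∣ (w : ℕ) - (v : ℕ) := by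
    have := dvd_sub hw hdvd
    rwa [add_sub_add_left_eq_sub] at this
  have h4 := Int.eq_zero_of_abs_lt_dvd h3 (by
    have := w.2
    rw [abs_lt]
    omega)
  exact Fin.ext (by simp only; omega)

/-- Wait for the start of the next window, then take one hop in each of `h` consecutive windows. -/
def rotationRoute (hn : 0 < n) {h K : ℕ} (hK : K ≤ n) (hhK : n ≤ h * K) :
    SemiRoute (rotationSchedule n) ((h + 1) * (2 ^ K * n)) h where
  Ω := Fin (2 ^ K * n) × Fin n × (Fin h → Fin K → Fin 2)
  off _ ω := hopSet ω.1 (rotationSlot ω.2.1 ω.2.2)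
  weight t ω := if ((2 ^ K * n : ℕ) : ℤ) ∣ t + (ω.1 : ℕ) then rotationWeight n h K else 0
  off_lt t ω i hi := by
    have h1 := (mem_hopSet hi).2
    have h2 := ω.1.2
    rw [add_mul, one_mul]
    omega
  off_periodic _ _ := rfl
  weight_periodic t ω := by
    refine if_congr ?_ rfl rfl
    rw [period_rotationSchedule hn, add_right_comm]
    refine (Int.dvd_add_left (Int.natCast_dvd_natCast.2 ?_))
    exact Nat.mul_dvd_mul_right (pow_dvd_pow 2 hK) n
  uniform t c := by
    have hB : 0 < 2 ^ K * n := by positivity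
    obtain ⟨w₀, ⟨a, ha⟩, hw₀⟩ := exists_wait hB t
    simp only [hw₀]
    rw [Fintype.sum_prod_type, Fintype.sum_eq_single w₀ fun w hw => by simp [hw]]
    simp only [if_true, disp_hopSet, ha]
    refine ENNReal.eq_inv_of_mul_eq_one_left ?_
    rw [Fintype.sum_prod_type, Finset.sum_mul]
    have key : ∀ i : Fin n, (∑ β : Fin h → Fin K → Fin 2,
        if blockSum (rotationSchedule n).shiftAt ((2 ^ K * n : ℕ) * a) (rotationSlot i β) = c then
          rotationWeight n h K else 0) * (2 ^ n : ℕ) = 2 ^ (h * K) * rotationWeight n h K := by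
      intro i
      obtain ⟨d, hd⟩ := exists_blockSum_rotationSlot hn (h := h) hK a i
      simp only [hd, ← eq_sub_iff_add_eq']
      rw [← Finset.sum_filter, Finset.sum_const, nsmul_eq_mul, card_bit_blocks, mul_right_comm]
      congr 1
      rw [mul_comm]
      exact_mod_cast two_pow_mul_bitCount hhK i (c - d)
    rw [Finset.sum_congr rfl fun i _ => key i, Finset.sum_const, Finset.card_univ,
      Fintype.card_fin, nsmul_eq_mul, ← mul_assoc, mul_rotationWeight hn]
  load u := by
    refine (tsum_load_le _ _ u).trans ?_
    have hB : 0 < 2 ^ K * n := by positivity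
    obtain ⟨v, -, hv⟩ := exists_wait hB (-u)
    -- The waiting time cancels: whatever `w` and `j` are, a hop at time `u` has positive weight
    -- exactly if its slot within the window is the slot `v` of `u`.
    have hcond : ∀ (w : ℕ) (j : Fin h) (x : Fin (2 ^ K * n)),
        (if ((2 ^ K * n : ℕ) : ℤ) ∣ u - (w + (j * (2 ^ K * n) + x) : ℕ) + w then
          rotationWeight n h K else 0) = if x = v then rotationWeight n h K else 0 := by
      intro w j x
      refine if_congr ?_ rfl rfl
      rw [← hv x, ← dvd_neg, show -(u - (w + (j * (2 ^ K * n) + x) : ℕ) + w : ℤ) =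
        -u + x + (2 ^ K * n : ℕ) * (j : ℕ) by push_cast; ring]
      exact Int.dvd_add_left (dvd_mul_right _ _)
    have hload : ∀ f : Fin n × (Fin h → Fin K → Fin 2) → ℝ≥0∞,
        ∑ ω : Fin (2 ^ K * n) × Fin n × (Fin h → Fin K → Fin 2), f ω.2 =
          (2 ^ K * n : ℕ) * ∑ y, f y := by
      intro f
      simp [Fintype.sum_prod_type]
    simp only [sum_hopSet, hcond]
    rw [hload fun y => ∑ j, if rotationSlot y.1 y.2 j = v then rotationWeight n h K else 0,
      Finset.sum_comm, Finset.mul_sum]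
    -- For each `j`, the 2^K n waiting times and at most 2^((h-1)K) choices per slot, each of weight
    -- 1/(n 2^(hK)), add up to at most 1. The random initial type is what spreads the hops over all
    -- slots.
    calc _ ≤ ∑ _j : Fin h, (1 : ℝ≥0∞) := Finset.sum_le_sum fun j _ => ?_
      _ = h := by simp
    rw [← Finset.sum_filter, Finset.sum_const, nsmul_eq_mul, ← mul_rotationWeight hn h K,
      ← mul_assoc]
    refine mul_le_mul' ?_ le_rfl
    have h1 := Nat.mul_le_mul_left n (card_rotationSlot_eq_le j v)
    rw [mul_comm _ (2 ^ K), mul_left_comm, ← mul_assoc] at h1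
    exact_mod_cast h1

end RotationSchedule

/-! ### Throughput, latency and computation of the rotation schedule -/

section Deterministic

theorem supportsAllHopCounts_rotationSchedule (n : ℕ) [NeZero (2 ^ n)] {ε : ℝ} (hε : 0 < ε) :
    SupportsAllHopCounts (rotationSchedule n) (fun h => 1 / (2 * (h : ℝ)) * (1 - ε))
      (fun h => 48 * (Lstar h (2 ^ n) * Real.log ((2 ^ n : ℕ) : ℝ))) := by
  intro h hh h2
  obtain ⟨hN, hle⟩ := two_le_of_hops hh h2
  have hclog : Nat.clog 2 (2 ^ n) = n := Nat.clog_pow 2 n (by norm_num)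
  rw [hclog] at hle
  have hn : 0 < n := hh.trans hle
  have hh0 : (0 : ℝ) < h := by exact_mod_cast hh
  have hh1 : (1 : ℝ) ≤ h := by exact_mod_cast hh
  set K := n ⌈/⌉ h with hK
  have hKn : K ≤ n := (ceilDiv_le_iff_le_mul hh).2 (Nat.le_mul_of_pos_left n hh)
  have hhK : n ≤ h * K := (ceilDiv_le_iff_le_mul hh).1 le_rfl
  have hroot : 2 ^ K = hopRoot (2 ^ n) h := by rw [hopRoot, hclog]
  let Q := rotationRoute hn hKn hhK
  refine ⟨Q.routing, Q.isObliviousRouting (by positivity), Q.guaranteesThroughput ?_,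
    Q.maxLatency_routing_le.trans (natCast_le_ofReal ?_)⟩
  · rw [show (2 * (h : ℝ≥0∞)) = ENNReal.ofReal (2 * h) by
      rw [ENNReal.ofReal_mul (by norm_num), ENNReal.ofReal_natCast]
      norm_num, ← ENNReal.ofReal_mul' (by positivity), ← ENNReal.ofReal_one]
    refine ENNReal.ofReal_le_ofReal ?_
    rw [mul_right_comm, one_div_mul_cancel (by positivity)]
    linarith
  · have h3 := hopRoot_le_rpow hN hh
    have h4 := clog_le_log hN
    rw [hclog] at h4
    rw [hroot]
    simp only [Lstar]
    push_cast
    push_cast at h3 h4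
    -- The constant is 48 = 2 · 2 · 4 · 3: two halves, h + 1 ≤ 2h, the rounding of the root, and n ≤
    -- 3 log N.
    calc 2 * (((h : ℝ) + 1) * (hopRoot (2 ^ n) h * n))
        ≤ 2 * ((h + h) * (4 * ((2 : ℝ) ^ n) ^ (1 / (h : ℝ)) * (3 * Real.log (2 ^ n)))) := by
          gcongr
      _ = _ := by ring

/-- Replace `reg 6` by its rotation by one place, as a number with `log₂ (reg 0)` bits. -/
def rotateProg : Prog :=
  .add 6 6 6 ;; .sub 8 0 6 ;; .ite 8 (.const 21 0) (.sub 6 6 0 ;; .add 6 6 3)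

/-- Write all rotations of `reg 5` to the output. -/
def rotationsProg : Prog :=
  .add 6 5 2 ;; .add 33 26 2 ;; Prog.rep 33 (.store 0 4 6 ;; .add 4 4 3 ;; rotateProg) ;;
    .add 5 5 3

/-- The program that computes `rotationSchedule`. -/
def rotationProg : Prog :=
  .const 2 0 ;; .const 3 1 ;; clogProg ;; .const 4 0 ;; .const 5 0 ;; .add 31 0 2 ;;
    Prog.rep 31 rotationsProg ;; .add 1 4 2 ;; .ite 1 (.const 21 0) (.const 1 1)

variable {n : ℕ}

/-- The first `T` entries of array 0 are those of `rotationSchedule`, and the others are zero. -/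
def Written (n T : ℕ) (st : MachineState) : Prop :=
  ∀ q, st.arr 0 q = if q < T then bitRotate n (q % n) (q / n) else 0

theorem runs_rotateProg {st : MachineState} {r m : ℕ} (hn : 0 < n) (h0 : st.reg 0 = 2 ^ n)
    (h3 : st.reg 3 = 1) (h6 : st.reg 6 = bitRotate n r m) :
    Runs rotateProg 5 st fun st' => st'.reg 6 = bitRotate n (r + 1) m := by
  have hs := bitRotate_succ hn r m
  refine Runs.basic_seq rfl (Runs.basic_seq rfl (Runs.ite (fun h => Runs.basic rfl ?_) fun h =>
    Runs.basic_seq rfl (Runs.basic (B := 0) rfl ?_)))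
  · simp [h0, h6] at h
    rw [if_neg (by omega)] at hs
    simp [h6, hs, two_mul]
  · simp [h0, h6] at h
    rw [if_pos (by omega)] at hs
    simp [h6, hs, two_mul, h0, h3]

theorem runs_rotationsProg {st : MachineState} {j : ℕ} (hj : j < 2 ^ n) (h0 : st.reg 0 = 2 ^ n)
    (h2 : st.reg 2 = 0) (h3 : st.reg 3 = 1) (h26 : st.reg 26 = n) (h4 : st.reg 4 = j * n)
    (h5 : st.reg 5 = j) (hw : Written n (j * n) st) :
    Runs rotationsProg (n * 9 + 4) st fun st' => st'.reg 4 = (j + 1) * n ∧ st'.reg 5 = j + 1 ∧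
      Written n ((j + 1) * n) st' := by
  refine Runs.basic_seq rfl (Runs.basic_seq rfl (Runs.weaken (B := n * (7 + 2) + 1 + (0 + 1)) ?_
    (by omega)))
  refine Runs.seq ?_
  refine Runs.rep (c := 33) (p := .store 0 4 6 ;; .add 4 4 3 ;; rotateProg) (fun i st' =>
    st'.reg 4 = j * n + i ∧ st'.reg 6 = bitRotate n i j ∧ Written n (j * n + i) st')
    ?_ ?_ (by decide) (by decide) (by norm_num) ?_ ?_ ?_ ?_
  · simp [h26, h2]
  · simp [h3]
  · refine ⟨by simp [h4], ?_, hw⟩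
    simp [h5, h2, bitRotate_zero hj]
  · rintro i st' v ⟨e4, e6, ew⟩
    exact ⟨by simpa using e4, by simpa using e6, ew⟩
  · rintro i hi st' hf ⟨e4, e6, ew⟩
    have e0 : st'.reg 0 = 2 ^ n := by
      rw [hf.1 0 (by decide)]
      simpa using h0
    have e3 : st'.reg 3 = 1 := by
      rw [hf.1 3 (by decide)]
      simpa using h3
    refine Runs.basic_seq rfl (Runs.basic_seq rfl ?_)
    refine (runs_rotateProg (n := n) (r := i) (m := j) (by omega) ?_ ?_ ?_).mono le_rfl ?_
    · simpa using e0
    · simpa using e3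
    · simpa using e6
    rintro st'' hf'' f6
    refine ⟨?_, f6, fun q => ?_⟩
    · rw [hf''.1 4 (by decide)]
      simp [e4, e3, add_assoc]
    · rw [hf''.2 0 (by decide)]
      have hq : st'.arr 0 q = _ := ew q
      simp only [Prog.effect, MachineState.arr_setReg, MachineState.arr_setArr, if_true,
        Function.update_apply, e4, e6, hq]
      rcases lt_trichotomy q (j * n + i) with h | h | h
      · rw [if_neg h.ne, if_pos h, if_pos (by omega)]
      · rw [if_pos h, if_pos (by omega), h, Nat.mul_add_mod_self_right, Nat.mod_eq_of_lt hi,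
          mul_comm j, Nat.mul_add_div (by omega), Nat.div_eq_of_lt hi, add_zero]
      · rw [if_neg h.ne', if_neg (by omega), if_neg (by omega)]
  · rintro st' hf ⟨e4, e6, ew⟩
    have e5 : st'.reg 5 = j := by
      rw [hf.1 5 (by decide)]
      simpa using h5
    have e3 : st'.reg 3 = 1 := by
      rw [hf.1 3 (by decide)]
      simpa using h3
    rw [add_mul, one_mul]
    refine Runs.basic rfl ⟨by simpa using e4, by simp [e5, e3], ew⟩

/-- A bound for the running time of `rotationProg`. -/
def rotationTime (N : ℕ) : ℕ := N * (N * 9 + 6) + N * 6 + 13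

theorem computesWithin_rotationProg (n : ℕ) : ComputesWithin rotationProg
    (Fin.elim0 : Fin 0 → ZMod (2 ^ n)) (rotationSchedule n) (rotationTime (2 ^ n)) := by
  suffices H : Runs rotationProg (rotationTime (2 ^ n))
      (inputState (2 ^ n) (Fin.elim0 : Fin 0 → ZMod (2 ^ n))) fun st =>
      IsOutput st (rotationSchedule n) from H
  obtain ⟨τ, hτ⟩ : ∃ τ, τ = 2 ^ n * (n * 9 + 4 + 2) + 1 := ⟨_, rfl⟩
  refine Runs.weaken (B := 2 ^ n * 6 + 4 + (τ + (2 + 1) + 1 + 1 + 1) + 1 + 1) ?_ ?_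
  · refine Runs.basic_seq rfl (Runs.basic_seq rfl (Runs.seq ?_))
    refine (runs_clogProg (N := 2 ^ n) ?_ ?_ ?_).mono le_rfl fun st₁ hf₁ e26 => ?_
    · simp [inputState]
    · simp [inputState]
    · simp
    rw [Nat.clog_pow 2 n (by norm_num)] at e26
    have e0 : st₁.reg 0 = 2 ^ n := by
      rw [hf₁.1 0 (by decide)]
      simp [inputState]
    have e2 : st₁.reg 2 = 0 := by
      rw [hf₁.1 2 (by decide)]
      simp
    have e3 : st₁.reg 3 = 1 := by
      rw [hf₁.1 3 (by decide)]
      simp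
    have earr : st₁.arr 0 = fun _ => 0 := by
      rw [hf₁.2 0 (by decide)]
      funext q
      simp [inputState]
    refine Runs.basic_seq rfl (Runs.basic_seq rfl (Runs.basic_seq rfl (Runs.seq (B := τ)
      (B' := 2 + 1) ?_)))
    rw [hτ]
    refine Runs.rep (c := 31) (p := rotationsProg) (fun j st' =>
      st'.reg 4 = j * n ∧ st'.reg 5 = j ∧ Written n (j * n) st')
      ?_ ?_ (by decide) (by decide) (by norm_num) ?_ ?_ ?_ ?_
    · simp [e0, e2]
    · simp [e3]
    · exact ⟨by simp, by simp, fun q => by simp [earr]⟩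
    · rintro j st' v ⟨f4, f5, fw⟩
      exact ⟨by simpa using f4, by simpa using f5, fw⟩
    · rintro j hj st' hf ⟨f4, f5, fw⟩
      refine runs_rotationsProg hj ?_ ?_ ?_ ?_ f4 f5 fw
      · rw [hf.1 0 (by decide)]
        simpa using e0
      · rw [hf.1 2 (by decide)]
        simpa using e2
      · rw [hf.1 3 (by decide)]
        simpa using e3
      · rw [hf.1 26 (by decide)]
        simpa using e26
    · rintro st' hf ⟨f4, f5, fw⟩
      have f2 : st'.reg 2 = 0 := by
        rw [hf.1 2 (by decide)]
        simpa using e2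
      have hout : ∀ st'' : MachineState, st''.reg 1 = max 1 (2 ^ n * n) → st''.arr = st'.arr →
          IsOutput st'' (rotationSchedule n) := by
        intro st'' h1 h2
        refine ⟨h1, fun i => ?_⟩
        rw [h2, fw i]
        have hi : (i : ℕ) < max 1 (2 ^ n * n) := i.2
        have hval : ((rotationSchedule n).shift i).val = bitRotate n (i % n) (i / n) :=
          ZMod.val_cast_of_lt (bitRotate_lt _ _)
        rw [hval]
        split_ifs with h
        · rfl
        -- For n = 0 nothing is written, but the period is 1; the untouched zero cell is the correct
        -- shift.
        · rcases Nat.eq_zero_or_pos n with rfl | hn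
          · simp [bitRotate]
          · rw [max_eq_right (Nat.mul_pos (by positivity) hn)] at hi
            exact absurd hi h
      refine Runs.basic_seq rfl (Runs.ite (fun h => Runs.basic rfl (hout _ ?_ rfl)) fun h =>
        Runs.basic rfl (hout _ ?_ rfl))
      · simp [f4, f2] at h ⊢
        exact Nat.mul_pos (by positivity) (Nat.pos_of_ne_zero h)
      · simp [f4, f2] at h ⊢
        simp [h]
  · have h1 : n ≤ 2 ^ n := Nat.lt_two_pow_self.le
    have h2 : 2 ^ n * (n * 9 + 4 + 2) ≤ 2 ^ n * (2 ^ n * 9 + 6) := Nat.mul_le_mul_left _ (by omega)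
    rw [rotationTime]
    omega

theorem isPolynomial_rotationTime : IsPolynomial rotationTime := by
  unfold rotationTime
  repeat' first
    | exact IsPolynomial.const _
    | exact IsPolynomial.id
    | apply IsPolynomial.add
    | apply IsPolynomial.mul

theorem exists_deterministic {ε : ℝ} (hε : 0 < ε) :
    ∃ (G : Prog) (q : Polynomial ℕ) (C : ℝ), ∀ (N : ℕ) [NeZero N], (∃ n : ℕ, N = 2 ^ n) →
      ∃ s : ShiftSchedule N,
        ComputesWithin G (Fin.elim0 : Fin 0 → ZMod N) s (q.eval N) ∧
        SupportsAllHopCounts s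
          (fun h => 1 / (2 * (h : ℝ)) * (1 - ε))
          (fun h => C * (Lstar h N * Real.log N)) := by
  obtain ⟨q, hq⟩ := isPolynomial_rotationTime
  refine ⟨rotationProg, q, 48, ?_⟩
  rintro N _ ⟨n, rfl⟩
  refine ⟨rotationSchedule n, ?_, supportsAllHopCounts_rotationSchedule n hε⟩
  rw [hq]
  exact computesWithin_rotationProg n

end Deterministic

end

theorem theorem1 (ε : ℝ) (hε : 0 < ε) :
    -- (1) uniformly random shift schedule, multiplicative error
    (∃ (G V : Prog) (q : Polynomial ℕ) (k : ℕ) (C : ℝ) (N₀ : ℕ), ∀ (N : ℕ) [NeZero N], N₀ ≤ N →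
      ∃ (T : ℕ) (hT : 0 < T) (hm : T ≤ N ^ k),
        SamplesAndCertifies G V q
          (fun w : Fin (N ^ k) → ZMod N => ShiftSchedule.ofPrefix w T hT hm)
          (fun s => SupportsAllHopCounts s
            (fun h => 1 / (2 * (h : ℝ)) * (1 - ε))
            (fun h => C * (Lstar h N * Real.log N)))) ∧
    -- (2) convolution power of a uniformly random base schedule, additive error
    (∃ (G V : Prog) (q : Polynomial ℕ) (k H : ℕ) (C : ℝ) (N₀ : ℕ), 0 < H ∧
      ∀ (N : ℕ) [NeZero N], N₀ ≤ N →
      ∃ (L : ℕ) (hL : 0 < L) (hm : L ≤ N ^ k),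
        SamplesAndCertifies G V q
          (fun w : Fin (N ^ k) → ZMod N => (ShiftSchedule.ofPrefix w L hL hm).convPow H)
          (fun s => SupportsAllHopCounts s
            (fun h => 1 / (2 * (h : ℝ)) - ε)
            (fun h => C * Lstar h N))) ∧
    -- (3) deterministic schedule for powers of two, multiplicative error
    (∃ (G : Prog) (q : Polynomial ℕ) (C : ℝ), ∀ (N : ℕ) [NeZero N], (∃ n : ℕ, N = 2 ^ n) →
      ∃ s : ShiftSchedule N,
        ComputesWithin G (Fin.elim0 : Fin 0 → ZMod N) s (q.eval N) ∧
        SupportsAllHopCounts s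
          (fun h => 1 / (2 * (h : ℝ)) * (1 - ε))
          (fun h => C * (Lstar h N * Real.log N))) :=
  ⟨exists_randomized_mul hε, exists_randomized_sub hε, exists_deterministic hε⟩
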